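/- Let $0<p<\infty$, let $\mathbb D$ be the open unit disk and $\eta(z)=(1-|z|^2)^{-2}$. Let $\Gamma,\tilde\Gamma$ be torsion-free Fuchsian groups acting on $\mathbb D$ (for example, groups uniformising analytically finite Riemann surfaces $R=\mathbb D/\Gamma$ and $S=\mathbb D/\tilde\Gamma$), let $\mathcal I:\Gamma\to\tilde\Gamma$ be an isomorphism and let $\mathcal P\subset\mathbb D$ be a (measurable) fundamental domain for $\Gamma$, for instance a convex fundamental polyhedron. For a map $f$ of finite distortion put $$\mathbb K(z,f)=\frac{|f_z|^2+|f_{\bar z}|^2}{|f_z|^2-|f_{\bar z}|^2}\ \text{ where } J(z,f)=|f_z|^2-|f_{\bar z}|^2\neq 0,\qquad \mathbb K(z,f)=1\ \text{ elsewhere},$$ $$\mathcal E_p(f)=\int_{\mathcal P}\exp(p\,\mathbb K(z,f))\,\eta(z)\,dz,\qquad \mu_f=\frac{f_{\bar z}}{f_z}.$$ Let $\mathcal F_p$ be the class of homeomorphisms $f:\mathbb D\to\mathbb D$ in $W^{1,1}_{loc}(\mathbb D)$ which are of finite distortion (i.e. $J(\cdot,f)\in L^1_{loc}(\mathbb D)$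 and $|Df|^2\le K\,J(\cdot,f)$ almost everywhere for some finite measurable function $K$, with $|Df|$ the operator norm), satisfy $\mathcal E_p(f)<\infty$, and satisfy $\mathcal I(\gamma)\circ f=f\circ\gamma$ for all $\gamma\in\Gamma$. Let $f\in\mathcal F_p$ minimise $\mathcal E_p$ in $\mathcal F_p$, and suppose that $f$ is a smooth diffeomorphism of $\mathbb D$. Let $h=f^{-1}$. Then: 1. $f_z\neq 0$ on $\mathbb D$, the Beltrami coefficient $\mu=\mu_f$ is smooth with $|\mu|<1$ on $\mathbb D$, and everywhere in $\mathbb D$ $$\gamma(|\mu|)\,\mu_z=\alpha(|\mu|)\,\bar\mu\,\mu_{\bar z}-\beta(|\mu|)\,\mu^2\,\overline{\mu_{\bar z}}+\phi,$$ where $$\gamma(t)=1+(4p-3)t^2+(4p^2-4p+3)t^4-t^6,\quad \alpha(t)=(1-t^2)^3,\quad \beta(t)=2p(1+2pt^2-t^4),$$ $$\phi=-(1-|\mu|^2)^2\bigl(1+(2p-1)|\mu|^2\bigr)\,\mu\,\frac{\eta_z}{\eta}-(1-|\mu|^2)^3|\mu|^2\,\frac{\eta_{\bar z}}{\eta}.$$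 2. $h_w\ne0$ on $\mathbb D$, the function $\Phi=\exp(p\,\mathbb K(w,h))\,h_w\,\overline{h_{\bar w}}\,\eta(h)$ is holomorphic in $\mathbb D$, and $$\mu_h=|\mu_h|\,\frac{\overline\Phi}{|\Phi|}$$ at every point of $\mathbb D$ where $\Phi\neq0$, while $\mu_h=0$ where $\Phi=0$. 3. With $\lambda(z)=\exp(p\,\mathbb K(z,f))\,\eta(z)$, everywhere in $\mathbb D$ $$h_{w\bar w}+(\log\lambda)_z(h)\,h_w\,h_{\bar w}=0 .$$ 4. $\lambda(z)|dz|^2$ is a smooth Riemannian metric on $\mathbb D$, and $h$ is a harmonic map from $\mathbb D$ (with the Euclidean metric) to $(\mathbb D,\lambda(z)|dz|^2)$, that is, its tension field vanishes. -/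

import Mathlib

open MeasureTheory Complex
open scoped ContDiff ENNReal ComplexConjugate

namespace ExpDistortion

noncomputable section

/-! ### Wirtinger derivatives and distortion -/

/-- `A_z = (A(1) - i A(i)) / 2`, the complex-linear part of a real-linear map `A : ℂ → ℂ`. -/
def linZ (A : ℂ →L[ℝ] ℂ) : ℂ := (A 1 - I * A I) / 2

/-- `A_z̄ = (A(1) + i A(i)) / 2`, the complex-antilinear part of a real-linear map `A`. -/
def linZbar (A : ℂ →L[ℝ] ℂ) : ℂ := (A 1 + I * A I) / 2

/-- The Jacobian determinant `|A_z|² - |A_z̄|²`. -/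
def jac (A : ℂ →L[ℝ] ℂ) : ℝ := ‖linZ A‖ ^ 2 - ‖linZbar A‖ ^ 2

/-- The distortion `𝕂 = (|A_z|² + |A_z̄|²) / J`, set to `1` where the Jacobian vanishes. -/
def distortion (A : ℂ →L[ℝ] ℂ) : ℝ :=
  open Classical in
  if jac A ≠ 0 then (‖linZ A‖ ^ 2 + ‖linZbar A‖ ^ 2) / jac A else 1

/-- The Wirtinger derivative `F_z`. -/
def dz (F : ℂ → ℂ) (z : ℂ) : ℂ := linZ (fderiv ℝ F z)

/-- The Wirtinger derivative `F_z̄`. -/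
def dzbar (F : ℂ → ℂ) (z : ℂ) : ℂ := linZbar (fderiv ℝ F z)

/-- The Beltrami coefficient `μ_F = F_z̄ / F_z`. -/
def beltrami (F : ℂ → ℂ) (z : ℂ) : ℂ := dzbar F z / dz F z

/-! ### The disk, its hyperbolic area and Fuchsian groups -/

/-- The open unit disk as a subset of `ℂ`. -/
abbrev disk : Set ℂ := Metric.ball (0 : ℂ) 1

/-- The open unit disk as a type. -/
abbrev Disk : Type := disk

/-- A self-map of the disk as a function on `ℂ`, extended by zero; only its values on the open disk
matter below. -/
def toPlane (f : Disk → Disk) : ℂ → ℂ :=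
  Function.extend (Subtype.val : Disk → ℂ) (fun z => (f z : ℂ)) 0

/-- The hyperbolic density `η(z) = 1 / (1 - |z|²)²`. -/
def eta (z : ℂ) : ℝ := 1 / (1 - ‖z‖ ^ 2) ^ 2

/-- The hyperbolic area measure `η(z) dz` on the disk. -/
def hypArea : Measure Disk :=
  (Measure.comap (Subtype.val : Disk → ℂ) volume).withDensity fun z => ENNReal.ofReal (eta z)

/-- `Γ` is a group of conformal automorphisms of the disk which acts properly discontinuously and
freely, i.e. a torsion-free Fuchsian group, the group of deck transformations of the universal
covering of the Riemann surface `𝔻 / Γ`. -/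
structure IsSurfaceGroup (Γ : Subgroup (Equiv.Perm Disk)) : Prop where
  holomorphic : ∀ γ ∈ Γ, DifferentiableOn ℂ (toPlane γ) disk
  properlyDiscontinuous : ProperlyDiscontinuousSMul Γ Disk
  free : ∀ γ ∈ Γ, ∀ z : Disk, γ z = z → γ = 1

/-! ### Sobolev maps, mappings of finite distortion and the energy -/

/-- `F ∈ W^{1,1}_loc(U)` and `D` is its weak differential on `U`. -/
structure HasWeakDifferential (U : Set ℂ) (F : ℂ → ℂ) (D : ℂ → ℂ →L[ℝ] ℂ) : Prop where
  locInt : LocallyIntegrableOn F U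
  locInt_diff : LocallyIntegrableOn D U
  integral_eq : ∀ φ : ℂ → ℝ, ContDiff ℝ ∞ φ → HasCompactSupport φ → tsupport φ ⊆ U →
    ∀ v : ℂ, ∫ z, fderiv ℝ φ z v • F z = -∫ z, φ z • D z v

/-- A map with weak differential `D` on `U` has finite distortion: its Jacobian is locally
integrable and `|Df|² ≤ K J` almost everywhere (operator norm) for a measurable finite `K`. -/
def FiniteDistortion (U : Set ℂ) (D : ℂ → ℂ →L[ℝ] ℂ) : Prop :=
  LocallyIntegrableOn (fun z => jac (D z)) U ∧
    ∃ K : ℂ → ℝ, Measurable K ∧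
      ∀ᵐ z ∂(volume.restrict U), ‖D z‖ ^ 2 ≤ K z * jac (D z)

/-- The energy `∫_P exp(p 𝕂) η dz` of a map with weak differential `D`. -/
def energy (p : ℝ) (P : Set Disk) (D : ℂ → ℂ →L[ℝ] ℂ) : ℝ≥0∞ :=
  ∫⁻ z in P, ENNReal.ofReal (Real.exp (p * distortion (D z))) ∂hypArea

/-- The class `ℱ_p`: the homeomorphism `f` of the disk is a `W^{1,1}_loc` mapping of finite
distortion, with weak differential `D`, it has finite energy, and it is automorphic with respect to
the isomorphism `θ`. -/
structure Admissible {Γ Γ' : Subgroup (Equiv.Perm Disk)} (θ : Γ ≃* Γ') (p : ℝ) (P : Set Disk)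
    (f : Disk ≃ₜ Disk) (D : ℂ → ℂ →L[ℝ] ℂ) : Prop where
  weak : HasWeakDifferential disk (toPlane f) D
  finiteDistortion : FiniteDistortion disk D
  energy_lt_top : energy p P D < ⊤
  automorphic : ∀ (γ : Γ) (z : Disk), f (γ • z) = θ γ • f z

/-- `f` minimises the energy in the class `ℱ_p`. -/
def IsMinimiser {Γ Γ' : Subgroup (Equiv.Perm Disk)} (θ : Γ ≃* Γ') (p : ℝ) (P : Set Disk)
    (f : Disk ≃ₜ Disk) : Prop :=
  ∃ D, Admissible θ p P f D ∧ ∀ g D', Admissible θ p P g D' → energy p P D ≤ energy p P D'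

/-- `f` is a smooth diffeomorphism of the open disk. -/
def IsDiffeo (f : Disk ≃ₜ Disk) : Prop :=
  ContDiffOn ℝ ∞ (toPlane f) disk ∧ ContDiffOn ℝ ∞ (toPlane f.symm) disk

/-! ### The equations -/

def gammaCoeff (p t : ℝ) : ℝ :=
  1 + (4 * p - 3) * t ^ 2 + (4 * p ^ 2 - 4 * p + 3) * t ^ 4 - t ^ 6

def alphaCoeff (t : ℝ) : ℝ := (1 - t ^ 2) ^ 3

def betaCoeff (p t : ℝ) : ℝ := 2 * p * (1 + 2 * p * t ^ 2 - t ^ 4)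

/-- The inhomogeneous term `φ` of the equation for the Beltrami coefficient `μ`. -/
def phiTerm (p : ℝ) (μ : ℂ → ℂ) (z : ℂ) : ℂ :=
  -((1 - ‖μ z‖ ^ 2) ^ 2 * (1 + (2 * p - 1) * ‖μ z‖ ^ 2) : ℝ) * μ z *
      (dz (fun ζ => (eta ζ : ℂ)) z / eta z)
    - ((1 - ‖μ z‖ ^ 2) ^ 3 * ‖μ z‖ ^ 2 : ℝ) * (dzbar (fun ζ => (eta ζ : ℂ)) z / eta z)

/-- `γ(|μ|) μ_z = α(|μ|) μ̄ μ_z̄ - β(|μ|) μ² conj(μ_z̄) + φ` at the point `z`. -/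
def MuEquation (p : ℝ) (μ : ℂ → ℂ) (z : ℂ) : Prop :=
  (gammaCoeff p ‖μ z‖ : ℂ) * dz μ z =
    alphaCoeff ‖μ z‖ * conj (μ z) * dzbar μ z
      - betaCoeff p ‖μ z‖ * μ z ^ 2 * conj (dzbar μ z) + phiTerm p μ z

/-- The Ahlfors–Hopf differential `Φ = exp(p 𝕂(w,h)) h_w conj(h_w̄) η(h)`. -/
def ahlforsHopf (p : ℝ) (H : ℂ → ℂ) (w : ℂ) : ℂ :=
  (Real.exp (p * distortion (fderiv ℝ H w)) : ℂ) * dz H w * conj (dzbar H w) * eta (H w)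

/-- The density `λ(z) = exp(p 𝕂(z,f)) η(z)`. -/
def lam (p : ℝ) (F : ℂ → ℂ) (z : ℂ) : ℝ :=
  Real.exp (p * distortion (fderiv ℝ F z)) * eta z

/-- The tension equation `h_{w w̄} + (log l)_z(h) h_w h_w̄ = 0` at the point `w`. -/
def TensionEquation (l : ℂ → ℝ) (H : ℂ → ℂ) (w : ℂ) : Prop :=
  dzbar (dz H) w + dz (fun ζ => (Real.log (l ζ) : ℂ)) (H w) * dz H w * dzbar H w = 0

/-! ### Harmonic maps between planar domains with Riemannian metrics

The plane `ℂ` carries the real coordinates `x⁰ = re`, `x¹ = im`. -/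

/-- The `i`-th coordinate vector. -/
def coordVec (i : Fin 2) : ℂ := ![1, I] i

/-- The `k`-th coordinate function. -/
def coord (k : Fin 2) (z : ℂ) : ℝ := ![z.re, z.im] k

/-- The partial derivative `∂_i u`. -/
def pd (i : Fin 2) (u : ℂ → ℝ) (z : ℂ) : ℝ := fderiv ℝ u z (coordVec i)

/-- A smooth Riemannian metric on `U ⊆ ℂ`, given by its matrix in the coordinates. -/
def IsMetricOn (U : Set ℂ) (g : ℂ → Matrix (Fin 2) (Fin 2) ℝ) : Prop :=
  (∀ i j, ContDiffOn ℝ ∞ (fun z => g z i j) U) ∧ ∀ z ∈ U, (g z).PosDef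

/-- The Christoffel symbols `Γ^k_{ij}` of the Levi-Civita connection of `g`. -/
def christoffel (g : ℂ → Matrix (Fin 2) (Fin 2) ℝ) (k i j : Fin 2) (z : ℂ) : ℝ :=
  1 / 2 * ∑ l, (g z)⁻¹ k l *
    (pd i (fun ζ => g ζ j l) z + pd j (fun ζ => g ζ i l) z - pd l (fun ζ => g ζ i j) z)

/-- The `k`-th component of the tension field of `H` with respect to the metric `g` on the domain
and `g'` on the target. -/
def tension (g g' : ℂ → Matrix (Fin 2) (Fin 2) ℝ) (H : ℂ → ℂ) (k : Fin 2) (w : ℂ) : ℝ :=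
  ∑ a, ∑ b, (g w)⁻¹ a b *
    (pd a (pd b fun ζ => coord k (H ζ)) w
      - ∑ c, christoffel g c a b w * pd c (fun ζ => coord k (H ζ)) w
      + ∑ i, ∑ j, christoffel g' k i j (H w) *
          pd a (fun ζ => coord i (H ζ)) w * pd b (fun ζ => coord j (H ζ)) w)

/-- `H` is a (smooth) harmonic map from `(U, g)` to `(V, g')`: its tension field vanishes. -/
structure IsHarmonicMap (U : Set ℂ) (g : ℂ → Matrix (Fin 2) (Fin 2) ℝ)
    (V : Set ℂ) (g' : ℂ → Matrix (Fin 2) (Fin 2) ℝ) (H : ℂ → ℂ) : Prop where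
  metric_source : IsMetricOn U g
  metric_target : IsMetricOn V g'
  mapsTo : Set.MapsTo H U V
  smooth : ContDiffOn ℝ ∞ H U
  tension_eq_zero : ∀ w ∈ U, ∀ k, tension g g' H k w = 0

/-- The matrix of the conformal metric `l(z) |dz|²`. -/
def conformalMetric (l : ℂ → ℝ) (z : ℂ) : Matrix (Fin 2) (Fin 2) ℝ :=
  l z • (1 : Matrix (Fin 2) (Fin 2) ℝ)

end

end ExpDistortion

open ExpDistortion

/-! The theorem is an Euler–Lagrange computation for variations `G ∘ f` in the target. Let `G` be a
diffeomorphism that differs from the identity only in a compact part of a small disc `B` disjoint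
from its nontrivial translates under `Γ'`. Conjugating by the group extends `G` to an equivariant
homeomorphism, so `G ∘ f` becomes a competitor (`exists_automorphic_perturbation`). Hyperbolic area
and the distortion of automorphic maps are invariant, so the integral over the fundamental domain
unfolds. After the substitution `z = h(w)`, minimality becomes an inequality between integrals over
`B` (`exists_ball_local_minimality`).

The sign of the Jacobian is not part of the hypotheses: the bound `|Df|² ≤ K J` with `K` of either
sign admits orientation-reversing diffeomorphisms. For these `𝕂 ≤ 0`, and composing with ever
stronger area-preserving twists sends `𝕂` to `-∞` on an open set while the integrand stays bounded.
The energy would drop strictly, so a minimiser has `J > 0` (`jac_pos_of_isMinimiser`).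

With `G = w + tφ(w)` the first variation reads `Re ∫ φ_w̄ Φ = 0` for every complex test function
`φ`. As `Φ` is smooth, this gives `Φ_w̄ = 0` (`dzbar_ahlforsHopf_eq_zero`).

The rest is pointwise calculus. Since `Φ = λ(h) h_w conj(h_w̄)`, one finds `Φ_w̄ = λ(h) (conj(h_w̄)
T + h_w conj T)`, where `T` is the left side of the tension equation; as `|h_w̄| < |h_w|`, it
follows that `T = 0`. Differentiating `h_w̄ = -μ(h) conj(h_w)` and removing the second derivatives
of `h` with `T = 0` leaves a first-order equation for `μ`. It involves `μ_z` and its conjugate;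
eliminating the latter gives the stated equation. Harmonicity is `T = 0` written in real
coordinates. -/

namespace ExpDistortion

noncomputable section

/-! ### Real-linear maps of the plane -/

/-- The real-linear map `v ↦ a v + b v̄`. -/
def wirt (a b : ℂ) : ℂ →L[ℝ] ℂ :=
  a • ContinuousLinearMap.id ℝ ℂ + b • (conjCLE : ℂ →L[ℝ] ℂ)

@[simp] lemma wirt_apply (a b v : ℂ) : wirt a b v = a * v + b * conj v := by
  simp [wirt]

@[simp] lemma linZ_wirt (a b : ℂ) : linZ (wirt a b) = a := by
  simp only [linZ, wirt_apply, map_one, conj_I]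
  linear_combination (-a + b) / 2 * I_sq

@[simp] lemma linZbar_wirt (a b : ℂ) : linZbar (wirt a b) = b := by
  simp only [linZbar, wirt_apply, map_one, conj_I]
  linear_combination (a - b) / 2 * I_sq

lemma ext_one_I {A B : ℂ →L[ℝ] ℂ} (h1 : A 1 = B 1) (hI : A I = B I) : A = B := by
  ext v
  have hv : v = v.re • (1 : ℂ) + v.im • I := by simp [re_add_im]
  rw [hv, map_add, map_add, map_smul, map_smul, map_smul, map_smul, h1, hI]

lemma wirt_lin (A : ℂ →L[ℝ] ℂ) : wirt (linZ A) (linZbar A) = A := by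
  apply ext_one_I
  · simp only [wirt_apply, linZ, linZbar, map_one]; ring
  · simp only [wirt_apply, linZ, linZbar, conj_I]
    linear_combination (-A I) * I_sq

lemma exists_wirt (A : ℂ →L[ℝ] ℂ) : ∃ a b, A = wirt a b := ⟨_, _, (wirt_lin A).symm⟩

lemma wirt_comp (a b c d : ℂ) :
    (wirt a b).comp (wirt c d) = wirt (a * c + b * conj d) (a * d + b * conj c) := by
  ext v
  simp only [ContinuousLinearMap.comp_apply, wirt_apply, map_add, map_mul, conj_conj]
  ring

lemma jac_wirt (a b : ℂ) : jac (wirt a b) = ‖a‖ ^ 2 - ‖b‖ ^ 2 := by simp [jac]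

lemma sq_norm_eq (a : ℂ) : ‖a‖ ^ 2 = a.re ^ 2 + a.im ^ 2 := by
  rw [Complex.sq_norm, normSq_apply]; ring

lemma jac_comp (A B : ℂ →L[ℝ] ℂ) : jac (A.comp B) = jac A * jac B := by
  obtain ⟨a, b, rfl⟩ := exists_wirt A
  obtain ⟨c, d, rfl⟩ := exists_wirt B
  rw [wirt_comp]
  simp only [jac_wirt, sq_norm_eq, add_re, add_im, mul_re, mul_im, conj_re, conj_im]
  ring

lemma jac_id : jac (ContinuousLinearMap.id ℝ ℂ) = 1 := by
  have : ContinuousLinearMap.id ℝ ℂ = wirt 1 0 := by ext v; simp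
  rw [this, jac_wirt]; simp

/-- Links the Wirtinger form of the Jacobian to the determinant in the change of variables formula.
-/
lemma det_eq_jac (A : ℂ →L[ℝ] ℂ) : A.det = jac A := by
  obtain ⟨a, b, rfl⟩ := exists_wirt A
  have : (wirt a b).det = LinearMap.det ((wirt a b : ℂ →L[ℝ] ℂ) : ℂ →ₗ[ℝ] ℂ) := rfl
  rw [this, ← LinearMap.det_toMatrix basisOneI, Matrix.det_fin_two]
  simp [LinearMap.toMatrix_apply, jac_wirt, sq_norm_eq]
  ring

lemma distortion_wirt {a b : ℂ} (h : ‖a‖ ^ 2 - ‖b‖ ^ 2 ≠ 0) :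
    distortion (wirt a b) = (‖a‖ ^ 2 + ‖b‖ ^ 2) / (‖a‖ ^ 2 - ‖b‖ ^ 2) := by
  rw [distortion, if_pos (by rwa [jac_wirt]), jac_wirt]
  simp

lemma distortion_of_jac_ne_zero {A : ℂ →L[ℝ] ℂ} (h : jac A ≠ 0) :
    distortion A = (‖linZ A‖ ^ 2 + ‖linZbar A‖ ^ 2) / jac A := if_pos h

/-- Composition with a complex-linear map on the left does not change the distortion. -/
lemma distortion_conformal_comp {a : ℂ} (ha : a ≠ 0) (A : ℂ →L[ℝ] ℂ) :
    distortion ((wirt a 0).comp A) = distortion A := by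
  have ha' : ‖a‖ ^ 2 ≠ 0 := by simpa
  obtain ⟨c, d, rfl⟩ := exists_wirt A
  rw [wirt_comp]
  simp only [zero_mul, add_zero]
  simp only [distortion, jac_wirt, linZ_wirt, linZbar_wirt, norm_mul, mul_pow, ← mul_sub, ← mul_add]
  -- A conformal factor does not affect whether the Jacobian vanishes, so in the degenerate case
  -- both sides take the default value 1.
  by_cases h : ‖c‖ ^ 2 - ‖d‖ ^ 2 = 0
  · simp [h]
  · rw [if_pos h, if_pos (mul_ne_zero ha' h), mul_div_mul_left _ _ ha']

/-- Composition with a complex-linear map on the right does not change the distortion. -/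
lemma distortion_comp_conformal {a : ℂ} (ha : a ≠ 0) (A : ℂ →L[ℝ] ℂ) :
    distortion (A.comp (wirt a 0)) = distortion A := by
  have ha' : ‖a‖ ^ 2 ≠ 0 := by simpa
  obtain ⟨c, d, rfl⟩ := exists_wirt A
  rw [wirt_comp]
  simp only [map_zero, mul_zero, add_zero, zero_add]
  simp only [distortion, jac_wirt, linZ_wirt, linZbar_wirt, norm_mul, mul_pow, ← sub_mul, ← add_mul,
    norm_conj]
  by_cases h : ‖c‖ ^ 2 - ‖d‖ ^ 2 = 0
  · simp [h]
  · rw [if_pos h, if_pos (mul_ne_zero h ha'), mul_div_mul_right _ _ ha']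

lemma jac_ne_zero_of_comp_eq_id {A B : ℂ →L[ℝ] ℂ} (h : A.comp B = ContinuousLinearMap.id ℝ ℂ) :
    jac A ≠ 0 ∧ jac B ≠ 0 := by
  have h1 : jac A * jac B = 1 := by rw [← jac_comp, h, jac_id]
  exact ⟨left_ne_zero_of_mul_eq_one h1, right_ne_zero_of_mul_eq_one h1⟩

/-- The Wirtinger derivatives of the inverse of a real-linear map. -/
lemma lin_of_comp_eq_id {A B : ℂ →L[ℝ] ℂ} (h : A.comp B = ContinuousLinearMap.id ℝ ℂ) :
    linZ B = conj (linZ A) / jac A ∧ linZbar B = -linZbar A / jac A := by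
  have hJ := (jac_ne_zero_of_comp_eq_id h).1
  obtain ⟨a, b, rfl⟩ := exists_wirt A
  obtain ⟨c, d, rfl⟩ := exists_wirt B
  rw [wirt_comp] at h
  have h1 : a * c + b * conj d = 1 := by
    have := congrArg linZ h
    rw [show ContinuousLinearMap.id ℝ ℂ = wirt 1 0 by ext v; simp] at this
    simpa using this
  have h2 : a * d + b * conj c = 0 := by
    have := congrArg linZbar h
    rw [show ContinuousLinearMap.id ℝ ℂ = wirt 1 0 by ext v; simp] at this
    simpa using this
  have h2' : conj a * conj d + conj b * c = 0 := by
    have := congrArg conj h2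
    simpa using this
  have h1' : conj a * conj c + conj b * d = 1 := by
    have := congrArg conj h1
    simpa using this
  rw [jac_wirt] at hJ ⊢
  have hJ' : ((‖a‖ ^ 2 - ‖b‖ ^ 2 : ℝ) : ℂ) ≠ 0 := by exact_mod_cast hJ
  have e : ((‖a‖ ^ 2 - ‖b‖ ^ 2 : ℝ) : ℂ) = a * conj a - b * conj b := by
    rw [Complex.mul_conj, Complex.mul_conj, normSq_eq_norm_sq, normSq_eq_norm_sq]; push_cast; ring
  simp only [linZ_wirt, linZbar_wirt]
  constructor
  · rw [eq_div_iff hJ', e]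
    linear_combination conj a * h1 - b * h2'
  · rw [eq_div_iff hJ', e]
    linear_combination conj a * h2 - b * h1'

/-- The inverse of `v ↦ a v + b v̄` has coefficients `ā/J` and `-b/J`: the moduli are only rescaled,
and `𝕂` is homogeneous of degree zero. -/
lemma distortion_of_comp_eq_id {A B : ℂ →L[ℝ] ℂ} (h : A.comp B = ContinuousLinearMap.id ℝ ℂ) :
    distortion B = distortion A := by
  obtain ⟨hA, hB⟩ := jac_ne_zero_of_comp_eq_id h
  obtain ⟨h1, h2⟩ := lin_of_comp_eq_id h
  have h3 : jac B = 1 / jac A := by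
    rw [eq_div_iff hA, mul_comm, ← jac_comp, h, jac_id]
  rw [distortion_of_jac_ne_zero hA, distortion_of_jac_ne_zero hB, h3, h1, h2]
  simp only [norm_div, norm_conj, norm_neg, norm_real, Real.norm_eq_abs, div_pow, sq_abs]
  field_simp

/-! ### Wirtinger calculus -/

/-- `F` is real-differentiable at `z` with `F_z = a` and `F_z̄ = b`. -/
def HasWirt (F : ℂ → ℂ) (a b z : ℂ) : Prop := HasFDerivAt F (wirt a b) z

lemma HasWirt.dz_eq {F : ℂ → ℂ} {a b z : ℂ} (h : HasWirt F a b z) : dz F z = a := by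
  rw [dz, HasFDerivAt.fderiv h, linZ_wirt]

lemma HasWirt.dzbar_eq {F : ℂ → ℂ} {a b z : ℂ} (h : HasWirt F a b z) : dzbar F z = b := by
  rw [dzbar, HasFDerivAt.fderiv h, linZbar_wirt]

lemma fderiv_eq_wirt (F : ℂ → ℂ) (z : ℂ) : fderiv ℝ F z = wirt (dz F z) (dzbar F z) :=
  (wirt_lin _).symm

lemma hasWirt_of_differentiableAt {F : ℂ → ℂ} {z : ℂ} (h : DifferentiableAt ℝ F z) :
    HasWirt F (dz F z) (dzbar F z) z := by
  rw [HasWirt, ← fderiv_eq_wirt]; exact h.hasFDerivAt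

lemma HasWirt.congr {F : ℂ → ℂ} {a b a' b' z : ℂ} (h : HasWirt F a b z) (ha : a = a') (hb : b = b') :
    HasWirt F a' b' z := ha ▸ hb ▸ h

lemma HasWirt.mul {F G : ℂ → ℂ} {a b c d z : ℂ} (hF : HasWirt F a b z) (hG : HasWirt G c d z) :
    HasWirt (fun w => F w * G w) (a * G z + F z * c) (b * G z + F z * d) z := by
  refine (HasFDerivAt.mul hF hG).congr_fderiv ?_
  ext v
  simp
  ring

lemma HasWirt.conj {F : ℂ → ℂ} {a b z : ℂ} (hF : HasWirt F a b z) :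
    HasWirt (fun w => conj (F w)) (conj b) (conj a) z := by
  refine ((conjCLE : ℂ →L[ℝ] ℂ).hasFDerivAt.comp z hF).congr_fderiv ?_
  ext v
  simp
  ring

lemma HasWirt.comp {F G : ℂ → ℂ} {a b c d z : ℂ} (hF : HasWirt F a b (G z)) (hG : HasWirt G c d z) :
    HasWirt (fun w => F (G w)) (a * c + b * conj d)
      (a * d + b * conj c) z := by
  have := HasFDerivAt.comp z hF hG
  rwa [wirt_comp] at this

lemma HasWirt.neg {F : ℂ → ℂ} {a b z : ℂ} (hF : HasWirt F a b z) :
    HasWirt (fun w => -F w) (-a) (-b) z := by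
  refine (HasFDerivAt.neg hF).congr_fderiv ?_
  ext v
  simp
  ring

/-- Post-composition of a real-valued function with a real differentiable function. -/
lemma HasWirt.ofReal_comp {u : ℂ → ℝ} {k : ℝ → ℝ} {k' : ℝ} {a b z : ℂ}
    (hu : HasWirt (fun w => (u w : ℂ)) a b z) (hk : HasDerivAt k k' (u z)) :
    HasWirt (fun w => (k (u w) : ℂ)) (k' * a) (k' * b) z := by
  have h1 : HasFDerivAt u (reCLM.comp (wirt a b)) z := by
    have := reCLM.hasFDerivAt.comp z hu
    simpa [Function.comp_def] using this
  -- A real-valued function has a real-valued differential, so taking real parts loses nothing.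
  have h2 : wirt a b = ofRealCLM.comp (reCLM.comp (wirt a b)) := by
    have := ofRealCLM.hasFDerivAt.comp z h1
    exact HasFDerivAt.unique hu this
  have h3 := ofRealCLM.hasFDerivAt.comp z (hk.hasFDerivAt.comp z h1)
  refine HasFDerivAt.congr_fderiv h3 ?_
  ext v
  have h4 := congrArg (fun A : ℂ →L[ℝ] ℂ => A v) h2
  simp only [ContinuousLinearMap.comp_apply, ofRealCLM_apply, reCLM_apply] at h4
  simp only [ContinuousLinearMap.comp_apply, ofRealCLM_apply, reCLM_apply]
  rw [show (wirt ((k' : ℂ) * a) (k' * b)) v = k' * wirt a b v by simp; ring, h4]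
  simp [mul_comm]

/-- The Wirtinger derivatives of a real-valued function are conjugate to each other. -/
lemma dzbar_ofReal {u : ℂ → ℝ} {z : ℂ} (h : DifferentiableAt ℝ u z) :
    dzbar (fun w => (u w : ℂ)) z = conj (dz (fun w => (u w : ℂ)) z) := by
  have h1 := ofRealCLM.hasFDerivAt.comp z h.hasFDerivAt
  have h2 : fderiv ℝ (fun w => (u w : ℂ)) z = ofRealCLM.comp (fderiv ℝ u z) := h1.fderiv
  simp [dzbar, dz, h2, linZ, linZbar, map_ofNat]

/-- A complex-differentiable function has `F_z = F'` and `F_z̄ = 0`. -/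
lemma HasDerivAt.hasWirt {F : ℂ → ℂ} {a z : ℂ} (h : HasDerivAt F a z) : HasWirt F a 0 z := by
  refine (h.hasFDerivAt.restrictScalars ℝ).congr_fderiv ?_
  ext v
  simp [mul_comm]

lemma differentiableAt_of_dzbar_eq_zero {F : ℂ → ℂ} {z : ℂ} (h : DifferentiableAt ℝ F z)
    (h0 : dzbar F z = 0) : DifferentiableAt ℂ F z := by
  rw [differentiableAt_complex_iff_differentiableAt_real]
  refine ⟨h, ?_⟩
  rw [fderiv_eq_wirt, h0]
  simp [mul_comm]

/-- The mixed Wirtinger derivatives commute. -/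
lemma dzbar_dz_comm {F : ℂ → ℂ} {z : ℂ} (h : ContDiffAt ℝ 2 F z) :
    dz (dzbar F) z = dzbar (dz F) z := by
  have hs := h.isSymmSndFDerivAt (by simp)
  have hd : DifferentiableAt ℝ (fderiv ℝ F) z :=
    (h.fderiv_right (m := 1) (by norm_num)).differentiableAt (by norm_num)
  have hv : ∀ v, HasFDerivAt (fun w => fderiv ℝ F w v)
      ((ContinuousLinearMap.apply ℝ ℂ v).comp (fderiv ℝ (fderiv ℝ F) z)) z := fun v =>
    (ContinuousLinearMap.apply ℝ ℂ v).hasFDerivAt.comp z hd.hasFDerivAt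
  have h1 := (((hv 1).sub ((hv I).const_mul I)).mul_const (2⁻¹ : ℂ)).fderiv
  have h2 := (((hv 1).add ((hv I).const_mul I)).mul_const (2⁻¹ : ℂ)).fderiv
  have e1 : dz F = fun w => (fderiv ℝ F w 1 - I * fderiv ℝ F w I) * 2⁻¹ := by
    funext w; simp [dz, linZ, div_eq_mul_inv]
  have e2 : dzbar F = fun w => (fderiv ℝ F w 1 + I * fderiv ℝ F w I) * 2⁻¹ := by
    funext w; simp [dzbar, linZbar, div_eq_mul_inv]
  have hsym := hs.eq 1 I
  rw [e1, e2, dz, dzbar]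
  simp only [Pi.add_def, Pi.sub_def] at h1 h2
  rw [h1, h2]
  simp [linZ, linZbar, hsym]
  ring

section

/-! ### Regularity of the basic quantities -/

lemma contDiff_linZ {n : WithTop ℕ∞} : ContDiff ℝ n linZ := by
  have h : ∀ v : ℂ, ContDiff ℝ n (fun A : ℂ →L[ℝ] ℂ => A v) := fun v =>
    (ContinuousLinearMap.apply ℝ ℂ v).contDiff
  exact ((h 1).sub (contDiff_const.mul (h I))).div_const 2

lemma contDiff_linZbar {n : WithTop ℕ∞} : ContDiff ℝ n linZbar := by
  have h : ∀ v : ℂ, ContDiff ℝ n (fun A : ℂ →L[ℝ] ℂ => A v) := fun v =>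
    (ContinuousLinearMap.apply ℝ ℂ v).contDiff
  exact ((h 1).add (contDiff_const.mul (h I))).div_const 2

lemma contDiff_jac {n : WithTop ℕ∞} : ContDiff ℝ n jac :=
  (contDiff_linZ.norm_sq ℝ).sub (contDiff_linZbar.norm_sq ℝ)

lemma measurable_distortion : Measurable distortion := by
  classical
  have hj : Measurable jac := (contDiff_jac (n := 0)).continuous.measurable
  refine Measurable.ite ?_ ?_ measurable_const
  · exact (hj (measurableSet_singleton 0)).compl
  · exact (((contDiff_linZ (n := 0)).continuous.norm.pow 2).add
      ((contDiff_linZbar (n := 0)).continuous.norm.pow 2)).measurable.div hj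

/-- Nonvanishing of the Jacobian is an open condition, so the default value 1 is not seen near `A`.
-/
lemma contDiffAt_distortion {n : WithTop ℕ∞} {A : ℂ →L[ℝ] ℂ} (h : jac A ≠ 0) :
    ContDiffAt ℝ n distortion A := by
  have h1 : ContDiffAt ℝ n
      (fun A : ℂ →L[ℝ] ℂ => (‖linZ A‖ ^ 2 + ‖linZbar A‖ ^ 2) / jac A) A :=
    ((contDiff_linZ.norm_sq ℝ).add (contDiff_linZbar.norm_sq ℝ)).contDiffAt.div
      contDiff_jac.contDiffAt h
  refine h1.congr_of_eventuallyEq ?_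
  filter_upwards [(contDiff_jac (n := 0)).continuous.continuousAt.eventually_ne h] with B hB
  exact distortion_of_jac_ne_zero hB

lemma contDiffOn_dz {F : ℂ → ℂ} {U : Set ℂ} (hU : IsOpen U) (hF : ContDiffOn ℝ ∞ F U) :
    ContDiffOn ℝ ∞ (dz F) U :=
  contDiff_linZ.comp_contDiffOn (hF.fderiv_of_isOpen hU (by simp))

lemma contDiffOn_dzbar {F : ℂ → ℂ} {U : Set ℂ} (hU : IsOpen U) (hF : ContDiffOn ℝ ∞ F U) :
    ContDiffOn ℝ ∞ (dzbar F) U :=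
  contDiff_linZbar.comp_contDiffOn (hF.fderiv_of_isOpen hU (by simp))

lemma contDiffOn_distortion_fderiv {F : ℂ → ℂ} {U : Set ℂ} (hU : IsOpen U)
    (hF : ContDiffOn ℝ ∞ F U) (hJ : ∀ z ∈ U, jac (fderiv ℝ F z) ≠ 0) :
    ContDiffOn ℝ ∞ (fun z => distortion (fderiv ℝ F z)) U := by
  have h := hF.fderiv_of_isOpen hU (m := ∞) (by simp)
  intro z hz
  exact (contDiffAt_distortion (hJ z hz)).comp_contDiffWithinAt z (h z hz)

lemma isOpen_disk : IsOpen disk := Metric.isOpen_ball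

lemma one_sub_norm_sq_pos {z : ℂ} (hz : z ∈ disk) : 0 < 1 - ‖z‖ ^ 2 := by
  have h : ‖z‖ < 1 := by simpa using hz
  nlinarith [norm_nonneg z]

lemma eta_pos {z : ℂ} (hz : z ∈ disk) : 0 < eta z := by
  have := one_sub_norm_sq_pos hz
  unfold eta; positivity

lemma contDiffOn_eta : ContDiffOn ℝ ∞ eta disk := by
  refine ContDiffOn.div contDiffOn_const ?_ fun z hz => ?_
  · exact ((contDiff_const.sub (contDiff_id.norm_sq ℝ)).pow 2).contDiffOn
  · have := one_sub_norm_sq_pos hz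
    positivity

/-! ### Self-maps of the disk as planar maps -/

@[simp] lemma toPlane_coe (f : Disk → Disk) (z : Disk) : toPlane f z = f z :=
  Subtype.val_injective.extend_apply _ _ _

lemma toPlane_of_mem (f : Disk → Disk) {z : ℂ} (hz : z ∈ disk) : toPlane f z = f ⟨z, hz⟩ :=
  toPlane_coe f ⟨z, hz⟩

lemma toPlane_mem (f : Disk → Disk) {z : ℂ} (hz : z ∈ disk) : toPlane f z ∈ disk := by
  rw [toPlane_of_mem f hz]; exact (f _).2

lemma toPlane_symm_toPlane (f : Disk ≃ₜ Disk) {z : ℂ} (hz : z ∈ disk) :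
    toPlane f.symm (toPlane f z) = z := by
  rw [toPlane_of_mem f hz, toPlane_coe]; simp

/-! ### Integration by parts and weak differentials -/

variable {E : Type*} [NormedAddCommGroup E] [NormedSpace ℝ E]

/-- `F` is controlled only on `U`, but the product vanishes off the support of `g`, hence is
continuous on the whole plane. -/
lemma integrable_smul_of_tsupport_subset {U : Set ℂ} (hU : IsOpen U) {g : ℂ → ℝ} {F : ℂ → E}
    (hg : Continuous g) (hc : HasCompactSupport g) (hs : tsupport g ⊆ U) (hF : ContinuousOn F U) :
    Integrable fun z => g z • F z := by
  have hcont : Continuous fun z => g z • F z := by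
    refine continuous_of_tsupport fun z hz => ?_
    have hzU : z ∈ U := hs (closure_mono (Function.support_smul_subset_left g F) hz)
    exact hg.continuousAt.smul (hF.continuousAt (hU.mem_nhds hzU))
  exact hcont.integrable_of_hasCompactSupport hc.smul_right

lemma integral_fderiv_smul_eq_neg {U : Set ℂ} (hU : IsOpen U) {g : ℂ → ℝ} {F : ℂ → E}
    (hg : ContDiff ℝ ∞ g) (hc : HasCompactSupport g) (hs : tsupport g ⊆ U)
    (hF : ContDiffOn ℝ ∞ F U) (v : ℂ) :
    ∫ z, fderiv ℝ g z v • F z = -∫ z, g z • fderiv ℝ F z v := by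
  have hF' : ContinuousOn (fun z => fderiv ℝ F z v) U :=
    (hF.continuousOn_fderiv_of_isOpen hU (by simp)).clm_apply continuousOn_const
  have hg' : Continuous fun z => fderiv ℝ g z v :=
    (hg.continuous_fderiv (by simp)).clm_apply continuous_const
  have hs' : tsupport (fun z => fderiv ℝ g z v) ⊆ tsupport g :=
    tsupport_fderiv_apply_subset ℝ v
  have := integral_smul_fderiv_eq_neg_fderiv_smul_of_integrable (μ := volume) (f := g) (g := F)
    (v := v)
    (integrable_smul_of_tsupport_subset hU hg' (hc.fderiv_apply ℝ v) (hs'.trans hs) hF.continuousOn)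
    (integrable_smul_of_tsupport_subset hU hg.continuous hc hs hF')
    (integrable_smul_of_tsupport_subset hU hg.continuous hc hs hF.continuousOn)
    (fun x _ => (hg.differentiable (by simp)) x)
    (fun x hx => (hF.contDiffAt (hU.mem_nhds (hs hx))).differentiableAt (by simp))
  rw [this, neg_neg]

lemma hasWeakDifferential_fderiv {U : Set ℂ} (hU : IsOpen U) {F : ℂ → ℂ}
    (hF : ContDiffOn ℝ ∞ F U) : HasWeakDifferential U F (fderiv ℝ F) where
  locInt := hF.continuousOn.locallyIntegrableOn hU.measurableSet
  locInt_diff :=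
    (hF.continuousOn_fderiv_of_isOpen hU (by simp)).locallyIntegrableOn hU.measurableSet
  integral_eq _ hg hc hs v := integral_fderiv_smul_eq_neg hU hg hc hs hF v

/-- The weak differential of a smooth map is its classical differential. -/
lemma HasWeakDifferential.ae_eq_fderiv {U : Set ℂ} (hU : IsOpen U) {F : ℂ → ℂ}
    {D : ℂ → ℂ →L[ℝ] ℂ} (h : HasWeakDifferential U F D) (hF : ContDiffOn ℝ ∞ F U) :
    ∀ᵐ z, z ∈ U → D z = fderiv ℝ F z := by
  have hF' := hF.continuousOn_fderiv_of_isOpen hU (by simp)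
  have key : ∀ v : ℂ, ∀ᵐ z, z ∈ U → D z v - fderiv ℝ F z v = 0 := by
    intro v
    have hD : LocallyIntegrableOn (fun z => D z v) U := by
      intro z hz
      obtain ⟨s, hs, hi⟩ := h.locInt_diff z hz
      exact ⟨s, hs, hi.apply_continuousLinearMap v⟩
    have hF'v : ContinuousOn (fun z => fderiv ℝ F z v) U := hF'.clm_apply continuousOn_const
    -- Both differentials satisfy the same integration by parts, so their difference is orthogonal
    -- to all test functions.
    refine hU.ae_eq_zero_of_integral_contDiff_smul_eq_zero
      (hD.sub (hF'v.locallyIntegrableOn hU.measurableSet)) fun g hg hc hs => ?_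
    have hgD : Integrable fun z => g z • D z v := by
      have := (locallyIntegrableOn_iff hU.isLocallyClosed |>.1 hD _ hs hc)
      have h2 := this.continuousOn_smul hg.continuous.continuousOn hc
      rwa [integrableOn_iff_integrable_of_support_subset] at h2
      exact (Function.support_smul_subset_left g _).trans subset_closure
    have hgF := integrable_smul_of_tsupport_subset hU hg.continuous hc hs hF'v
    simp only [smul_sub]
    rw [integral_sub hgD hgF, sub_eq_zero, ← neg_inj, ← h.integral_eq g hg hc hs v,
      integral_fderiv_smul_eq_neg hU hg hc hs hF v]
  filter_upwards [key 1, key I] with z h1 hI hz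
  exact ext_one_I (sub_eq_zero.1 (h1 hz)) (sub_eq_zero.1 (hI hz))

/-- `K = |DF|²/J` gives equality for either sign of `J`. Orientation-reversing competitors are
therefore admitted, which is why the orientation of the minimiser needs a proof. -/
lemma finiteDistortion_fderiv {U : Set ℂ} (hU : IsOpen U) {F : ℂ → ℂ}
    (hF : ContDiffOn ℝ ∞ F U) (hJ : ∀ z ∈ U, jac (fderiv ℝ F z) ≠ 0) :
    FiniteDistortion U (fderiv ℝ F) := by
  have hjac : Continuous jac := (contDiff_jac (n := 0)).continuous
  refine ⟨?_, fun z => ‖fderiv ℝ F z‖ ^ 2 / jac (fderiv ℝ F z), ?_, ?_⟩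
  · exact (hjac.comp_continuousOn
      (hF.continuousOn_fderiv_of_isOpen hU (by simp))).locallyIntegrableOn hU.measurableSet
  · exact ((measurable_fderiv ℝ F).norm.pow_const 2).div
      (hjac.measurable.comp (measurable_fderiv ℝ F))
  · filter_upwards [ae_restrict_mem hU.measurableSet] with z hz
    rw [div_mul_cancel₀ _ (hJ z hz)]

end

section

/-! ### Schwarz–Pick and the invariance of hyperbolic area -/

/-- The Möbius map `z ↦ (z + c) / (1 + c̄ z)`. -/
def mobius (c z : ℂ) : ℂ := (z + c) / (1 + conj c * z)

lemma mobius_denom_norm_sq (c z : ℂ) :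
    ‖1 + conj c * z‖ ^ 2 - ‖z + c‖ ^ 2 = (1 - ‖z‖ ^ 2) * (1 - ‖c‖ ^ 2) := by
  simp only [sq_norm_eq, add_re, add_im, mul_re, mul_im, conj_re, conj_im, one_re, one_im]
  ring

lemma mobius_denom_ne_zero {c z : ℂ} (hc : c ∈ disk) (hz : z ∈ disk) : 1 + conj c * z ≠ 0 := by
  intro h
  have h1 := mobius_denom_norm_sq c z
  have h2 := mul_pos (one_sub_norm_sq_pos hz) (one_sub_norm_sq_pos hc)
  rw [h, norm_zero] at h1
  nlinarith [sq_nonneg ‖z + c‖]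

lemma mobius_mem {c z : ℂ} (hc : c ∈ disk) (hz : z ∈ disk) : mobius c z ∈ disk := by
  have h0 := mobius_denom_ne_zero hc hz
  have h1 := mobius_denom_norm_sq c z
  have h2 := mul_pos (one_sub_norm_sq_pos hz) (one_sub_norm_sq_pos hc)
  rw [mem_ball_zero_iff, mobius, norm_div, div_lt_one (norm_pos_iff.2 h0)]
  exact lt_of_pow_lt_pow_left₀ 2 (norm_nonneg _) (by linarith)

lemma hasDerivAt_mobius {c z : ℂ} (hc : c ∈ disk) (hz : z ∈ disk) :
    HasDerivAt (mobius c) ((1 - ‖c‖ ^ 2 : ℝ) / (1 + conj c * z) ^ 2) z := by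
  have h1 : HasDerivAt (fun z : ℂ => z + c) 1 z := (hasDerivAt_id z).add_const c
  have h2 : HasDerivAt (fun z : ℂ => 1 + conj c * z) (conj c) z := by
    simpa using ((hasDerivAt_id z).const_mul (conj c)).const_add 1
  refine (h1.div h2 (mobius_denom_ne_zero hc hz)).congr_deriv ?_
  have : ((1 - ‖c‖ ^ 2 : ℝ) : ℂ) = 1 - c * conj c := by
    rw [Complex.mul_conj, normSq_eq_norm_sq]; push_cast; ring
  rw [this]
  congr 1
  ring

/-- Möbius maps carrying `0` to `a` and `F a` to `0` reduce the claim to the Schwarz bound for the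
derivative at a fixed origin. -/
lemma schwarz_pick {F : ℂ → ℂ} (hF : DifferentiableOn ℂ F disk) (hm : Set.MapsTo F disk disk)
    {a : ℂ} (ha : a ∈ disk) : ‖deriv F a‖ * (1 - ‖a‖ ^ 2) ≤ 1 - ‖F a‖ ^ 2 := by
  have hb : F a ∈ disk := hm ha
  have hnb : -F a ∈ disk := by simpa using hb
  have h0 : (0 : ℂ) ∈ disk := by simp
  have hpa := one_sub_norm_sq_pos ha
  have hpb := one_sub_norm_sq_pos hb
  set k : ℂ → ℂ := fun z => mobius (-F a) (F (mobius a z)) with hk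
  have ha0 : mobius a 0 = a := by simp [mobius]
  have hk0 : k 0 = 0 := by simp [hk, mobius]
  have hkd : DifferentiableOn ℂ k disk := fun z hz => by
    have hmz := mobius_mem ha hz
    exact (((hasDerivAt_mobius hnb (hm hmz)).differentiableAt.comp _
      (hF.differentiableAt (isOpen_disk.mem_nhds hmz))).comp z
      (hasDerivAt_mobius ha hz).differentiableAt).differentiableWithinAt
  have hkm : Set.MapsTo k (Metric.ball 0 1) (Metric.closedBall (k 0) 1) := fun z hz => by
    rw [hk0]
    exact Metric.ball_subset_closedBall (mobius_mem hnb (hm (mobius_mem ha hz)))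
  have hle := norm_deriv_le_one_of_mapsTo_ball hkd hkm one_pos
  have hd1 := hasDerivAt_mobius ha h0
  have hd2 : HasDerivAt F (deriv F a) (mobius a 0) := by
    rw [ha0]; exact (hF.differentiableAt (isOpen_disk.mem_nhds ha)).hasDerivAt
  have hd3 : HasDerivAt (mobius (-F a)) ((1 - ‖-F a‖ ^ 2 : ℝ) / (1 + conj (-F a) * F a) ^ 2)
      (F (mobius a 0)) := by
    rw [ha0]; exact hasDerivAt_mobius hnb hb
  have hd := ((hd3.comp _ hd2).comp 0 hd1).deriv
  have e : (1 : ℂ) + conj (-F a) * F a = ((1 - ‖F a‖ ^ 2 : ℝ) : ℂ) := by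
    rw [map_neg, neg_mul, mul_comm, Complex.mul_conj, normSq_eq_norm_sq]; push_cast; ring
  have hd' : deriv k 0 = _ := hd
  rw [hd', e] at hle
  simp only [mul_zero, add_zero, norm_neg, norm_mul, norm_div, norm_pow, norm_real,
    Real.norm_eq_abs, abs_of_pos hpa, abs_of_pos hpb, one_pow, div_one] at hle
  have e2 : (1 - ‖F a‖ ^ 2) / (1 - ‖F a‖ ^ 2) ^ 2 = (1 - ‖F a‖ ^ 2)⁻¹ := by field_simp
  rw [e2, mul_assoc, inv_mul_le_iff₀ hpb, mul_one] at hle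
  exact hle

variable {Γ : Subgroup (Equiv.Perm Disk)}

lemma IsSurfaceGroup.hasDerivAt (hΓ : IsSurfaceGroup Γ) {γ : Equiv.Perm Disk} (hγ : γ ∈ Γ) {z : ℂ}
    (hz : z ∈ disk) : HasDerivAt (toPlane γ) (deriv (toPlane γ) z) z :=
  ((hΓ.holomorphic γ hγ).differentiableAt (isOpen_disk.mem_nhds hz)).hasDerivAt

lemma IsSurfaceGroup.contDiffOn (hΓ : IsSurfaceGroup Γ) {γ : Equiv.Perm Disk} (hγ : γ ∈ Γ) :
    ContDiffOn ℝ ∞ (toPlane γ) disk :=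
  ((hΓ.holomorphic γ hγ).contDiffOn isOpen_disk).restrict_scalars ℝ

lemma toPlane_inv_toPlane (γ : Equiv.Perm Disk) {z : ℂ} (hz : z ∈ disk) :
    toPlane (γ⁻¹ : Equiv.Perm Disk) (toPlane γ z) = z := by
  rw [toPlane_of_mem γ hz, toPlane_coe]; simp

lemma IsSurfaceGroup.deriv_inv_mul_deriv (hΓ : IsSurfaceGroup Γ) {γ : Equiv.Perm Disk}
    (hγ : γ ∈ Γ) {z : ℂ} (hz : z ∈ disk) :
    deriv (toPlane (γ⁻¹ : Equiv.Perm Disk)) (toPlane γ z) * deriv (toPlane γ) z = 1 := by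
  have h1 := (hΓ.hasDerivAt (Γ.inv_mem hγ) (toPlane_mem γ hz)).comp z (hΓ.hasDerivAt hγ hz)
  refine h1.unique ((hasDerivAt_id z).congr_of_eventuallyEq ?_)
  filter_upwards [isOpen_disk.mem_nhds hz] with w hw
  exact toPlane_inv_toPlane γ hw

lemma IsSurfaceGroup.deriv_ne_zero (hΓ : IsSurfaceGroup Γ) {γ : Equiv.Perm Disk}
    (hγ : γ ∈ Γ) {z : ℂ} (hz : z ∈ disk) : deriv (toPlane γ) z ≠ 0 :=
  right_ne_zero_of_mul_eq_one (hΓ.deriv_inv_mul_deriv hγ hz)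

/-- Schwarz–Pick holds for `γ` and for `γ⁻¹`, and their derivatives multiply to 1, so both
inequalities are equalities: `γ` is a hyperbolic isometry. -/
lemma IsSurfaceGroup.norm_deriv_sq_mul_eta (hΓ : IsSurfaceGroup Γ) {γ : Equiv.Perm Disk}
    (hγ : γ ∈ Γ) {z : ℂ} (hz : z ∈ disk) :
    ‖deriv (toPlane γ) z‖ ^ 2 * eta (toPlane γ z) = eta z := by
  have h1 := schwarz_pick (hΓ.holomorphic γ hγ) (fun z hz => toPlane_mem γ hz) hz
  have hw := toPlane_mem γ hz
  have h2 := schwarz_pick (hΓ.holomorphic _ (Γ.inv_mem hγ)) (fun z hz => toPlane_mem _ hz) hw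
  rw [toPlane_inv_toPlane γ hz] at h2
  have h3 := congrArg norm (hΓ.deriv_inv_mul_deriv hγ hz)
  rw [norm_mul, norm_one] at h3
  set d := ‖deriv (toPlane γ) z‖
  set e := ‖deriv (toPlane (γ⁻¹ : Equiv.Perm Disk)) (toPlane γ z)‖
  have hpz := one_sub_norm_sq_pos hz
  have hpw := one_sub_norm_sq_pos hw
  have hd : 0 ≤ d := norm_nonneg _
  have h4 : d * (1 - ‖z‖ ^ 2) = 1 - ‖toPlane γ z‖ ^ 2 := by
    refine le_antisymm h1 ?_
    have := mul_le_mul_of_nonneg_left h2 hd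
    nlinarith
  unfold eta
  rw [← h4]
  have : d ≠ 0 := by rintro h; simp [h] at h3
  field_simp

lemma IsSurfaceGroup.continuous (hΓ : IsSurfaceGroup Γ) {γ : Equiv.Perm Disk} (hγ : γ ∈ Γ) :
    Continuous γ := by
  have h := (hΓ.holomorphic γ hγ).continuousOn
  rw [continuousOn_iff_continuous_domRestrict] at h
  refine continuous_induced_rng.2 (h.congr fun z => ?_)
  simp [Set.domRestrict_apply]

lemma IsSurfaceGroup.continuousConstSMul (hΓ : IsSurfaceGroup Γ) : ContinuousConstSMul Γ Disk :=
  ⟨fun γ => hΓ.continuous γ.2⟩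

/-- In a compact exhaustion every `γ` moves some member so that it meets itself, and proper
discontinuity allows only finitely many such `γ` for each member. -/
lemma IsSurfaceGroup.countable (hΓ : IsSurfaceGroup Γ) : Countable Γ := by
  have := hΓ.properlyDiscontinuous
  have : LocallyCompactSpace Disk := isOpen_disk.locallyCompactSpace
  let K := CompactExhaustion.choice Disk
  let z₀ : Disk := ⟨0, by simp⟩
  have : (Set.univ : Set Γ) ⊆ ⋃ n, {γ : Γ | ((γ • ·) '' K n ∩ K n).Nonempty} := by
    intro γ _
    obtain ⟨n, hn⟩ := K.exists_mem z₀
    obtain ⟨m, hm⟩ := K.exists_mem (γ • z₀)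
    refine Set.mem_iUnion.2 ⟨max n m, γ • z₀, ⟨z₀, K.subset (le_max_left _ _) hn, rfl⟩,
      K.subset (le_max_right _ _) hm⟩
  exact Set.countable_univ_iff.1 ((Set.countable_iUnion fun n =>
    (ProperlyDiscontinuousSMul.finite_disjoint_inter_image (K.isCompact n)
      (K.isCompact n)).countable).mono this)

lemma measurable_eta : Measurable eta := by unfold eta; fun_prop

lemma setLIntegral_hypArea {s : Set Disk} (hs : MeasurableSet s) {g : ℂ → ℝ≥0∞} (hg : Measurable g) :
    ∫⁻ z in s, g z ∂hypArea = ∫⁻ z in ((↑) '' s : Set ℂ), ENNReal.ofReal (eta z) * g z := by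
  have hm : Measurable fun z : Disk => ENNReal.ofReal (eta z) :=
    (measurable_eta.comp measurable_subtype_coe).ennreal_ofReal
  have hg' : Measurable fun z : Disk => g z := hg.comp measurable_subtype_coe
  rw [hypArea, restrict_withDensity hs, lintegral_withDensity_eq_lintegral_mul _ hm hg']
  exact setLIntegral_subtype isOpen_disk.measurableSet s fun z => ENNReal.ofReal (eta z) * g z

lemma hypArea_apply {s : Set Disk} (hs : MeasurableSet s) :
    hypArea s = ∫⁻ z in ((↑) '' s : Set ℂ), ENNReal.ofReal (eta z) := by
  have := setLIntegral_hypArea hs (g := fun _ => 1) measurable_const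
  simpa using this

/-- Change of variables: the Jacobian of `γ` is `|γ'|²`, which is exactly compensated by `η`. -/
lemma IsSurfaceGroup.smulInvariantMeasure (hΓ : IsSurfaceGroup Γ) :
    SMulInvariantMeasure Γ Disk hypArea := by
  have := hΓ.continuousConstSMul
  refine ⟨fun γ s hs => ?_⟩
  have ht : MeasurableSet ((γ • ·) ⁻¹' s : Set Disk) := measurable_const_smul γ hs
  set t : Set Disk := (γ • ·) ⁻¹' s with htdef
  have hst : ((↑) '' s : Set ℂ) = toPlane (γ : Equiv.Perm Disk) '' ((↑) '' t) := by
    rw [Set.image_image]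
    simp only [toPlane_coe]
    rw [← Set.image_image (fun z : Disk => (z : ℂ)) (fun z => (γ : Equiv.Perm Disk) z)]
    congr 1
    exact (Set.image_preimage_eq s (γ : Equiv.Perm Disk).surjective).symm
  have htd : ((↑) '' t : Set ℂ) ⊆ disk := Subtype.coe_image_subset _ _
  rw [hypArea_apply hs, hypArea_apply ht, hst,
    lintegral_image_eq_lintegral_abs_det_fderiv_mul volume
      ((MeasurableEmbedding.subtype_coe isOpen_disk.measurableSet).measurableSet_image.2 ht)
      (f' := fun z => wirt (deriv (toPlane (γ : Equiv.Perm Disk)) z) 0)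
      (fun z hz => (HasDerivAt.hasWirt (hΓ.hasDerivAt γ.2 (htd hz))).hasFDerivWithinAt)]
  · refine setLIntegral_congr_fun
      ((MeasurableEmbedding.subtype_coe isOpen_disk.measurableSet).measurableSet_image.2 ht)
      fun z hz => ?_
    simp only [det_eq_jac, jac_wirt, norm_zero]
    rw [← ENNReal.ofReal_mul (abs_nonneg _), ← hΓ.norm_deriv_sq_mul_eta γ.2 (htd hz)]
    simp
  · intro x hx y hy hxy
    have := congrArg (toPlane ((γ : Equiv.Perm Disk)⁻¹ : Equiv.Perm Disk)) hxy
    rwa [toPlane_inv_toPlane _ (htd hx), toPlane_inv_toPlane _ (htd hy)] at this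

/-- Every point has a neighbourhood which is disjoint from its nontrivial translates. -/
lemma IsSurfaceGroup.exists_nhds_disjoint (hΓ : IsSurfaceGroup Γ) (x : Disk) :
    ∃ U ∈ nhds x, ∀ γ ∈ Γ, ∀ y ∈ U, γ y ∈ U → γ = 1 := by
  have := hΓ.properlyDiscontinuous
  have := hΓ.continuousConstSMul
  have : LocallyCompactSpace Disk := isOpen_disk.locallyCompactSpace
  obtain ⟨U, hU, h⟩ := ProperlyDiscontinuousSMul.exists_nhds_image_smul_eq_self Γ x
  exact ⟨U, hU, fun γ hγ y hy hγy => hΓ.free γ hγ x (h ⟨γ, hγ⟩ ⟨γ y, ⟨y, hy, rfl⟩, hγy⟩)⟩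

end

section

/-! ### Equivariant extension of local perturbations -/

/-- `B` is disjoint from its nontrivial translates under `Γ`. -/
def IsWandering (Γ : Subgroup (Equiv.Perm Disk)) (B : Set Disk) : Prop :=
  ∀ γ ∈ Γ, ∀ y ∈ B, γ y ∈ B → γ = 1

/-- The `Γ`-equivariant self-map of the disk which is `G` on `B` and the identity off the
translates of `B`. -/
def equivariantExt (Γ : Subgroup (Equiv.Perm Disk)) (B : Set Disk) (G : Disk → Disk) (w : Disk) :
    Disk :=
  open Classical in
  if h : ∃ γ ∈ Γ, γ⁻¹ w ∈ B then h.choose (G (h.choose⁻¹ w)) else w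

variable {Γ : Subgroup (Equiv.Perm Disk)} {B K : Set Disk} {G : Disk → Disk}

/-- Well-definedness: two translates of a wandering set that share a point come from the same group
element, so the chosen element must be `γ`. -/
lemma equivariantExt_apply (hB : IsWandering Γ B) {γ : Equiv.Perm Disk} (hγ : γ ∈ Γ) {y : Disk}
    (hy : y ∈ B) : equivariantExt Γ B G (γ y) = γ (G y) := by
  have h : ∃ δ ∈ Γ, δ⁻¹ (γ y) ∈ B := ⟨γ, hγ, by simpa using hy⟩
  rw [equivariantExt, dif_pos h]
  obtain ⟨h1, h2⟩ := h.choose_spec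
  have h3 := hB _ (Γ.mul_mem (Γ.inv_mem h1) hγ) y hy (by simpa using h2)
  have h4 : h.choose = γ := inv_mul_eq_one.1 h3
  calc h.choose (G (h.choose⁻¹ (γ y))) = γ (G (γ⁻¹ (γ y))) := congrArg₂
        (fun δ ε : Equiv.Perm Disk => δ (G (ε⁻¹ (γ y)))) h4 h4
    _ = γ (G y) := by simp

lemma equivariantExt_apply_mem (hB : IsWandering Γ B) {y : Disk} (hy : y ∈ B) :
    equivariantExt Γ B G y = G y := by
  simpa using equivariantExt_apply (G := G) hB Γ.one_mem hy

lemma equivariantExt_of_notMem {w : Disk} (hw : ∀ γ ∈ Γ, γ⁻¹ w ∉ B) :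
    equivariantExt Γ B G w = w := by
  rw [equivariantExt, dif_neg]
  rintro ⟨γ, hγ, h⟩
  exact hw γ hγ h

lemma equivariantExt_eq_self (hB : IsWandering Γ B) (hG : ∀ y, y ∉ K → G y = y) {w : Disk}
    (hw : ∀ γ ∈ Γ, γ⁻¹ w ∉ K) : equivariantExt Γ B G w = w := by
  by_cases h : ∃ γ ∈ Γ, γ⁻¹ w ∈ B
  · obtain ⟨γ, hγ, hy⟩ := h
    have := equivariantExt_apply (G := G) hB hγ hy
    rw [hG _ (hw γ hγ)] at this
    simpa using this
  · push Not at h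
    exact equivariantExt_of_notMem h

lemma equivariantExt_smul (hB : IsWandering Γ B) {γ : Equiv.Perm Disk} (hγ : γ ∈ Γ) (w : Disk) :
    equivariantExt Γ B G (γ w) = γ (equivariantExt Γ B G w) := by
  by_cases h : ∃ δ ∈ Γ, δ⁻¹ w ∈ B
  · obtain ⟨δ, hδ, hy⟩ := h
    obtain ⟨y, rfl⟩ := δ.surjective w
    replace hy : y ∈ B := by simpa using hy
    rw [equivariantExt_apply hB hδ hy]
    simpa using equivariantExt_apply (G := G) hB (Γ.mul_mem hγ hδ) hy
  · push Not at h
    rw [equivariantExt_of_notMem h, equivariantExt_of_notMem]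
    intro δ hδ
    simpa using h _ (Γ.mul_mem (Γ.inv_mem hγ) hδ)

lemma equivariantExt_leftInverse (hB : IsWandering Γ B) {G' : Disk → Disk}
    (hG : Set.MapsTo G B B) (hGG : ∀ y ∈ B, G' (G y) = y) :
    Function.LeftInverse (equivariantExt Γ B G') (equivariantExt Γ B G) := by
  intro w
  by_cases h : ∃ δ ∈ Γ, δ⁻¹ w ∈ B
  · obtain ⟨δ, hδ, hy⟩ := h
    obtain ⟨y, rfl⟩ := δ.surjective w
    replace hy : y ∈ B := by simpa using hy
    rw [equivariantExt_apply hB hδ hy, equivariantExt_apply hB hδ (hG hy), hGG y hy]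
  · push Not at h
    rw [equivariantExt_of_notMem h, equivariantExt_of_notMem h]

/-- By proper discontinuity the translates of a compact set form a locally finite family of closed
sets, whose union is closed. -/
lemma IsSurfaceGroup.isOpen_compl_translates (hΓ : IsSurfaceGroup Γ) (hK : IsCompact K) :
    IsOpen {w : Disk | ∀ γ ∈ Γ, γ⁻¹ w ∉ K} := by
  have := hΓ.properlyDiscontinuous
  have : LocallyCompactSpace Disk := isOpen_disk.locallyCompactSpace
  have hc : ∀ γ : Γ, IsClosed ((γ • ·) '' K) := fun γ =>
    (hK.image (hΓ.continuous γ.2)).isClosed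
  have hl : LocallyFinite fun γ : Γ => (γ • ·) '' K := by
    intro x
    obtain ⟨L, hL, hx⟩ := exists_compact_mem_nhds x
    exact ⟨L, hx, ProperlyDiscontinuousSMul.finite_disjoint_inter_image hK hL⟩
  have := (hl.isClosed_iUnion hc).isOpen_compl
  convert this using 1
  ext w
  simp only [Set.mem_compl_iff, Set.mem_iUnion, Set.mem_image, not_exists, not_and]
  constructor
  · rintro h γ y hy rfl
    refine h γ γ.2 ?_
    rwa [show (γ : Equiv.Perm Disk)⁻¹ (γ • y) = y from (γ : Equiv.Perm Disk).symm_apply_apply y]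
  · intro h γ hγ hK'
    exact h ⟨γ, hγ⟩ _ hK' (γ.apply_symm_apply w)

/-- The translates of `B` and the complement of the translates of `K` are open and, as `K ⊆ B`,
cover the disk. On the former the map is locally `δ G δ⁻¹`, on the latter the identity. -/
lemma IsSurfaceGroup.continuous_equivariantExt (hΓ : IsSurfaceGroup Γ) (hB : IsWandering Γ B)
    (hBo : IsOpen B) (hK : IsCompact K) (hKB : K ⊆ B) (hG : Continuous G)
    (hGK : ∀ y, y ∉ K → G y = y) : Continuous (equivariantExt Γ B G) := by
  rw [continuous_iff_continuousAt]
  intro w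
  by_cases h : ∃ δ ∈ Γ, δ⁻¹ w ∈ B
  · obtain ⟨δ, hδ, hy⟩ := h
    have hc : Continuous fun x => δ (G (δ⁻¹ x)) :=
      (hΓ.continuous hδ).comp (hG.comp (hΓ.continuous (Γ.inv_mem hδ)))
    refine hc.continuousAt.congr ?_
    filter_upwards [(hBo.preimage (hΓ.continuous (Γ.inv_mem hδ))).mem_nhds hy] with x hx
    have h1 := equivariantExt_apply (G := G) hB hδ hx
    rw [show δ (δ⁻¹ x) = x from δ.apply_symm_apply x] at h1
    exact h1.symm
  · push Not at h
    refine continuousAt_id.congr ?_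
    filter_upwards [(hΓ.isOpen_compl_translates hK).mem_nhds
      (fun γ hγ hγK => h γ hγ (hKB hγK))] with x hx
    exact (equivariantExt_eq_self hB hGK hx).symm

/-- The equivariant extension of a homeomorphism as a homeomorphism. -/
def equivariantHomeo (hΓ : IsSurfaceGroup Γ) (hB : IsWandering Γ B)
    (hBo : IsOpen B) (hK : IsCompact K) (hKB : K ⊆ B) (G : Disk ≃ₜ Disk)
    (hGK : ∀ y, y ∉ K → G y = y) (hGK' : ∀ y, y ∉ K → G.symm y = y) : Disk ≃ₜ Disk where
  toFun := equivariantExt Γ B G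
  invFun := equivariantExt Γ B G.symm
  -- `G` maps `B` into itself: were `G y` outside `B ⊇ K`, the inverse would fix it, so that `y = G
  -- y`.
  left_inv := equivariantExt_leftInverse hB (fun y hy => by
    by_contra h
    have h1 := hGK' _ fun hk => h (hKB hk)
    rw [G.symm_apply_apply] at h1
    exact h (h1 ▸ hy)) fun y _ => G.symm_apply_apply y
  right_inv := equivariantExt_leftInverse hB (fun y hy => by
    by_contra h
    have h1 := hGK _ fun hk => h (hKB hk)
    rw [G.apply_symm_apply] at h1
    exact h (h1 ▸ hy)) fun y _ => G.apply_symm_apply y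
  continuous_toFun := hΓ.continuous_equivariantExt hB hBo hK hKB G.continuous hGK
  continuous_invFun := hΓ.continuous_equivariantExt hB hBo hK hKB G.symm.continuous hGK'

lemma eventuallyEq_toPlane {g : Disk → Disk} {F : ℂ → ℂ} {z : Disk}
    (h : ∀ᶠ x in nhds z, (g x : ℂ) = F x) : toPlane g =ᶠ[nhds (z : ℂ)] F := by
  rw [← isOpen_disk.isOpenEmbedding_subtypeVal.map_nhds_eq z, Filter.EventuallyEq,
    Filter.eventually_map]
  filter_upwards [h] with x hx
  rw [toPlane_coe, hx]

/-- Push a perturbation `G` of the identity, supported in a wandering set, forward to an automorphic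
perturbation of `f`. -/
theorem exists_automorphic_perturbation {Γ Γ' : Subgroup (Equiv.Perm Disk)}
    (hΓ' : IsSurfaceGroup Γ') {θ : Γ ≃* Γ'} {f : Disk ≃ₜ Disk}
    (hf : ContDiffOn ℝ ∞ (toPlane f) disk) (hJ : ∀ z ∈ disk, jac (fderiv ℝ (toPlane f) z) ≠ 0)
    (hθ : ∀ (γ : Γ) (z : Disk), f (γ • z) = θ γ • f z)
    (hB : IsWandering Γ' B) (hBo : IsOpen B) (hK : IsCompact K) (hKB : K ⊆ B)
    (G : ℂ ≃ₜ ℂ) (hG : ContDiff ℝ ∞ G) (hGJ : ∀ w, jac (fderiv ℝ G w) ≠ 0)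
    (hGK : ∀ w, w ∉ ((↑) '' K : Set ℂ) → G w = w) :
    ∃ F : Disk ≃ₜ Disk, (∀ (γ : Γ) (z : Disk), F (γ • z) = θ γ • F z) ∧
      ContDiffOn ℝ ∞ (toPlane F) disk ∧ (∀ z ∈ disk, jac (fderiv ℝ (toPlane F) z) ≠ 0) ∧
      (∀ z : Disk, f z ∈ B →
        fderiv ℝ (toPlane F) z = (fderiv ℝ G (f z)).comp (fderiv ℝ (toPlane f) z)) ∧
      ∀ z : Disk, (∀ γ ∈ Γ', γ⁻¹ (f z) ∉ B) →
        fderiv ℝ (toPlane F) z = fderiv ℝ (toPlane f) z := by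
  have hGK' : ∀ w, w ∉ ((↑) '' K : Set ℂ) → G.symm w = w := fun w hw => by
    rw [Homeomorph.symm_apply_eq, hGK w hw]
  have hKd : ((↑) '' K : Set ℂ) ⊆ disk := Subtype.coe_image_subset _ _
  -- `G` is a bijection fixing everything outside `K`, which lies in the disk, so it preserves the
  -- disk.
  have hGd : ∀ w, w ∈ disk ↔ G w ∈ disk := by
    intro w
    constructor <;> intro h
    · by_contra h1
      have h2 := hGK' _ fun hk => h1 (hKd hk)
      rw [G.symm_apply_apply] at h2
      exact h1 (h2 ▸ h)
    · by_contra h1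
      rw [hGK _ fun hk => h1 (hKd hk)] at h
      exact h1 h
  let Gd : Disk ≃ₜ Disk := G.subtype hGd
  have hGdc : ∀ y : Disk, (Gd y : ℂ) = G y := fun y => rfl
  have hmemK : ∀ {y : Disk}, y ∉ K → (y : ℂ) ∉ ((↑) '' K : Set ℂ) := fun {y} hy h =>
    hy (Subtype.val_injective.mem_set_image.1 h)
  have hGdK : ∀ y, y ∉ K → Gd y = y := fun y hy => Subtype.ext (hGK _ (hmemK hy))
  have hGdK' : ∀ y, y ∉ K → Gd.symm y = y := fun y hy => Subtype.ext (hGK' _ (hmemK hy))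
  let E := equivariantHomeo hΓ' hB hBo hK hKB Gd hGdK hGdK'
  have hE : ∀ w, E w = equivariantExt Γ' B Gd w := fun w => rfl
  have hfc : ∀ z : Disk, ContDiffAt ℝ ∞ (toPlane f) z := fun z =>
    hf.contDiffAt (isOpen_disk.mem_nhds z.2)
  have near : ∀ (z : Disk), ∀ γ ∈ Γ', γ⁻¹ (f z) ∈ B → toPlane (f.trans E) =ᶠ[nhds (z : ℂ)]
      fun x => toPlane γ (G (toPlane (γ⁻¹ : Equiv.Perm Disk) (toPlane f x))) := by
    intro z γ hγ hz
    refine eventuallyEq_toPlane ?_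
    have ho : IsOpen {x : Disk | γ⁻¹ (f x) ∈ B} :=
      hBo.preimage ((hΓ'.continuous (Γ'.inv_mem hγ)).comp f.continuous)
    filter_upwards [ho.mem_nhds hz] with x hx
    have h1 := equivariantExt_apply (G := Gd) hB hγ hx
    rw [show γ (γ⁻¹ (f x)) = f x from γ.apply_symm_apply _] at h1
    rw [Homeomorph.trans_apply, hE, h1, toPlane_coe, toPlane_coe, ← hGdc, toPlane_coe]
  have near1 : ∀ (z : Disk), f z ∈ B → toPlane (f.trans E) =ᶠ[nhds (z : ℂ)]
      fun x => G (toPlane f x) := by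
    intro z hz
    refine eventuallyEq_toPlane ?_
    filter_upwards [(hBo.preimage f.continuous).mem_nhds hz] with x hx
    rw [Homeomorph.trans_apply, hE, equivariantExt_apply_mem hB hx, toPlane_coe, hGdc]
  have far : ∀ z : Disk, (∀ γ ∈ Γ', γ⁻¹ (f z) ∉ B) →
      toPlane (f.trans E) =ᶠ[nhds (z : ℂ)] toPlane f := by
    intro z hz
    refine eventuallyEq_toPlane ?_
    filter_upwards [((hΓ'.isOpen_compl_translates hK).preimage f.continuous).mem_nhds
      (fun γ hγ hγK => hz γ hγ (hKB hγK))] with x hx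
    rw [Homeomorph.trans_apply, hE, equivariantExt_eq_self hB hGdK hx, toPlane_coe]
  -- Locally the new map is either `γ ∘ G ∘ γ⁻¹ ∘ f`, a composition of smooth maps with nonzero
  -- Jacobians, or `f` itself.
  have main : ∀ z : Disk, ContDiffAt ℝ ∞ (toPlane (f.trans E)) z ∧
      jac (fderiv ℝ (toPlane (f.trans E)) z) ≠ 0 := by
    intro z
    by_cases h : ∃ γ ∈ Γ', γ⁻¹ (f z) ∈ B
    · obtain ⟨γ, hγ, hz⟩ := h
      have hn := near z γ hγ hz
      have e1 : toPlane f z = f z := toPlane_coe _ _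
      have e2 : toPlane (γ⁻¹ : Equiv.Perm Disk) (f z) = (γ⁻¹ (f z) : Disk) := toPlane_coe _ _
      have e3 : G (γ⁻¹ (f z) : Disk) = (Gd (γ⁻¹ (f z)) : Disk) := rfl
      have c1 : ContDiffAt ℝ ∞ (toPlane (γ⁻¹ : Equiv.Perm Disk)) (toPlane f z) := by
        rw [e1]; exact (hΓ'.contDiffOn (Γ'.inv_mem hγ)).contDiffAt (isOpen_disk.mem_nhds (f z).2)
      have c2 : ContDiffAt ℝ ∞ G (toPlane (γ⁻¹ : Equiv.Perm Disk) (toPlane f z)) := hG.contDiffAt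
      have m3 : G (toPlane (γ⁻¹ : Equiv.Perm Disk) (toPlane f z)) ∈ disk := by
        rw [e1, e2, e3]; exact (Gd _).2
      have c3 : ContDiffAt ℝ ∞ (toPlane γ)
          (G (toPlane (γ⁻¹ : Equiv.Perm Disk) (toPlane f z))) :=
        (hΓ'.contDiffOn hγ).contDiffAt (isOpen_disk.mem_nhds m3)
      refine ⟨(c3.comp (z : ℂ) (c2.comp (z : ℂ) (c1.comp (z : ℂ) (hfc z)))).congr_of_eventuallyEq
        hn, ?_⟩
      have d0 := ((hfc z).differentiableAt (by simp)).hasFDerivAt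
      have d1 : HasFDerivAt _ _ _ := HasDerivAt.hasWirt (hΓ'.hasDerivAt (Γ'.inv_mem hγ) (e1 ▸ (f z).2))
      have d2 := (c2.differentiableAt (by simp)).hasFDerivAt
      have d3 : HasFDerivAt _ _ _ := HasDerivAt.hasWirt (hΓ'.hasDerivAt hγ m3)
      have d := HasFDerivAt.comp (z : ℂ) d3 (d2.comp (z : ℂ) (HasFDerivAt.comp (z : ℂ) d1 d0))
      have d' := (d.congr_of_eventuallyEq hn).fderiv
      rw [d', jac_comp, jac_comp, jac_comp, jac_wirt, jac_wirt]
      refine mul_ne_zero ?_ (mul_ne_zero (hGJ _) (mul_ne_zero ?_ (hJ z z.2)))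
      · simpa using hΓ'.deriv_ne_zero hγ m3
      · simpa using hΓ'.deriv_ne_zero (Γ'.inv_mem hγ) (f z).2
    · push Not at h
      have hn := far z h
      exact ⟨(hfc z).congr_of_eventuallyEq hn, by rw [hn.fderiv_eq]; exact hJ z z.2⟩
  refine ⟨f.trans E, fun γ z => ?_, fun z hz => (main ⟨z, hz⟩).1.contDiffWithinAt,
    fun z hz => (main ⟨z, hz⟩).2, fun z hz => ?_, fun z hz => (far z hz).fderiv_eq⟩
  · rw [Homeomorph.trans_apply, Homeomorph.trans_apply, hθ, hE, hE]
    exact equivariantExt_smul hB (θ γ).2 (f z)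
  · rw [(near1 z hz).fderiv_eq]
    have := ((hG.differentiable (by simp) (toPlane f z)).hasFDerivAt.comp (z : ℂ)
      ((hfc z).differentiableAt (by simp)).hasFDerivAt).fderiv
    rw [toPlane_coe] at this
    exact this

end

/-! ### Local minimality -/

/-- The part of a fundamental domain covered by the translates of a wandering set has the same
integrals as that set, for invariant integrands. -/
lemma setLIntegral_fundamentalDomain_eq {Γ : Subgroup (Equiv.Perm Disk)} (hΓ : IsSurfaceGroup Γ)
    {P : Set Disk} (hP : IsFundamentalDomain Γ P hypArea) {A : Set Disk} (hA : MeasurableSet A)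
    (hw : IsWandering Γ A) {ρ : Disk → ℝ≥0∞} (hρ : Measurable ρ)
    (hinv : ∀ (γ : Γ) (z : Disk), ρ (γ • z) = ρ z) :
    ∫⁻ z in P, {z | ∃ γ : Γ, γ⁻¹ • z ∈ A}.indicator ρ z ∂hypArea = ∫⁻ z in A, ρ z ∂hypArea := by
  have := hΓ.smulInvariantMeasure
  have := hΓ.continuousConstSMul
  have := hΓ.countable
  -- Unfolding: the integral over `A` is the sum over `γ` of integrals over `P` of the translated
  -- integrand. As `A` is wandering, at most one `γ` contributes at each point, and invariance turns
  -- its term into `ρ z`.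
  rw [← lintegral_indicator hA, hP.lintegral_eq_tsum', ← lintegral_tsum]
  · refine lintegral_congr fun z => ?_
    by_cases hz : ∃ γ : Γ, γ⁻¹ • z ∈ A
    · obtain ⟨γ, hγ⟩ := hz
      rw [tsum_eq_single γ, Set.indicator_of_mem hγ, hinv,
        Set.indicator_of_mem (s := {z | ∃ γ : Γ, γ⁻¹ • z ∈ A}) ⟨γ, hγ⟩]
      intro δ hδ
      refine Set.indicator_of_notMem (fun h => hδ ?_) _
      have h1 := hw _ (δ⁻¹ * γ).2 (γ⁻¹ • z) hγ (by
        have : (δ⁻¹ * γ) • γ⁻¹ • z ∈ A := by rwa [smul_smul, mul_inv_cancel_right]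
        exact this)
      have h2 : δ⁻¹ * γ = 1 := Subtype.ext h1
      exact inv_mul_eq_one.1 h2
    · rw [Set.indicator_of_notMem (s := {z | ∃ γ : Γ, γ⁻¹ • z ∈ A}) hz, eq_comm,
        ENNReal.tsum_eq_zero]
      intro γ
      exact Set.indicator_of_notMem (fun h => hz ⟨γ, h⟩) _
  · intro γ
    exact ((hρ.indicator hA).comp (measurable_const_smul γ⁻¹)).aemeasurable

/-- The distortion of an automorphic map is an automorphic function. -/
lemma distortion_fderiv_smul {Γ Γ' : Subgroup (Equiv.Perm Disk)} (hΓ : IsSurfaceGroup Γ)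
    (hΓ' : IsSurfaceGroup Γ') {θ : Γ ≃* Γ'} {F : Disk ≃ₜ Disk}
    (hF : ContDiffOn ℝ ∞ (toPlane F) disk)
    (hθ : ∀ (γ : Γ) (z : Disk), F (γ • z) = θ γ • F z) (γ : Γ) (z : Disk) :
    distortion (fderiv ℝ (toPlane F) (γ • z : Disk)) = distortion (fderiv ℝ (toPlane F) z) := by
  have hd : ∀ z : Disk, HasFDerivAt (toPlane F) (fderiv ℝ (toPlane F) z) z := fun z =>
    ((hF.contDiffAt (isOpen_disk.mem_nhds z.2)).differentiableAt (by simp)).hasFDerivAt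
  have e1 : toPlane (γ : Equiv.Perm Disk) z = (γ • z : Disk) := toPlane_coe _ _
  have e2 : toPlane F z = F z := toPlane_coe _ _
  have d1 : HasFDerivAt _ _ _ := HasDerivAt.hasWirt (hΓ.hasDerivAt γ.2 z.2)
  have d2 : HasFDerivAt _ _ _ := HasDerivAt.hasWirt (hΓ'.hasDerivAt (θ γ).2 (F z).2)
  have d3 : HasFDerivAt _ _ _ := (e1 ▸ hd (γ • z)).comp (z : ℂ) d1
  have d4 : HasFDerivAt _ _ _ := (e2 ▸ d2).comp (z : ℂ) (hd z)
  have heq : (toPlane F ∘ toPlane (γ : Equiv.Perm Disk)) =ᶠ[nhds (z : ℂ)]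
      (toPlane (θ γ : Equiv.Perm Disk) ∘ toPlane F) := by
    filter_upwards [isOpen_disk.mem_nhds z.2] with x hx
    have h := hθ γ ⟨x, hx⟩
    simp only [Function.comp_apply]
    rw [toPlane_of_mem _ hx, toPlane_of_mem F hx, toPlane_coe, toPlane_coe]
    exact congrArg Subtype.val h
  have h5 := (d3.congr_of_eventuallyEq heq.symm).unique d4
  rw [e1, e2] at h5
  rw [← distortion_comp_conformal (hΓ.deriv_ne_zero γ.2 z.2), h5,
    distortion_conformal_comp (hΓ'.deriv_ne_zero (θ γ).2 (F z).2)]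

/-- Hyperbolic area is absolutely continuous, so the energy does not depend on the representative of
the weak differential. -/
lemma energy_congr {p : ℝ} {P : Set Disk} {D D' : ℂ → ℂ →L[ℝ] ℂ}
    (h : ∀ᵐ z, z ∈ disk → D z = D' z) : energy p P D = energy p P D' := by
  refine lintegral_congr_ae (ae_restrict_of_ae ?_)
  have h1 : ∀ᵐ z : Disk ∂(Measure.comap (Subtype.val : Disk → ℂ) volume), D z = D' z := by
    rw [← ae_restrict_iff' isOpen_disk.measurableSet,
      ← map_comap_subtype_coe isOpen_disk.measurableSet] at h
    exact ae_of_ae_map measurable_subtype_coe.aemeasurable h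
  filter_upwards [(withDensity_absolutelyContinuous _ _).ae_le h1] with z hz
  rw [hz]

/-- Among automorphic maps which differ from a smooth minimiser only in the translates of a wandering
set, the minimiser has the least energy over that set. -/
lemma setLIntegral_le_of_isMinimiser {p : ℝ} {Γ Γ' : Subgroup (Equiv.Perm Disk)}
    (hΓ : IsSurfaceGroup Γ) (hΓ' : IsSurfaceGroup Γ') {θ : Γ ≃* Γ'} {P : Set Disk}
    (hP : IsFundamentalDomain Γ P hypArea) {f : Disk ≃ₜ Disk}
    (hf : ContDiffOn ℝ ∞ (toPlane f) disk) (hmin : IsMinimiser θ p P f) {A : Set Disk}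
    (hA : MeasurableSet A) (hw : IsWandering Γ A) {F : Disk ≃ₜ Disk}
    (hF : ContDiffOn ℝ ∞ (toPlane F) disk) (hJ : ∀ z ∈ disk, jac (fderiv ℝ (toPlane F) z) ≠ 0)
    (hθ : ∀ (γ : Γ) (z : Disk), F (γ • z) = θ γ • F z)
    (hfF : ∀ z : Disk, (¬ ∃ γ : Γ, γ⁻¹ • z ∈ A) →
      fderiv ℝ (toPlane F) z = fderiv ℝ (toPlane f) z) :
    ∫⁻ z in A, ENNReal.ofReal (Real.exp (p * distortion (fderiv ℝ (toPlane f) z))) ∂hypArea ≤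
      ∫⁻ z in A, ENNReal.ofReal (Real.exp (p * distortion (fderiv ℝ (toPlane F) z))) ∂hypArea := by
  obtain ⟨D, hD, hle⟩ := hmin
  have hED : energy p P D = energy p P (fderiv ℝ (toPlane f)) :=
    energy_congr (hD.weak.ae_eq_fderiv isOpen_disk hf)
  have hfin : energy p P (fderiv ℝ (toPlane f)) < ⊤ := hED ▸ hD.energy_lt_top
  have hle' : energy p P (fderiv ℝ (toPlane f)) ≤ energy p P (fderiv ℝ (toPlane F)) := by
    -- Only competitors of finite energy are admissible; for the others the inequality is trivial.
    by_cases htop : energy p P (fderiv ℝ (toPlane F)) < ⊤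
    · rw [← hED]
      exact hle F _ ⟨hasWeakDifferential_fderiv isOpen_disk hF,
        finiteDistortion_fderiv isOpen_disk hF hJ, htop, hθ⟩
    · rw [not_lt_top_iff.1 htop]; exact le_top
  have := hΓ.countable
  have := hΓ.continuousConstSMul
  have hmeas : ∀ g : Disk → Disk, Measurable fun z : Disk =>
      ENNReal.ofReal (Real.exp (p * distortion (fderiv ℝ (toPlane g) z))) := fun g =>
    (Real.measurable_exp.comp ((measurable_distortion.comp ((measurable_fderiv ℝ _).comp
      measurable_subtype_coe)).const_mul p)).ennreal_ofReal
  have hΩ : MeasurableSet {z : Disk | ∃ γ : Γ, γ⁻¹ • z ∈ A} := by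
    have : {z : Disk | ∃ γ : Γ, γ⁻¹ • z ∈ A} = ⋃ γ : Γ, (fun z : Disk => γ⁻¹ • z) ⁻¹' A := by
      ext z; simp
    rw [this]
    exact MeasurableSet.iUnion fun γ => measurable_const_smul γ⁻¹ hA
  have split : ∀ g : Disk ≃ₜ Disk, ContDiffOn ℝ ∞ (toPlane g) disk →
      (∀ (γ : Γ) (z : Disk), g (γ • z) = θ γ • g z) →
      energy p P (fderiv ℝ (toPlane g)) =
        ∫⁻ z in A, ENNReal.ofReal (Real.exp (p * distortion (fderiv ℝ (toPlane g) z))) ∂hypArea +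
        ∫⁻ z in P, {z | ∃ γ : Γ, γ⁻¹ • z ∈ A}ᶜ.indicator (fun z : Disk =>
          ENNReal.ofReal (Real.exp (p * distortion (fderiv ℝ (toPlane g) z)))) z ∂hypArea := by
    intro g hg hgθ
    rw [← setLIntegral_fundamentalDomain_eq hΓ hP hA hw (hmeas g) fun γ z => by
        rw [distortion_fderiv_smul hΓ hΓ' hg hgθ],
      ← lintegral_add_left ((hmeas g).indicator hΩ), energy]
    refine lintegral_congr fun z => ?_
    exact (congrFun (Set.indicator_self_add_compl {z : Disk | ∃ γ : Γ, γ⁻¹ • z ∈ A}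
      fun z : Disk => ENNReal.ofReal (Real.exp (p * distortion (fderiv ℝ (toPlane g) z)))) z).symm
  have hC : ∀ z : Disk, {z | ∃ γ : Γ, γ⁻¹ • z ∈ A}ᶜ.indicator (fun z : Disk =>
      ENNReal.ofReal (Real.exp (p * distortion (fderiv ℝ (toPlane F) z)))) z =
      {z | ∃ γ : Γ, γ⁻¹ • z ∈ A}ᶜ.indicator (fun z : Disk =>
        ENNReal.ofReal (Real.exp (p * distortion (fderiv ℝ (toPlane f) z)))) z := by
    intro z
    by_cases hz : ∃ γ : Γ, γ⁻¹ • z ∈ A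
    · have hz' : z ∉ {z : Disk | ∃ γ : Γ, γ⁻¹ • z ∈ A}ᶜ := fun h => h hz
      rw [Set.indicator_of_notMem hz', Set.indicator_of_notMem hz']
    · have hz' : z ∈ {z : Disk | ∃ γ : Γ, γ⁻¹ • z ∈ A}ᶜ := hz
      rw [Set.indicator_of_mem hz', Set.indicator_of_mem hz', hfF z hz]
  rw [split f hf hD.automorphic] at hfin hle'
  rw [split F hF hθ] at hle'
  simp only [hC] at hle'
  -- The contribution off the translates of `A` is common to both sides and finite, so it cancels.
  exact (ENNReal.add_le_add_iff_right (ENNReal.add_lt_top.1 hfin).2.ne).1 hle'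

/-! ### The energy as an integral over the target -/

/-- The hyperbolic area form, transported by `H`. -/
def areaWeight (H : ℂ → ℂ) (w : ℂ) : ℝ := |jac (fderiv ℝ H w)| * eta (H w)

/-- The energy density of `A ∘ DF` at `H(w)`, as a density in `w`; here `H` is the inverse of `F`. -/
def energyDensity (p : ℝ) (F H : ℂ → ℂ) (A : ℂ →L[ℝ] ℂ) (w : ℂ) : ℝ :=
  areaWeight H w * Real.exp (p * distortion (A.comp (fderiv ℝ F (H w))))

lemma IsDiffeo.fderiv_comp_fderiv_symm {f : Disk ≃ₜ Disk} (hf : IsDiffeo f) {w : ℂ}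
    (hw : w ∈ disk) :
    (fderiv ℝ (toPlane f) (toPlane f.symm w)).comp (fderiv ℝ (toPlane f.symm) w) =
      ContinuousLinearMap.id ℝ ℂ := by
  have h1 := ((hf.2.contDiffAt (isOpen_disk.mem_nhds hw)).differentiableAt (by simp)).hasFDerivAt
  have h2 := ((hf.1.contDiffAt (isOpen_disk.mem_nhds
    (toPlane_mem f.symm hw))).differentiableAt (by simp)).hasFDerivAt
  refine (h2.comp w h1).unique ((hasFDerivAt_id w).congr_of_eventuallyEq ?_)
  filter_upwards [isOpen_disk.mem_nhds hw] with x hx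
  exact toPlane_symm_toPlane f.symm hx

lemma IsDiffeo.symm {f : Disk ≃ₜ Disk} (hf : IsDiffeo f) : IsDiffeo f.symm := ⟨hf.2, hf.1⟩

lemma IsDiffeo.jac_ne_zero {f : Disk ≃ₜ Disk} (hf : IsDiffeo f) {z : ℂ} (hz : z ∈ disk) :
    jac (fderiv ℝ (toPlane f) z) ≠ 0 :=
  (jac_ne_zero_of_comp_eq_id (hf.symm.fderiv_comp_fderiv_symm hz)).2

/-- Localises minimality to a wandering disc in the target. Written in `w = f(z)`, the domain and
the weight no longer depend on the variation, which enters only through the linear map `DG(w)`. -/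
theorem exists_ball_local_minimality {p : ℝ} {Γ Γ' : Subgroup (Equiv.Perm Disk)}
    (hΓ : IsSurfaceGroup Γ) (hΓ' : IsSurfaceGroup Γ') {θ : Γ ≃* Γ'} {P : Set Disk}
    (hP : IsFundamentalDomain Γ P hypArea) {f : Disk ≃ₜ Disk} (hf : IsDiffeo f)
    (hmin : IsMinimiser θ p P f) {w₀ : ℂ} (hw₀ : w₀ ∈ disk) :
    ∃ r > 0, Metric.closedBall w₀ r ⊆ disk ∧ ∀ G : ℂ ≃ₜ ℂ, ContDiff ℝ ∞ G →
      (∀ w, jac (fderiv ℝ G w) ≠ 0) → ∀ K ⊆ Metric.ball w₀ r, IsCompact K →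
      (∀ w, w ∉ K → G w = w) →
      ∫⁻ w in Metric.ball w₀ r, ENNReal.ofReal
          (energyDensity p (toPlane f) (toPlane f.symm) (ContinuousLinearMap.id ℝ ℂ) w) ≤
        ∫⁻ w in Metric.ball w₀ r, ENNReal.ofReal
          (energyDensity p (toPlane f) (toPlane f.symm) (fderiv ℝ G w) w) := by
  obtain ⟨U, hU, hUw⟩ := hΓ'.exists_nhds_disjoint ⟨w₀, hw₀⟩
  have hU' : ((↑) '' U : Set ℂ) ∈ nhds w₀ := by
    have := isOpen_disk.isOpenEmbedding_subtypeVal.map_nhds_eq ⟨w₀, hw₀⟩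
    simp only at this
    rw [← this]
    exact Filter.image_mem_map hU
  obtain ⟨r, hr, hrU⟩ := Metric.nhds_basis_closedBall.mem_iff.1 hU'
  have hrd : Metric.closedBall w₀ r ⊆ disk := hrU.trans (Subtype.coe_image_subset _ _)
  have hbd : Metric.ball w₀ r ⊆ disk := Metric.ball_subset_closedBall.trans hrd
  refine ⟨r, hr, hrd, fun G hG hGJ K hKr hK hGK => ?_⟩
  set B : Set Disk := (↑) ⁻¹' Metric.ball w₀ r with hBdef
  have hBo : IsOpen B := Metric.isOpen_ball.preimage continuous_subtype_val
  have hBimg : ((↑) '' B : Set ℂ) = Metric.ball w₀ r := by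
    rw [hBdef, Subtype.image_preimage_coe, Set.inter_eq_right.2 hbd]
  have hBw : IsWandering Γ' B := by
    have hBU : B ⊆ U := fun y hy =>
      Subtype.val_injective.mem_set_image.1 (hrU (Metric.ball_subset_closedBall hy))
    exact fun γ hγ y hy hγy => hUw γ hγ y (hBU hy) (hBU hγy)
  set K' : Set Disk := (↑) ⁻¹' K with hK'def
  have hK'img : ((↑) '' K' : Set ℂ) = K := by
    rw [hK'def, Subtype.image_preimage_coe, Set.inter_eq_right.2 (hKr.trans hbd)]
  have hK' : IsCompact K' := by
    rw [Subtype.isCompact_iff, hK'img]; exact hK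
  obtain ⟨D, hD, -⟩ := id hmin
  have hθ := hD.automorphic
  obtain ⟨F, hFθ, hFs, hFJ, hFB, hFfar⟩ := exists_automorphic_perturbation hΓ' hf.1
    (fun z hz => hf.jac_ne_zero hz) hθ hBw hBo hK' (Set.preimage_mono hKr) G hG hGJ
    (by rwa [hK'img])
  set A : Set Disk := f ⁻¹' B with hAdef
  have hAo : IsOpen A := hBo.preimage f.continuous
  -- Equivariance carries a return of `z` to `A` to a return of `f z` to `B`; then `θ γ = 1`, and
  -- `θ` is injective.
  have hAw : IsWandering Γ A := by
    intro γ hγ z hz hγz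
    have h1 : f ((⟨γ, hγ⟩ : Γ) • z) ∈ B := hγz
    rw [hθ] at h1
    have h2 : θ ⟨γ, hγ⟩ = 1 := Subtype.ext (hBw _ (θ ⟨γ, hγ⟩).2 _ hz h1)
    rw [map_eq_one_iff θ θ.injective] at h2
    exact congrArg Subtype.val h2
  have hmain := setLIntegral_le_of_isMinimiser hΓ hΓ' hP hf.1 hmin hAo.measurableSet hAw hFs hFJ hFθ
    (fun z hz => hFfar z fun γ hγ hmem => hz ⟨θ.symm ⟨γ, hγ⟩, by
      change f ((θ.symm ⟨γ, hγ⟩)⁻¹ • z) ∈ B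
      rw [hθ, map_inv, MulEquiv.apply_symm_apply]
      exact hmem⟩)
  have hAimg : ((↑) '' A : Set ℂ) = toPlane f.symm '' Metric.ball w₀ r := by
    rw [← hBimg, Set.image_image]
    simp only [toPlane_coe]
    rw [← Set.image_image (fun z : Disk => (z : ℂ)) (fun z => f.symm z), f.symm.image_eq_preimage_symm]
    rfl
  have hmeas : ∀ g : Disk → Disk, Measurable fun z : ℂ =>
      ENNReal.ofReal (Real.exp (p * distortion (fderiv ℝ (toPlane g) z))) := fun g =>
    (Real.measurable_exp.comp
      ((measurable_distortion.comp (measurable_fderiv ℝ _)).const_mul p)).ennreal_ofReal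
  have hcv : ∀ g : ℂ → ℝ≥0∞, ∫⁻ z in toPlane f.symm '' Metric.ball w₀ r, g z =
      ∫⁻ w in Metric.ball w₀ r, ENNReal.ofReal |(fderiv ℝ (toPlane f.symm) w).det| *
        g (toPlane f.symm w) := fun g => by
    refine lintegral_image_eq_lintegral_abs_det_fderiv_mul volume Metric.isOpen_ball.measurableSet
      (fun w hw => ((hf.2.contDiffAt (isOpen_disk.mem_nhds (hbd hw))).differentiableAt
        (by simp)).hasFDerivAt.hasFDerivWithinAt) (fun x hx y hy hxy => ?_) g
    have := congrArg (toPlane f) hxy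
    have e := fun {x : ℂ} (hx : x ∈ disk) => toPlane_symm_toPlane f.symm hx
    simp only [Homeomorph.symm_symm] at e
    rwa [e (hbd hx), e (hbd hy)] at this
  rw [setLIntegral_hypArea hAo.measurableSet (hmeas f),
    setLIntegral_hypArea hAo.measurableSet (hmeas F), hAimg, hcv, hcv] at hmain
  have hform : ∀ w A, ENNReal.ofReal (energyDensity p (toPlane f) (toPlane f.symm) A w) =
      ENNReal.ofReal |(fderiv ℝ (toPlane f.symm) w).det| *
        (ENNReal.ofReal (eta (toPlane f.symm w)) * ENNReal.ofReal (Real.exp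
          (p * distortion (A.comp (fderiv ℝ (toPlane f) (toPlane f.symm w)))))) := by
    intro w A
    have h0 : 0 ≤ eta (toPlane f.symm w) := by unfold eta; positivity
    rw [energyDensity, areaWeight, det_eq_jac, ENNReal.ofReal_mul (by positivity),
      ENNReal.ofReal_mul (by positivity), mul_assoc]
  refine (le_of_eq ?_).trans (hmain.trans (le_of_eq ?_))
  · refine lintegral_congr fun w => ?_
    rw [hform, ContinuousLinearMap.id_comp]
  · refine setLIntegral_congr_fun Metric.isOpen_ball.measurableSet fun w hw => ?_
    have hwd := hbd hw
    have e1 : toPlane f.symm w = f.symm ⟨w, hwd⟩ := toPlane_of_mem _ hwd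
    have e2 := hFB (f.symm ⟨w, hwd⟩) (by
      rw [f.apply_symm_apply]; exact hw)
    rw [f.apply_symm_apply] at e2
    rw [hform, e1, e2]

/-! ### Twists, and the orientation of a smooth minimiser -/

/-- The twist `w ↦ c + (w - c) exp(i ψ(|w - c|²))` about `c`. -/
def twist (c : ℂ) (ψ : ℝ → ℝ) (w : ℂ) : ℂ :=
  c + (w - c) * cexp (I * (ψ (‖w - c‖ ^ 2) : ℝ))

lemma norm_twist_sub (c : ℂ) (ψ : ℝ → ℝ) (w : ℂ) : ‖twist c ψ w - c‖ = ‖w - c‖ := by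
  simp [twist, mul_comm I, norm_exp_ofReal_mul_I]

lemma twist_twist_neg (c : ℂ) (ψ : ℝ → ℝ) (w : ℂ) : twist c (-ψ) (twist c ψ w) = w := by
  have h := norm_twist_sub c ψ w
  rw [twist, h]
  simp only [twist, add_sub_cancel_left, Pi.neg_apply, ofReal_neg, mul_neg]
  rw [mul_assoc, ← Complex.exp_add, add_neg_cancel, Complex.exp_zero, mul_one, add_sub_cancel]

lemma contDiff_twist (c : ℂ) {ψ : ℝ → ℝ} (hψ : ContDiff ℝ ∞ ψ) : ContDiff ℝ ∞ (twist c ψ) := by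
  have h1 : ContDiff ℝ ∞ fun w : ℂ => w - c := contDiff_id.sub contDiff_const
  have h2 : ContDiff ℝ ∞ fun w : ℂ => ((ψ (‖w - c‖ ^ 2) : ℝ) : ℂ) :=
    ofRealCLM.contDiff.comp (hψ.comp (h1.norm_sq ℝ))
  exact contDiff_const.add (h1.mul (contDiff_const.mul h2).cexp)

/-- The twist as a homeomorphism of the plane. -/
def twistHomeo (c : ℂ) {ψ : ℝ → ℝ} (hψ : ContDiff ℝ ∞ ψ) : ℂ ≃ₜ ℂ where
  toFun := twist c ψ
  invFun := twist c (-ψ)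
  left_inv := twist_twist_neg c ψ
  right_inv w := by simpa using twist_twist_neg c (-ψ) w
  continuous_toFun := (contDiff_twist c hψ).continuous
  continuous_invFun := (contDiff_twist c hψ.neg).continuous

lemma hasWirt_sub_const (c w : ℂ) : HasWirt (fun w => w - c) 1 0 w :=
  HasDerivAt.hasWirt ((hasDerivAt_id w).sub_const c)

lemma HasWirt.norm_sq {F : ℂ → ℂ} {a b z : ℂ} (h : HasWirt F a b z) :
    HasWirt (fun w => ((‖F w‖ ^ 2 : ℝ) : ℂ)) (a * conj (F z) + F z * conj b)
      (b * conj (F z) + F z * conj a) z := by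
  have e : (fun w => ((‖F w‖ ^ 2 : ℝ) : ℂ)) = fun w => F w * conj (F w) := by
    funext w; rw [Complex.mul_conj, normSq_eq_norm_sq]
  rw [e]
  exact h.mul h.conj

lemma HasWirt.const_add {F : ℂ → ℂ} {a b z : ℂ} (h : HasWirt F a b z) (c : ℂ) :
    HasWirt (fun w => c + F w) a b z := HasFDerivAt.const_add c h

/-- The differential of the twist. -/
lemma hasWirt_twist (c : ℂ) {ψ : ℝ → ℝ} {ψ' : ℝ} {w : ℂ} (hψ : HasDerivAt ψ ψ' (‖w - c‖ ^ 2)) :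
    HasWirt (twist c ψ)
      (cexp (I * (ψ (‖w - c‖ ^ 2) : ℝ)) * (1 + I * (ψ' * ‖w - c‖ ^ 2 : ℝ)))
      (cexp (I * (ψ (‖w - c‖ ^ 2) : ℝ)) * (I * (ψ' * (w - c) ^ 2))) w := by
  have h1 := hasWirt_sub_const c w
  have h2 := h1.norm_sq.ofReal_comp hψ
  have h3 : HasDerivAt (fun x : ℂ => cexp (I * x)) (cexp (I * (ψ (‖w - c‖ ^ 2) : ℝ)) * (I * 1))
      (ψ (‖w - c‖ ^ 2) : ℝ) := ((hasDerivAt_id _).const_mul I).cexp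
  have h4 := (HasDerivAt.hasWirt h3).comp (G := fun w => ((ψ (‖w - c‖ ^ 2) : ℝ) : ℂ)) h2
  refine ((h1.mul h4).const_add c).congr ?_ ?_
  · have : (((ψ' * ‖w - c‖ ^ 2 : ℝ)) : ℂ) = ψ' * ((w - c) * conj (w - c)) := by
      rw [Complex.mul_conj, normSq_eq_norm_sq]; push_cast; ring
    rw [this]
    simp
    ring
  · simp
    ring

/-- Each circle about `c` is merely rotated, so the twist preserves area. Composition with it
therefore leaves the Jacobian unchanged while increasing the shear. -/
lemma jac_fderiv_twist (c : ℂ) {ψ : ℝ → ℝ} (hψ : ContDiff ℝ ∞ ψ) (w : ℂ) :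
    jac (fderiv ℝ (twist c ψ) w) = 1 := by
  have h := hasWirt_twist c (w := w) ((hψ.differentiable (by simp)) (‖w - c‖ ^ 2)).hasDerivAt
  rw [HasFDerivAt.fderiv h, jac_wirt]
  simp only [norm_mul, mul_comm I, norm_exp_ofReal_mul_I, one_mul, norm_I, mul_one, norm_pow,
    norm_real]
  have h1 : ∀ s : ℝ, ‖1 + (s : ℂ) * I‖ ^ 2 = 1 + s ^ 2 := fun s => by
    rw [sq_norm_eq]; simp
  rw [h1, Real.norm_eq_abs, mul_pow, mul_pow, sq_abs]
  ring

/-- Composition with an increasingly strong twist makes the distortion of an orientation-reversing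
linear map tend to `-∞`. -/
lemma tendsto_distortion_twist_comp {A : ℂ →L[ℝ] ℂ} (hA : jac A < 0) {ψ : ℝ → ℝ}
    (hψ : ContDiff ℝ ∞ ψ) {c w : ℂ} (hw : w ≠ c) (hd : deriv ψ (‖w - c‖ ^ 2) ≠ 0) :
    Filter.Tendsto (fun n : ℕ =>
      distortion ((fderiv ℝ (twist c fun t => n * ψ t) w).comp A)) Filter.atTop Filter.atBot := by
  obtain ⟨a, b, rfl⟩ := exists_wirt A
  rw [jac_wirt] at hA
  set d := deriv ψ (‖w - c‖ ^ 2) with hdd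
  have hζ : 0 < ‖w - c‖ := norm_pos_iff.2 (sub_ne_zero.2 hw)
  set κ : ℝ := |d| * ‖w - c‖ ^ 2 * (‖b‖ - ‖a‖) with hκ
  have hab : ‖a‖ < ‖b‖ := lt_of_pow_lt_pow_left₀ 2 (norm_nonneg _) (by linarith)
  have hκ0 : 0 < κ := mul_pos (mul_pos (abs_pos.2 hd) (by positivity)) (sub_pos.2 hab)
  -- The antilinear coefficient of the composed map grows at least like `nκ - ‖b‖`, where `κ > 0`
  -- because `‖a‖ < ‖b‖` for reversed orientation. The denominator stays fixed and negative.
  have hlow : ∀ n : ℕ, ‖b‖ ≤ n * κ → distortion ((fderiv ℝ (twist c fun t => n * ψ t) w).comp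
      (wirt a b)) ≤ (n * κ - ‖b‖) ^ 2 / (‖a‖ ^ 2 - ‖b‖ ^ 2) := by
    intro n hn
    have hψn : ContDiff ℝ ∞ fun t => (n : ℝ) * ψ t := contDiff_const.mul hψ
    have hder : HasDerivAt (fun t => (n : ℝ) * ψ t) (n * d) (‖w - c‖ ^ 2) :=
      ((hψ.differentiable (by simp)) _).hasDerivAt.const_mul _
    have hjac := jac_fderiv_twist c hψn w
    have hj : jac ((fderiv ℝ (twist c fun t => n * ψ t) w).comp (wirt a b)) =
        ‖a‖ ^ 2 - ‖b‖ ^ 2 := by rw [jac_comp, hjac, one_mul, jac_wirt]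
    rw [distortion_of_jac_ne_zero (by rw [hj]; exact hA.ne), hj,
      HasFDerivAt.fderiv (hasWirt_twist c hder), wirt_comp, linZ_wirt, linZbar_wirt]
    refine (div_le_div_right_of_neg hA).2 ?_
    refine le_trans ?_ (le_add_of_nonneg_left (sq_nonneg _))
    refine pow_le_pow_left₀ (sub_nonneg.2 hn) ?_ 2
    set e := cexp (I * ((n * ψ (‖w - c‖ ^ 2) : ℝ) : ℂ)) with he
    have hen : ‖e‖ = 1 := by rw [he, mul_comm I, norm_exp_ofReal_mul_I]
    have e1 : e * (1 + I * ((n * d * ‖w - c‖ ^ 2 : ℝ) : ℂ)) * b +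
        e * (I * (((n * d : ℝ) : ℂ) * (w - c) ^ 2)) * conj a =
        e * (b + (I * ((n * d * ‖w - c‖ ^ 2 : ℝ) : ℂ) * b +
          I * (((n * d : ℝ) : ℂ) * (w - c) ^ 2) * conj a)) := by ring
    rw [e1, norm_mul, hen, one_mul]
    have n1 : ‖I * ((n * d * ‖w - c‖ ^ 2 : ℝ) : ℂ) * b‖ = n * |d| * ‖w - c‖ ^ 2 * ‖b‖ := by
      simp
    have n2 : ‖I * (((n * d : ℝ) : ℂ) * (w - c) ^ 2) * conj a‖ =
        n * |d| * ‖w - c‖ ^ 2 * ‖a‖ := by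
      simp
    have t1 := norm_sub_norm_le (I * ((n * d * ‖w - c‖ ^ 2 : ℝ) : ℂ) * b)
      (-(I * (((n * d : ℝ) : ℂ) * (w - c) ^ 2) * conj a))
    rw [norm_neg, sub_neg_eq_add, n1, n2] at t1
    have t2 := norm_sub_norm_le (I * ((n * d * ‖w - c‖ ^ 2 : ℝ) : ℂ) * b +
      I * (((n * d : ℝ) : ℂ) * (w - c) ^ 2) * conj a) (-b)
    rw [norm_neg, sub_neg_eq_add, add_comm _ b] at t2
    have : (n : ℝ) * κ = n * |d| * ‖w - c‖ ^ 2 * ‖b‖ - n * |d| * ‖w - c‖ ^ 2 * ‖a‖ := by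
      rw [hκ]; ring
    linarith
  have hlin : Filter.Tendsto (fun n : ℕ => (n : ℝ) * κ) Filter.atTop Filter.atTop :=
    tendsto_natCast_atTop_atTop.atTop_mul_const hκ0
  have hlim : Filter.Tendsto (fun n : ℕ => (n * κ - ‖b‖) ^ 2 / (‖a‖ ^ 2 - ‖b‖ ^ 2))
      Filter.atTop Filter.atBot := by
    have h1 : Filter.Tendsto (fun n : ℕ => (n * κ - ‖b‖) ^ 2) Filter.atTop Filter.atTop :=
      (Filter.tendsto_pow_atTop two_ne_zero).comp
        (Filter.tendsto_atTop_add_const_right _ (-‖b‖) hlin)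
    exact h1.atTop_div_const_of_neg hA
  refine Filter.tendsto_atBot_mono' _ ?_ hlim
  filter_upwards [hlin.eventually_ge_atTop ‖b‖] with n hn
  exact hlow n hn

/-- A smooth function on the line which vanishes from `ρ²` on and is not locally constant before. -/
lemma exists_twist_profile {ρ : ℝ} (hρ : 0 < ρ) :
    ∃ ψ : ℝ → ℝ, ContDiff ℝ ∞ ψ ∧ (∀ t, ρ ^ 2 ≤ t → ψ t = 0) ∧
      ∃ t, 0 < t ∧ t < ρ ^ 2 ∧ deriv ψ t ≠ 0 := by
  have hρ2 : 0 < ρ ^ 2 := by positivity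
  set ψ : ℝ → ℝ := fun t => Real.smoothTransition (1 - t / ρ ^ 2) with hψ
  have hs : ContDiff ℝ ∞ ψ :=
    Real.smoothTransition.contDiff.comp (contDiff_const.sub (contDiff_id.div_const _))
  have h0 : ψ 0 = 1 := by simp [hψ]
  have h1 : ∀ t, ρ ^ 2 ≤ t → ψ t = 0 := fun t ht =>
    Real.smoothTransition.zero_of_nonpos (by rw [sub_nonpos, le_div_iff₀ hρ2]; linarith)
  refine ⟨ψ, hs, h1, ?_⟩
  -- The profile falls from 1 at `0` to 0 at `ρ²`, so by the mean value theorem its derivative is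
  -- nonzero somewhere between.
  obtain ⟨t, ht, hd⟩ := exists_deriv_eq_slope ψ hρ2 hs.continuous.continuousOn
    (hs.differentiable (by simp)).differentiableOn
  refine ⟨t, ht.1, ht.2, ?_⟩
  rw [hd, h0, h1 _ le_rfl]
  simp [hρ.ne']

lemma contDiffOn_energyDensity_parts {f : Disk ≃ₜ Disk} (hf : IsDiffeo f) :
    ContinuousOn (areaWeight (toPlane f.symm)) disk ∧
      ContDiffOn ℝ ∞ (fun w => fderiv ℝ (toPlane f) (toPlane f.symm w)) disk := by
  have hm : Set.MapsTo (toPlane f.symm) disk disk := fun w hw => toPlane_mem _ hw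
  constructor
  · exact (((contDiff_jac (n := 0)).continuous.comp_continuousOn
      (hf.2.continuousOn_fderiv_of_isOpen isOpen_disk (by simp))).abs).mul
      (contDiffOn_eta.continuousOn.comp hf.2.continuousOn hm)
  · exact (hf.1.fderiv_of_isOpen isOpen_disk (m := ∞) (by simp)).comp hf.2 hm

lemma areaWeight_pos {f : Disk ≃ₜ Disk} (hf : IsDiffeo f) {w : ℂ} (hw : w ∈ disk) :
    0 < areaWeight (toPlane f.symm) w :=
  mul_pos (abs_pos.2 (hf.symm.jac_ne_zero hw)) (eta_pos (toPlane_mem _ hw))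

lemma continuousOn_energyDensity {f : Disk ≃ₜ Disk} (hf : IsDiffeo f) (p : ℝ)
    {A : ℂ → ℂ →L[ℝ] ℂ} (hA : Continuous A) (hJ : ∀ w, jac (A w) ≠ 0) :
    ContinuousOn (fun w => energyDensity p (toPlane f) (toPlane f.symm) (A w) w) disk := by
  obtain ⟨h1, h2⟩ := contDiffOn_energyDensity_parts hf
  have h3 : ContinuousOn
      (fun w => (A w).comp (fderiv ℝ (toPlane f) (toPlane f.symm w))) disk :=
    hA.continuousOn.clm_comp h2.continuousOn
  have h4 : ContinuousOn (fun w =>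
      distortion ((A w).comp (fderiv ℝ (toPlane f) (toPlane f.symm w)))) disk := fun w hw =>
    (contDiffAt_distortion (n := 0) (by
      rw [jac_comp]
      exact mul_ne_zero (hJ w) (hf.jac_ne_zero (toPlane_mem _ hw)))).continuousAt
        |>.comp_continuousWithinAt (f := fun w =>
          (A w).comp (fderiv ℝ (toPlane f) (toPlane f.symm w))) (h3 w hw)
  exact h1.mul (Real.continuous_exp.comp_continuousOn (continuousOn_const.mul h4))

lemma jac_id_ne_zero : jac (ContinuousLinearMap.id ℝ ℂ) ≠ 0 := by rw [jac_id]; exact one_ne_zero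

lemma distortion_nonpos {A : ℂ →L[ℝ] ℂ} (hA : jac A < 0) : distortion A ≤ 0 := by
  rw [distortion_of_jac_ne_zero hA.ne]
  exact div_nonpos_of_nonneg_of_nonpos (by positivity) hA.le

/-- A smooth minimiser preserves the orientation. -/
theorem jac_pos_of_isMinimiser {p : ℝ} (hp : 0 < p) {Γ Γ' : Subgroup (Equiv.Perm Disk)}
    (hΓ : IsSurfaceGroup Γ) (hΓ' : IsSurfaceGroup Γ') {θ : Γ ≃* Γ'} {P : Set Disk}
    (hP : IsFundamentalDomain Γ P hypArea) {f : Disk ≃ₜ Disk} (hf : IsDiffeo f)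
    (hmin : IsMinimiser θ p P f) {z : ℂ} (hz : z ∈ disk) : 0 < jac (fderiv ℝ (toPlane f) z) := by
  by_contra hneg
  have hneg' : jac (fderiv ℝ (toPlane f) z) < 0 := lt_of_le_of_ne (not_lt.1 hneg) (hf.jac_ne_zero hz)
  have hjc : ContinuousOn (fun z => jac (fderiv ℝ (toPlane f) z)) disk :=
    (contDiff_jac (n := 0)).continuous.comp_continuousOn
      (hf.1.continuousOn_fderiv_of_isOpen isOpen_disk (by simp))
  have hall : ∀ x ∈ disk, jac (fderiv ℝ (toPlane f) x) < 0 := by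
    intro x hx
    by_contra hx'
    -- The Jacobian is continuous without zeros on the connected disk, so a negative value at one
    -- point makes it negative everywhere.
    obtain ⟨y, hy, hy0⟩ := (convex_ball (0 : ℂ) 1).isPreconnected.intermediate_value hz hx hjc
      ⟨hneg'.le, not_lt.1 hx'⟩
    exact hf.jac_ne_zero hy hy0
  have h0 : (0 : ℂ) ∈ disk := by simp
  obtain ⟨r, hr, hrd, hmain⟩ := exists_ball_local_minimality hΓ hΓ' hP hf hmin h0
  set B := Metric.ball (0 : ℂ) r
  have hBd : B ⊆ disk := Metric.ball_subset_closedBall.trans hrd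
  set M : ℂ → ℂ →L[ℝ] ℂ := fun w => fderiv ℝ (toPlane f) (toPlane f.symm w) with hM
  have hMJ : ∀ w ∈ disk, jac (M w) < 0 := fun w hw => hall _ (toPlane_mem _ hw)
  -- Radius `r/2` keeps the support of the twist in a compact subset of the open ball of radius `r`.
  obtain ⟨ψ, hψ, hψ0, t₀, ht0, ht1, htd⟩ := exists_twist_profile (half_pos hr)
  have hψn : ∀ n : ℕ, ContDiff ℝ ∞ fun t => (n : ℝ) * ψ t := fun n => contDiff_const.mul hψ
  set den : (ℂ →L[ℝ] ℂ) → ℂ → ℝ := energyDensity p (toPlane f) (toPlane f.symm) with hden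
  set o : ℂ → ℝ≥0∞ := fun w => ENNReal.ofReal (den (ContinuousLinearMap.id ℝ ℂ) w) with ho
  set T : Set ℂ := {w | w ≠ 0 ∧ deriv ψ (‖w‖ ^ 2) ≠ 0} with hT
  have hTo : IsOpen T := by
    refine isOpen_ne.inter (isOpen_ne.preimage (f := fun w : ℂ => deriv ψ (‖w‖ ^ 2)) ?_)
    exact (hψ.continuous_deriv (by simp)).comp (continuous_norm.pow 2)
  have hle : ∀ n : ℕ, ∫⁻ w in B, o w ≤
      ∫⁻ w in B, ENNReal.ofReal (den (fderiv ℝ (twist 0 fun t => n * ψ t) w) w) := by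
    intro n
    refine hmain (twistHomeo 0 (hψn n)) (contDiff_twist 0 (hψn n)) (fun w => ?_)
      (Metric.closedBall 0 (r / 2)) (Metric.closedBall_subset_ball (by linarith))
      (isCompact_closedBall _ _) fun w hw => ?_
    · have : jac (fderiv ℝ (twistHomeo 0 (hψn n)) w) = 1 := jac_fderiv_twist 0 (hψn n) w
      rw [this]; exact one_ne_zero
    · change twist 0 (fun t => (n : ℝ) * ψ t) w = w
      have hw' : r / 2 < ‖w‖ := by simpa using hw
      have : ψ (‖w - 0‖ ^ 2) = 0 := hψ0 _ (by
        rw [sub_zero]; exact pow_le_pow_left₀ (by linarith) hw'.le 2)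
      simp only [twist]
      rw [this]
      simp
  have hcont : ∀ n : ℕ, ContinuousOn
      (fun w => den (fderiv ℝ (twist 0 fun t => n * ψ t) w) w) disk := fun n =>
    continuousOn_energyDensity hf p ((contDiff_twist 0 (hψn n)).continuous_fderiv (by simp))
      fun w => by rw [jac_fderiv_twist 0 (hψn n)]; exact one_ne_zero
  have hcont0 : ContinuousOn (den (ContinuousLinearMap.id ℝ ℂ)) disk :=
    continuousOn_energyDensity hf p continuous_const fun _ => jac_id_ne_zero
  -- Reversed orientation gives `𝕂 ≤ 0`, hence `exp(p 𝕂) ≤ 1`: the area weight dominates all the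
  -- energy densities.
  have hbound : ∀ n : ℕ, ∀ w ∈ B, den (fderiv ℝ (twist 0 fun t => n * ψ t) w) w ≤
      areaWeight (toPlane f.symm) w := by
    intro n w hw
    refine mul_le_of_le_one_right (areaWeight_pos hf (hBd hw)).le (Real.exp_le_one_iff.2 ?_)
    refine mul_nonpos_of_nonneg_of_nonpos hp.le (distortion_nonpos ?_)
    rw [jac_comp, jac_fderiv_twist 0 (hψn n), one_mul]
    exact hMJ w (hBd hw)
  have hWint : ∫⁻ w in B, ENNReal.ofReal (areaWeight (toPlane f.symm) w) ≠ ⊤ := by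
    have h1 : IntegrableOn (areaWeight (toPlane f.symm)) B :=
      (((contDiffOn_energyDensity_parts hf).1.mono hrd).integrableOn_compact
        (isCompact_closedBall _ _)).mono_set Metric.ball_subset_closedBall
    exact h1.lintegral_lt_top.ne
  have hBm : MeasurableSet B := Metric.isOpen_ball.measurableSet
  have hlim : Filter.Tendsto (fun n : ℕ => ∫⁻ w in B,
      ENNReal.ofReal (den (fderiv ℝ (twist 0 fun t => n * ψ t) w) w)) Filter.atTop
      (nhds (∫⁻ w in B, Tᶜ.indicator o w)) := by
    refine tendsto_lintegral_of_dominated_convergence' _ (fun n =>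
      (((hcont n).mono hBd).aemeasurable hBm).ennreal_ofReal) (fun n => ?_) hWint ?_
    · filter_upwards [ae_restrict_mem hBm] with w hw
      exact ENNReal.ofReal_le_ofReal (hbound n w hw)
    · filter_upwards [ae_restrict_mem hBm] with w hw
      -- On `T` the twist shears ever more strongly and the density tends to 0. Off `T` its
      -- differential is a rotation for every `n`, so the density never changes.
      by_cases hwT : w ∈ T
      · rw [Set.indicator_of_notMem (Set.notMem_compl_iff.2 hwT)]
        have h1 := tendsto_distortion_twist_comp (hMJ w (hBd hw)) hψ (c := 0) hwT.1
          (by rw [sub_zero]; exact hwT.2)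
        have h2 := (Real.tendsto_exp_atBot.comp (h1.const_mul_atBot hp)).const_mul
          (areaWeight (toPlane f.symm) w)
        rw [mul_zero] at h2
        have h3 := ENNReal.tendsto_ofReal h2
        rw [ENNReal.ofReal_zero] at h3
        exact h3
      · rw [Set.indicator_of_mem (show w ∈ Tᶜ from hwT)]
        refine tendsto_const_nhds.congr fun n => ?_
        have hder : HasDerivAt (fun t => (n : ℝ) * ψ t) (n * deriv ψ (‖w - 0‖ ^ 2)) (‖w - 0‖ ^ 2) :=
          ((hψ.differentiable (by simp)) _).hasDerivAt.const_mul _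
        have hcase : w = 0 ∨ deriv ψ (‖w‖ ^ 2) = 0 := by
          by_contra h; push Not at h; exact hwT h
        have hfd := HasFDerivAt.fderiv (hasWirt_twist 0 hder)
        have hb : I * (((n * deriv ψ (‖w - 0‖ ^ 2) : ℝ) : ℂ) * (w - 0) ^ 2) = 0 := by
          rcases hcase with h | h <;> simp [h]
        have ha : I * ((n * deriv ψ (‖w - 0‖ ^ 2) * ‖w - 0‖ ^ 2 : ℝ) : ℂ) = 0 := by
          rcases hcase with h | h <;> simp [h]
        rw [ha, hb, add_zero, mul_one, mul_zero] at hfd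
        simp only [ho, hden, energyDensity]
        rw [hfd, distortion_conformal_comp (Complex.exp_ne_zero _), ContinuousLinearMap.id_comp]
  have hfinal : ∫⁻ w in B, o w ≤ ∫⁻ w in B, Tᶜ.indicator o w :=
    ge_of_tendsto' hlim hle
  have hom : AEMeasurable o (volume.restrict B) :=
    ((hcont0.mono hBd).aemeasurable hBm).ennreal_ofReal
  have hofin : ∫⁻ w in B, o w ≠ ⊤ := by
    have h1 : IntegrableOn (den (ContinuousLinearMap.id ℝ ℂ)) B :=
      ((hcont0.mono hrd).integrableOn_compact
        (isCompact_closedBall _ _)).mono_set Metric.ball_subset_closedBall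
    exact h1.lintegral_lt_top.ne
  -- The indicator is at most `o` but its integral is at least as large and finite, so the two agree
  -- almost everywhere. Since `o > 0` on the ball, `T` must be null there.
  have hae : Tᶜ.indicator o =ᵐ[volume.restrict B] o := by
    refine ae_eq_of_ae_le_of_lintegral_le
      (Filter.Eventually.of_forall fun w => Set.indicator_le_self _ _ w) ?_ hom hfinal
    exact ne_top_of_le_ne_top hofin (lintegral_mono fun w => Set.indicator_le_self _ _ w)
  rw [Filter.EventuallyEq, ae_restrict_iff' hBm] at hae
  have hnull : volume (T ∩ B) = 0 := by
    refine measure_mono_null (fun w hw => ?_) hae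
    simp only [Set.mem_compl_iff, Set.mem_ofPred_eq, Classical.not_imp]
    refine ⟨hw.2, ?_⟩
    rw [Set.indicator_of_notMem (Set.notMem_compl_iff.2 hw.1)]
    refine (ENNReal.ofReal_pos.2 ?_).ne
    exact mul_pos (areaWeight_pos hf (hBd hw.2)) (Real.exp_pos _)
  -- Yet `T` is open and contains the point `√t₀` of the ball, so it has positive measure there.
  refine ((hTo.inter Metric.isOpen_ball).measure_pos volume ⟨(Real.sqrt t₀ : ℂ), ?_, ?_⟩).ne' hnull
  · have hs := Real.sqrt_pos.2 ht0
    refine ⟨by exact_mod_cast hs.ne', ?_⟩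
    rw [norm_real, Real.norm_eq_abs, sq_abs, Real.sq_sqrt ht0.le]
    exact htd
  · rw [mem_ball_zero_iff, norm_real, Real.norm_eq_abs, abs_of_nonneg (Real.sqrt_nonneg _)]
    have : Real.sqrt t₀ < r / 2 := (Real.sqrt_lt' (half_pos hr)).2 ht1
    linarith

section

/-! ### The first variation -/

lemma norm_linZ_le (A : ℂ →L[ℝ] ℂ) : ‖linZ A‖ ≤ ‖A‖ := by
  have h1 := A.le_opNorm 1
  have h2 := A.le_opNorm I
  have h3 := norm_sub_le (A 1) (I * A I)
  rw [linZ, norm_div]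
  simp only [norm_one, norm_I, mul_one, norm_mul, one_mul] at h1 h2 h3
  norm_num
  linarith

lemma norm_linZbar_le (A : ℂ →L[ℝ] ℂ) : ‖linZbar A‖ ≤ ‖A‖ := by
  have h1 := A.le_opNorm 1
  have h2 := A.le_opNorm I
  have h3 := norm_add_le (A 1) (I * A I)
  rw [linZbar, norm_div]
  simp only [norm_one, norm_I, mul_one, norm_mul, one_mul] at h1 h2 h3
  norm_num
  linarith

/-- Small multiples of a test field perturb the identity to diffeomorphisms of the plane. -/
lemma exists_homeo_id_add {φ : ℂ → ℂ} (hφ : ContDiff ℝ ∞ φ) (hc : HasCompactSupport φ) :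
    ∃ δ > 0, ∀ t : ℝ, |t| ≤ δ → (∃ G : ℂ ≃ₜ ℂ, ∀ w, G w = w + t * φ w) ∧
      ∀ w, 0 < jac (wirt (1 + t * dz φ w) (t * dzbar φ w)) := by
  obtain ⟨C, hC⟩ := hφ.lipschitzWith_of_hasCompactSupport hc (by simp)
  have hC0 : (0 : ℝ) < C + 1 := by positivity
  -- This gives `|t| C ≤ 1/3`: the perturbation is a contraction, and `|1 + t φ_z| ≥ 2/3` exceeds
  -- `|t φ_z̄| ≤ 1/3`. The `+ 1` covers `C = 0`.
  refine ⟨1 / (3 * (C + 1)), by positivity, fun t ht => ?_⟩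
  have htC : |t| * C ≤ 1 / 3 := by
    have h1 : |t| * (C + 1) ≤ 1 / 3 := by
      calc |t| * (C + 1) ≤ 1 / (3 * (C + 1)) * (C + 1) := by gcongr
        _ = 1 / 3 := by field_simp
    nlinarith [abs_nonneg t]
  constructor
  · have happ : ApproximatesLinearOn (fun w : ℂ => w + t * φ w)
        ((ContinuousLinearEquiv.refl ℝ ℂ : ℂ ≃L[ℝ] ℂ) : ℂ →L[ℝ] ℂ) Set.univ (‖t‖₊ * C) := by
      intro x _ y _
      have e : x + t * φ x - (y + t * φ y) -
          ((ContinuousLinearEquiv.refl ℝ ℂ : ℂ ≃L[ℝ] ℂ) : ℂ →L[ℝ] ℂ) (x - y) =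
          t * (φ x - φ y) := by
        simp only [ContinuousLinearEquiv.coe_refl, ContinuousLinearMap.id_apply]; ring
      rw [e, norm_mul, norm_real, NNReal.coe_mul, coe_nnnorm, mul_assoc]
      gcongr
      exact hC.norm_sub_le x y
    have hlt : ‖t‖₊ * C < ‖((ContinuousLinearEquiv.refl ℝ ℂ : ℂ ≃L[ℝ] ℂ).symm : ℂ →L[ℝ] ℂ)‖₊⁻¹ := by
      have : ((ContinuousLinearEquiv.refl ℝ ℂ : ℂ ≃L[ℝ] ℂ).symm : ℂ →L[ℝ] ℂ) =
        ContinuousLinearMap.id ℝ ℂ := rfl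
      rw [this, ContinuousLinearMap.nnnorm_id, inv_one, ← NNReal.coe_lt_coe]
      push_cast
      rw [Real.norm_eq_abs]
      linarith
    exact ⟨happ.toHomeomorph _ (Or.inr hlt), fun w => rfl⟩
  · intro w
    have hn : ‖fderiv ℝ φ w‖ ≤ C := norm_fderiv_le_of_lipschitz ℝ hC
    have ha : ‖(t : ℂ) * dz φ w‖ ≤ 1 / 3 := by
      rw [norm_mul, norm_real, Real.norm_eq_abs]
      exact (mul_le_mul_of_nonneg_left ((norm_linZ_le _).trans hn) (abs_nonneg t)).trans htC
    have hb : ‖(t : ℂ) * dzbar φ w‖ ≤ 1 / 3 := by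
      rw [norm_mul, norm_real, Real.norm_eq_abs]
      exact (mul_le_mul_of_nonneg_left ((norm_linZbar_le _).trans hn) (abs_nonneg t)).trans htC
    have h1 := norm_sub_norm_le (1 : ℂ) (-((t : ℂ) * dz φ w))
    rw [norm_neg, sub_neg_eq_add, norm_one] at h1
    rw [jac_wirt]
    nlinarith [norm_nonneg ((t : ℂ) * dzbar φ w)]

lemma jac_wirt_one_add (a b : ℂ) (t : ℝ) : jac (wirt (1 + t * a) (t * b)) =
    1 + 2 * a.re * t + (‖a‖ ^ 2 - ‖b‖ ^ 2) * t ^ 2 := by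
  rw [jac_wirt]
  simp only [sq_norm_eq, add_re, add_im, mul_re, mul_im, ofReal_re, ofReal_im, one_re, one_im]
  ring

/-- Exhibits the distortion along the variation as a quotient of quadratics in `t`, the form in
which `integral_eq_zero_of_forall_le` differentiates it. Only the coefficients up to order one
survive at `t = 0`. -/
lemma distortion_wirt_one_add_comp {a b u v : ℂ} {t : ℝ}
    (h1 : 1 + 2 * a.re * t + (‖a‖ ^ 2 - ‖b‖ ^ 2) * t ^ 2 ≠ 0) (h2 : ‖u‖ ^ 2 - ‖v‖ ^ 2 ≠ 0) :
    distortion ((wirt (1 + t * a) (t * b)).comp (wirt u v)) =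
      (‖u‖ ^ 2 + ‖v‖ ^ 2 + (2 * a.re * (‖u‖ ^ 2 + ‖v‖ ^ 2) + 4 * (b * conj (u * v)).re) * t +
        (‖a * u + b * conj v‖ ^ 2 + ‖a * v + b * conj u‖ ^ 2) * t ^ 2) /
      ((1 + 2 * a.re * t + (‖a‖ ^ 2 - ‖b‖ ^ 2) * t ^ 2) * (‖u‖ ^ 2 - ‖v‖ ^ 2)) := by
  have hj : jac ((wirt (1 + t * a) (t * b)).comp (wirt u v)) =
      (1 + 2 * a.re * t + (‖a‖ ^ 2 - ‖b‖ ^ 2) * t ^ 2) * (‖u‖ ^ 2 - ‖v‖ ^ 2) := by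
    rw [jac_comp, jac_wirt_one_add, jac_wirt]
  rw [distortion_of_jac_ne_zero (by rw [hj]; exact mul_ne_zero h1 h2), hj, wirt_comp, linZ_wirt,
    linZbar_wirt]
  congr 1
  simp only [sq_norm_eq, add_re, add_im, mul_re, mul_im, ofReal_re, ofReal_im, one_re, one_im,
    conj_re, conj_im]
  ring

/-- Differentiation under the integral sign over a compact set. -/
lemma hasDerivAt_integral_of_continuousOn {K : Set ℂ} (hK : IsCompact K) {δ : ℝ} (hδ : 0 < δ)
    {Φ Φ' : ℝ → ℂ → ℝ}
    (hΦ : ContinuousOn (Function.uncurry Φ) (Set.Icc (-δ) δ ×ˢ K))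
    (hΦ' : ContinuousOn (Function.uncurry Φ') (Set.Icc (-δ) δ ×ˢ K))
    (hd : ∀ t ∈ Set.Icc (-δ) δ, ∀ w ∈ K, HasDerivAt (fun t => Φ t w) (Φ' t w) t) :
    HasDerivAt (fun t => ∫ w in K, Φ t w) (∫ w in K, Φ' 0 w) 0 := by
  have hslice : ∀ {Ψ : ℝ → ℂ → ℝ}, ContinuousOn (Function.uncurry Ψ) (Set.Icc (-δ) δ ×ˢ K) →
      ∀ t ∈ Set.Icc (-δ) δ, ContinuousOn (Ψ t) K := fun hΨ t ht =>
    hΨ.comp (f := fun w => (t, w)) (Continuous.continuousOn (by fun_prop)) fun w hw => ⟨ht, hw⟩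
  obtain ⟨C, hC⟩ := (isCompact_Icc.prod hK).exists_bound_of_continuousOn hΦ'
  have h0 : (0 : ℝ) ∈ Set.Icc (-δ) δ := ⟨by linarith, hδ.le⟩
  have hs : Set.Icc (-δ) δ ∈ nhds (0 : ℝ) := Icc_mem_nhds (by linarith) hδ
  refine (hasDerivAt_integral_of_dominated_loc_of_deriv_le (μ := volume.restrict K) hs ?_ ?_ ?_
    (bound := fun _ => C) ?_ ?_ ?_).2
  · filter_upwards [hs] with t ht
    exact (hslice hΦ t ht).aestronglyMeasurable hK.measurableSet
  · exact (hslice hΦ 0 h0).integrableOn_compact hK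
  · exact (hslice hΦ' 0 h0).aestronglyMeasurable hK.measurableSet
  · filter_upwards [ae_restrict_mem hK.measurableSet] with w hw t ht
    exact hC (t, w) ⟨ht, hw⟩
  · exact integrableOn_const hK.measure_lt_top.ne
  · filter_upwards [ae_restrict_mem hK.measurableSet] with w hw t ht
    exact hd t ht w hw

/-- The first variation of `∫ W exp(p N/j)` for quadratic polynomials `N`, `j` in the parameter, when
it is minimal at `0`. -/
lemma integral_eq_zero_of_forall_le {K : Set ℂ} (hK : IsCompact K) {δ : ℝ} (hδ : 0 < δ) (p : ℝ)
    {W n₀ n₁ n₂ j₁ j₂ : ℂ → ℝ} (hW : ContinuousOn W K) (h0 : ContinuousOn n₀ K)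
    (h1 : ContinuousOn n₁ K) (h2 : ContinuousOn n₂ K) (hj1 : ContinuousOn j₁ K)
    (hj2 : ContinuousOn j₂ K)
    (hj : ∀ t ∈ Set.Icc (-δ) δ, ∀ w ∈ K, 1 + j₁ w * t + j₂ w * t ^ 2 ≠ 0)
    (hmin : ∀ t ∈ Set.Icc (-δ) δ,
      ∫ w in K, W w * Real.exp (p * n₀ w) ≤ ∫ w in K, W w * Real.exp (p *
        ((n₀ w + n₁ w * t + n₂ w * t ^ 2) / (1 + j₁ w * t + j₂ w * t ^ 2)))) :
    ∫ w in K, W w * (Real.exp (p * n₀ w) * (p * (n₁ w - n₀ w * j₁ w))) = 0 := by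
  set N : ℝ → ℂ → ℝ := fun t w => n₀ w + n₁ w * t + n₂ w * t ^ 2 with hN
  set j : ℝ → ℂ → ℝ := fun t w => 1 + j₁ w * t + j₂ w * t ^ 2 with hjd
  set S := Set.Icc (-δ) δ ×ˢ K
  have cw : ∀ {k : ℂ → ℝ}, ContinuousOn k K → ContinuousOn (fun x : ℝ × ℂ => k x.2) S := fun hk =>
    hk.comp continuousOn_snd fun x hx => hx.2
  have ct : ContinuousOn (fun x : ℝ × ℂ => x.1) S := continuousOn_fst
  have cN : ContinuousOn (fun x : ℝ × ℂ => N x.1 x.2) S :=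
    ((cw h0).add ((cw h1).mul ct)).add ((cw h2).mul (ct.pow 2))
  have cj : ContinuousOn (fun x : ℝ × ℂ => j x.1 x.2) S :=
    (continuousOn_const.add ((cw hj1).mul ct)).add ((cw hj2).mul (ct.pow 2))
  have hj0 : ∀ x ∈ S, j x.1 x.2 ≠ 0 := fun x hx => hj x.1 hx.1 x.2 hx.2
  have cE : ContinuousOn (fun x : ℝ × ℂ => Real.exp (p * (N x.1 x.2 / j x.1 x.2))) S :=
    Real.continuous_exp.comp_continuousOn (continuousOn_const.mul (cN.div cj hj0))
  have c2 : ContinuousOn (fun x : ℝ × ℂ => 2 * x.1) S := continuousOn_const.mul ct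
  have cQ : ContinuousOn (fun x : ℝ × ℂ => p * (((n₁ x.2 + n₂ x.2 * (2 * x.1)) * j x.1 x.2 -
      N x.1 x.2 * (j₁ x.2 + j₂ x.2 * (2 * x.1))) / j x.1 x.2 ^ 2)) S :=
    continuousOn_const.mul (((((cw h1).add ((cw h2).mul c2)).mul cj).sub
      (cN.mul ((cw hj1).add ((cw hj2).mul c2)))).div (cj.pow 2) fun x hx => pow_ne_zero 2 (hj0 x hx))
  have cP : ContinuousOn (fun x : ℝ × ℂ => W x.2 * (Real.exp (p * (N x.1 x.2 / j x.1 x.2)) *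
      (p * (((n₁ x.2 + n₂ x.2 * (2 * x.1)) * j x.1 x.2 -
        N x.1 x.2 * (j₁ x.2 + j₂ x.2 * (2 * x.1))) / j x.1 x.2 ^ 2)))) S :=
    (cw hW).mul (cE.mul cQ)
  have key := hasDerivAt_integral_of_continuousOn hK hδ
    (Φ := fun t w => W w * Real.exp (p * (N t w / j t w)))
    (Φ' := fun t w => W w * (Real.exp (p * (N t w / j t w)) * (p *
      (((n₁ w + n₂ w * (2 * t)) * j t w - N t w * (j₁ w + j₂ w * (2 * t))) / j t w ^ 2))))
    ((cw hW).mul cE) cP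
    (by
      intro t ht w hw
      have hq : ∀ a b c : ℝ, HasDerivAt (fun t : ℝ => a + b * t + c * t ^ 2) (b + c * (2 * t)) t := by
        intro a b c
        have := (((hasDerivAt_id t).const_mul b).const_add a).add
          (((hasDerivAt_id t).pow 2).const_mul c)
        refine this.congr_deriv ?_
        simp
      exact ((((hq _ _ _).div (hq _ _ _) (hj t ht w hw)).const_mul p).exp).const_mul (W w))
  have hloc : IsLocalMin (fun t => ∫ w in K, W w * Real.exp (p * (N t w / j t w))) 0 := by
    filter_upwards [Icc_mem_nhds (neg_lt_zero.2 hδ) hδ] with t ht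
    have := hmin t ht
    simpa [hN, hjd] using this
  have := hloc.hasDerivAt_eq_zero key
  simpa [hN, hjd] using this

lemma fderiv_id_add_mul {φ : ℂ → ℂ} {w : ℂ} (hφ : DifferentiableAt ℝ φ w) (t : ℝ) :
    fderiv ℝ (fun w => w + t * φ w) w = wirt (1 + t * dz φ w) (t * dzbar φ w) := by
  have h : HasFDerivAt (fun w => w + t * φ w) (ContinuousLinearMap.id ℝ ℂ + (t : ℂ) • fderiv ℝ φ w)
      w := (hasFDerivAt_id w).add (hφ.hasFDerivAt.const_mul (t : ℂ))
  rw [h.fderiv, fderiv_eq_wirt]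
  ext v
  simp
  ring

/-! ### The inverse map and the variation formula for the Ahlfors–Hopf differential -/

variable {f : Disk ≃ₜ Disk}

lemma IsDiffeo.dz_symm (hf : IsDiffeo f) {w : ℂ} (hw : w ∈ disk) :
    dz (toPlane f.symm) w = conj (dz (toPlane f) (toPlane f.symm w)) /
      jac (fderiv ℝ (toPlane f) (toPlane f.symm w)) :=
  (lin_of_comp_eq_id (hf.fderiv_comp_fderiv_symm hw)).1

lemma IsDiffeo.dzbar_symm (hf : IsDiffeo f) {w : ℂ} (hw : w ∈ disk) :
    dzbar (toPlane f.symm) w = -dzbar (toPlane f) (toPlane f.symm w) /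
      jac (fderiv ℝ (toPlane f) (toPlane f.symm w)) :=
  (lin_of_comp_eq_id (hf.fderiv_comp_fderiv_symm hw)).2

lemma IsDiffeo.distortion_symm (hf : IsDiffeo f) {w : ℂ} (hw : w ∈ disk) :
    distortion (fderiv ℝ (toPlane f.symm) w) =
      distortion (fderiv ℝ (toPlane f) (toPlane f.symm w)) :=
  distortion_of_comp_eq_id (hf.fderiv_comp_fderiv_symm hw)

lemma IsDiffeo.jac_symm (hf : IsDiffeo f) {w : ℂ} (hw : w ∈ disk) :
    jac (fderiv ℝ (toPlane f.symm) w) =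
      (jac (fderiv ℝ (toPlane f) (toPlane f.symm w)))⁻¹ := by
  have h := congrArg jac (hf.fderiv_comp_fderiv_symm hw)
  rw [jac_comp, jac_id] at h
  exact eq_inv_of_mul_eq_one_right h

lemma contDiffOn_ahlforsHopf (hf : IsDiffeo f) (p : ℝ) :
    ContDiffOn ℝ ∞ (ahlforsHopf p (toPlane f.symm)) disk := by
  have h1 := contDiffOn_distortion_fderiv isOpen_disk hf.2 fun z hz => hf.symm.jac_ne_zero hz
  have h2 : ContDiffOn ℝ ∞ (fun w => ((Real.exp (p * distortion (fderiv ℝ (toPlane f.symm) w)) : ℝ)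
      : ℂ)) disk :=
    ofRealCLM.contDiff.comp_contDiffOn (Real.contDiff_exp.comp_contDiffOn (contDiffOn_const.mul h1))
  have h3 : ContDiffOn ℝ ∞ (fun w => conj (dzbar (toPlane f.symm) w)) disk :=
    (conjCLE : ℂ →L[ℝ] ℂ).contDiff.comp_contDiffOn (contDiffOn_dzbar isOpen_disk hf.2)
  have h4 : ContDiffOn ℝ ∞ (fun w => ((eta (toPlane f.symm w) : ℝ) : ℂ)) disk :=
    ofRealCLM.contDiff.comp_contDiffOn
      (contDiffOn_eta.comp hf.2 fun w hw => toPlane_mem _ hw)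
  exact ((h2.mul (contDiffOn_dz isOpen_disk hf.2)).mul h3).mul h4

/-- The first variation of the energy in the direction of a test field. -/
lemma integral_re_dzbar_mul_ahlforsHopf {p : ℝ} (hp : 0 < p) (hf : IsDiffeo f)
    (hpos : ∀ z ∈ disk, 0 < jac (fderiv ℝ (toPlane f) z)) {w₀ : ℂ} {r : ℝ}
    (hrd : Metric.closedBall w₀ r ⊆ disk)
    (hmain : ∀ G : ℂ ≃ₜ ℂ, ContDiff ℝ ∞ G →
      (∀ w, jac (fderiv ℝ G w) ≠ 0) → ∀ K ⊆ Metric.ball w₀ r, IsCompact K →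
      (∀ w, w ∉ K → G w = w) →
      ∫⁻ w in Metric.ball w₀ r, ENNReal.ofReal
          (energyDensity p (toPlane f) (toPlane f.symm) (ContinuousLinearMap.id ℝ ℂ) w) ≤
        ∫⁻ w in Metric.ball w₀ r, ENNReal.ofReal
          (energyDensity p (toPlane f) (toPlane f.symm) (fderiv ℝ G w) w))
    {φ : ℂ → ℂ} (hφ : ContDiff ℝ ∞ φ) (hc : HasCompactSupport φ)
    (hs : tsupport φ ⊆ Metric.ball w₀ r) :
    ∫ w in Metric.closedBall w₀ r, (dzbar φ w * ahlforsHopf p (toPlane f.symm) w).re = 0 := by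
  obtain ⟨δ, hδ, hδG⟩ := exists_homeo_id_add hφ hc
  set K := Metric.closedBall w₀ r with hKdef
  have hK : IsCompact K := isCompact_closedBall _ _
  set h := toPlane f.symm with hh
  set M : ℂ → ℂ →L[ℝ] ℂ := fun w => fderiv ℝ (toPlane f) (h w) with hM
  set u : ℂ → ℂ := fun w => linZ (M w)
  set v : ℂ → ℂ := fun w => linZbar (M w)
  set a : ℂ → ℂ := dz φ
  set b : ℂ → ℂ := dzbar φ
  set J : ℂ → ℝ := fun w => ‖u w‖ ^ 2 - ‖v w‖ ^ 2 with hJ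
  have hJjac : ∀ w, jac (M w) = J w := fun w => rfl
  have hMuv : ∀ w, M w = wirt (u w) (v w) := fun w => (wirt_lin _).symm
  have hJpos : ∀ w ∈ disk, 0 < J w := fun w hw => hpos _ (toPlane_mem _ hw)
  obtain ⟨hWc, hMc⟩ := contDiffOn_energyDensity_parts hf
  have hWc' := hWc.mono hrd
  have hMc' : ContinuousOn M K := hMc.continuousOn.mono hrd
  have hu : ContinuousOn u K := (contDiff_linZ (n := 0)).continuous.comp_continuousOn hMc'
  have hv : ContinuousOn v K := (contDiff_linZbar (n := 0)).continuous.comp_continuousOn hMc'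
  have hφ' : Continuous (fderiv ℝ φ) := hφ.continuous_fderiv (by simp)
  have ha : Continuous a := (contDiff_linZ (n := 0)).continuous.comp hφ'
  have hb : Continuous b := (contDiff_linZbar (n := 0)).continuous.comp hφ'
  have hJc : ContinuousOn J K := (hu.norm.pow 2).sub (hv.norm.pow 2)
  have hJ0 : ∀ w ∈ K, J w ≠ 0 := fun w hw => (hJpos w (hrd hw)).ne'
  set j₁ : ℂ → ℝ := fun w => 2 * (a w).re with hj1
  set j₂ : ℂ → ℝ := fun w => ‖a w‖ ^ 2 - ‖b w‖ ^ 2 with hj2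
  set n₀ : ℂ → ℝ := fun w => (‖u w‖ ^ 2 + ‖v w‖ ^ 2) / J w with hn0
  set n₁ : ℂ → ℝ := fun w =>
    (2 * (a w).re * (‖u w‖ ^ 2 + ‖v w‖ ^ 2) + 4 * (b w * conj (u w * v w)).re) / J w with hn1
  set n₂ : ℂ → ℝ := fun w =>
    (‖a w * u w + b w * conj (v w)‖ ^ 2 + ‖a w * v w + b w * conj (u w)‖ ^ 2) / J w with hn2
  have hare : ContinuousOn (fun w => (a w).re) K := (continuous_re.comp ha).continuousOn
  have hcu : ContinuousOn (fun w => conj (u w)) K := continuous_conj.comp_continuousOn hu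
  have hcv : ContinuousOn (fun w => conj (v w)) K := continuous_conj.comp_continuousOn hv
  have hjt : ∀ t ∈ Set.Icc (-δ) δ, ∀ w, 1 + j₁ w * t + j₂ w * t ^ 2 ≠ 0 := by
    intro t ht w
    have := (hδG t (abs_le.2 ht)).2 w
    rw [jac_wirt_one_add] at this
    exact this.ne'
  have hdist : ∀ t ∈ Set.Icc (-δ) δ, ∀ w ∈ K,
      energyDensity p (toPlane f) h (wirt (1 + t * a w) (t * b w)) w =
        areaWeight h w * Real.exp (p * ((n₀ w + n₁ w * t + n₂ w * t ^ 2) /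
          (1 + j₁ w * t + j₂ w * t ^ 2))) := by
    intro t ht w hw
    have e : fderiv ℝ (toPlane f) (h w) = wirt (u w) (v w) := hMuv w
    rw [energyDensity, e, distortion_wirt_one_add_comp (hjt t ht w) (hJ0 w hw)]
    congr 3
    have h1 := hJ0 w hw
    have h2 := hjt t ht w
    simp only [hn0, hn1, hn2]
    simp only [hj1, hj2] at h2 ⊢
    change _ / (_ * J w) = _
    field_simp
  have hid : ∀ w ∈ K, energyDensity p (toPlane f) h (ContinuousLinearMap.id ℝ ℂ) w =
      areaWeight h w * Real.exp (p * n₀ w) := by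
    intro w hw
    have e : fderiv ℝ (toPlane f) (h w) = wirt (u w) (v w) := hMuv w
    rw [energyDensity, ContinuousLinearMap.id_comp, e, distortion_wirt (hJ0 w hw)]
  -- The sphere is null, so integrals may be taken over the closed ball, where compactness gives
  -- integrability and differentiation under the integral.
  have hBK : Metric.ball w₀ r =ᵐ[volume] K := by
    exact ae_eq_of_subset_of_measure_ge Metric.ball_subset_closedBall
      (Measure.addHaar_closedBall_eq_addHaar_ball _ _ _).le
      Metric.isOpen_ball.measurableSet.nullMeasurableSet measure_closedBall_lt_top.ne
  have hmin : ∀ t ∈ Set.Icc (-δ) δ,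
      ∫ w in K, areaWeight h w * Real.exp (p * n₀ w) ≤ ∫ w in K, areaWeight h w * Real.exp (p *
        ((n₀ w + n₁ w * t + n₂ w * t ^ 2) / (1 + j₁ w * t + j₂ w * t ^ 2))) := by
    intro t ht
    obtain ⟨⟨G, hG⟩, hGJ⟩ := hδG t (abs_le.2 ht)
    have hGe : (G : ℂ → ℂ) = fun w => w + t * φ w := funext hG
    have hGd : ∀ w, fderiv ℝ G w = wirt (1 + t * a w) (t * b w) := fun w => by
      rw [hGe]; exact fderiv_id_add_mul (hφ.differentiable (by simp) w) t
    have hle := hmain G (by rw [hGe]; exact contDiff_id.add (contDiff_const.mul hφ))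
      (fun w => by rw [hGd]; exact (hGJ w).ne') (tsupport φ) hs hc
      (fun w hw => by rw [hG, image_eq_zero_of_notMem_tsupport hw]; simp)
    have hcon1 : ContinuousOn (fun w => energyDensity p (toPlane f) h (fderiv ℝ G w) w) K :=
      (continuousOn_energyDensity hf p (by
        rw [hGe]
        exact (contDiff_id.add (contDiff_const.mul hφ)).continuous_fderiv (n := ∞) (by simp))
        fun w => by rw [hGd]; exact (hGJ w).ne').mono hrd
    have hcon0 : ContinuousOn (energyDensity p (toPlane f) h (ContinuousLinearMap.id ℝ ℂ)) K :=
      (continuousOn_energyDensity hf p continuous_const fun _ => jac_id_ne_zero).mono hrd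
    have hnn : ∀ A : ℂ → ℂ →L[ℝ] ℂ, ∀ᵐ w ∂(volume.restrict K), 0 ≤ energyDensity p (toPlane f) h (A w) w := by
      intro A
      filter_upwards [ae_restrict_mem hK.measurableSet] with w hw
      exact mul_nonneg (areaWeight_pos hf (hrd hw)).le (Real.exp_pos _).le
    rw [Measure.restrict_congr_set hBK,
      ← ofReal_integral_eq_lintegral_ofReal (hcon0.integrableOn_compact hK)
        (hnn fun _ => ContinuousLinearMap.id ℝ ℂ),
      ← ofReal_integral_eq_lintegral_ofReal (hcon1.integrableOn_compact hK) (hnn _),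
      ENNReal.ofReal_le_ofReal_iff (integral_nonneg_of_ae (hnn _)),
      setIntegral_congr_fun hK.measurableSet hid] at hle
    refine hle.trans_eq (setIntegral_congr_fun hK.measurableSet fun w hw => ?_)
    rw [hGd]
    exact hdist t ht w hw
  have hzero := integral_eq_zero_of_forall_le hK hδ p (W := areaWeight h) (n₀ := n₀) (n₁ := n₁)
    (n₂ := n₂) (j₁ := j₁) (j₂ := j₂) hWc'
    (((hu.norm.pow 2).add (hv.norm.pow 2)).div hJc hJ0)
    ((((continuousOn_const.mul hare).mul ((hu.norm.pow 2).add (hv.norm.pow 2))).add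
      (continuousOn_const.mul (continuous_re.comp_continuousOn
        (hb.continuousOn.mul (continuous_conj.comp_continuousOn (hu.mul hv)))))).div hJc hJ0)
    (((((ha.continuousOn.mul hu).add (hb.continuousOn.mul hcv)).norm.pow 2).add
      (((ha.continuousOn.mul hv).add (hb.continuousOn.mul hcu)).norm.pow 2)).div hJc hJ0)
    (continuousOn_const.mul hare) ((ha.norm.pow 2).sub (hb.norm.pow 2)).continuousOn
    (fun t ht w _ => hjt t ht w) hmin
  -- The terms with `Re φ_w` cancel in `n₁ - n₀ j₁`, leaving `4 Re(φ_w̄ conj(uv)) / J`. In the same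
  -- notation `Φ = -exp(p 𝕂) η conj(uv) / J²`, whence the factor `-4p`.
  have hpt : ∀ w ∈ K, areaWeight h w * (Real.exp (p * n₀ w) * (p * (n₁ w - n₀ w * j₁ w))) =
      (-4 * p) * (b w * ahlforsHopf p h w).re := by
    intro w hw
    have hwd := hrd hw
    have hJw := hJ0 w hw
    have e1 : dz h w = conj (u w) / (J w : ℝ) := hf.dz_symm hwd
    have e2 : dzbar h w = -v w / (J w : ℝ) := hf.dzbar_symm hwd
    have e3 : distortion (fderiv ℝ h w) = n₀ w := by
      rw [hf.distortion_symm hwd, show fderiv ℝ (toPlane f) (toPlane f.symm w) = _ from hMuv w,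
        distortion_wirt hJw]
    have e4 : areaWeight h w = (J w)⁻¹ * eta (h w) := by
      rw [areaWeight, hf.jac_symm hwd, show jac (fderiv ℝ (toPlane f) (toPlane f.symm w)) = J w from
        hJjac w, abs_of_pos (inv_pos.2 (hJpos w hwd))]
    have e5 : b w * ahlforsHopf p h w =
        ((-(Real.exp (p * n₀ w) * (J w)⁻¹ ^ 2 * eta (h w)) : ℝ) : ℂ) *
          (b w * conj (u w * v w)) := by
      rw [ahlforsHopf, e1, e2, e3]
      push_cast
      simp only [map_div₀, map_neg, conj_ofReal, map_mul]
      ring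
    rw [e5, re_ofReal_mul, e4]
    simp only [hn1, hn0, hj1]
    field_simp
    ring
  rw [setIntegral_congr_fun hK.measurableSet hpt, integral_const_mul] at hzero
  exact (mul_eq_zero.1 hzero).resolve_left (by linarith)

/-- The Ahlfors–Hopf differential of the inverse of a smooth minimiser is holomorphic. -/
theorem dzbar_ahlforsHopf_eq_zero {p : ℝ} (hp : 0 < p) {Γ Γ' : Subgroup (Equiv.Perm Disk)}
    (hΓ : IsSurfaceGroup Γ) (hΓ' : IsSurfaceGroup Γ') {θ : Γ ≃* Γ'} {P : Set Disk}
    (hP : IsFundamentalDomain Γ P hypArea) (hf : IsDiffeo f)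
    (hmin : IsMinimiser θ p P f) {w : ℂ} (hw : w ∈ disk) :
    dzbar (ahlforsHopf p (toPlane f.symm)) w = 0 := by
  obtain ⟨r, hr, hrd, hmain⟩ := exists_ball_local_minimality hΓ hΓ' hP hf hmin hw
  set Φ := ahlforsHopf p (toPlane f.symm)
  set B := Metric.ball w r
  set K := Metric.closedBall w r
  have hBd : B ⊆ disk := Metric.ball_subset_closedBall.trans hrd
  have hBo : IsOpen B := Metric.isOpen_ball
  have hΦ : ContDiffOn ℝ ∞ Φ B := (contDiffOn_ahlforsHopf hf p).mono hBd
  have hΦ' : ContinuousOn (dzbar Φ) B := (contDiffOn_dzbar hBo hΦ).continuousOn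
  have hae : ∀ᵐ x, x ∈ B → dzbar Φ x = 0 := by
    refine hBo.ae_eq_zero_of_integral_contDiff_smul_eq_zero
      (hΦ'.locallyIntegrableOn hBo.measurableSet) fun g hg hgc hgs => ?_
    have hgC : ContDiff ℝ ∞ fun x => (g x : ℂ) := ofRealCLM.contDiff.comp hg
    -- Complex multiples of a real test function are allowed: `c = 1` and `c = -i` recover the real
    -- and imaginary parts of the integral.
    have hvar : ∀ c : ℂ, ∫ x in K, (c * (dzbar (fun x => (g x : ℂ)) x * Φ x)).re = 0 := by
      intro c
      have hsub : tsupport (fun x => c * (g x : ℂ)) ⊆ tsupport g := by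
        refine closure_mono fun x hx hx0 => hx ?_
        simp [hx0]
      have h1 := integral_re_dzbar_mul_ahlforsHopf hp hf
        (fun z hz => jac_pos_of_isMinimiser hp hΓ hΓ' hP hf hmin hz) hrd hmain
        (φ := fun x => c * (g x : ℂ)) (contDiff_const.mul hgC)
        (hgc.mono fun x hx hx0 => hx (by simp [hx0])) (hsub.trans hgs)
      have h2 : ∀ x, dzbar (fun x => c * (g x : ℂ)) x = c * dzbar (fun x => (g x : ℂ)) x := by
        intro x
        have hd := hasWirt_of_differentiableAt ((hgC.differentiable (by simp)) x)
        have := ((HasDerivAt.hasWirt (hasDerivAt_const x c)).mul hd).dzbar_eq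
        simpa using this
      rw [← h1]
      refine integral_congr_ae (Filter.Eventually.of_forall fun x => ?_)
      simp only [h2, mul_assoc]
      rfl
    have hgx : ∀ x v, fderiv ℝ (fun x => (g x : ℂ)) x v = (fderiv ℝ g x v : ℝ) := by
      intro x v
      have := (ofRealCLM.hasFDerivAt.comp x ((hg.differentiable (by simp)) x).hasFDerivAt).fderiv
      exact congrArg (fun A : ℂ →L[ℝ] ℂ => A v) this
    have hform : ∀ x, dzbar (fun x => (g x : ℂ)) x * Φ x =
        (2⁻¹ : ℂ) * (fderiv ℝ g x 1 • Φ x + I * (fderiv ℝ g x I • Φ x)) := by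
      intro x
      rw [dzbar, linZbar, hgx, hgx, real_smul, real_smul]
      ring
    have hsv : ∀ v : ℂ, tsupport (fun x => fderiv ℝ g x v) ⊆ tsupport g := fun v =>
      tsupport_fderiv_apply_subset ℝ v
    have hint : ∀ v : ℂ, Integrable fun x => fderiv ℝ g x v • Φ x := fun v =>
      integrable_smul_of_tsupport_subset hBo
        ((hg.continuous_fderiv (by simp)).clm_apply continuous_const) (hgc.fderiv_apply ℝ v)
        ((hsv v).trans hgs) hΦ.continuousOn
    have hintD : Integrable fun x => dzbar (fun x => (g x : ℂ)) x * Φ x := by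
      simp_rw [hform]
      exact ((hint 1).add ((hint I).const_mul I)).const_mul _
    have hKint : ∫ x in K, dzbar (fun x => (g x : ℂ)) x * Φ x = 0 := by
      have hre := hvar 1
      have him := hvar (-I)
      simp only [one_mul, neg_mul, neg_re, I_mul_re, neg_neg] at hre him
      have h3 : ∀ x : ℂ, reCLM x = x.re := fun _ => rfl
      have h4 : ∀ x : ℂ, imCLM x = x.im := fun _ => rfl
      apply Complex.ext
      · have := reCLM.integral_comp_comm hintD.integrableOn (μ := volume.restrict K)
        simp only [h3] at this
        rw [← this, hre, zero_re]
      · have := imCLM.integral_comp_comm hintD.integrableOn (μ := volume.restrict K)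
        simp only [h4] at this
        rw [← this, him, zero_im]
    have hall : ∫ x, dzbar (fun x => (g x : ℂ)) x * Φ x = 0 := by
      rw [← hKint, setIntegral_eq_integral_of_forall_compl_eq_zero]
      intro x hx
      have hxs : x ∉ tsupport g := fun h => hx (Metric.ball_subset_closedBall (hgs h))
      have hz : ∀ v, fderiv ℝ g x v = 0 := fun v =>
        image_eq_zero_of_notMem_tsupport (f := fun x => fderiv ℝ g x v) fun h => hxs (hsv v h)
      rw [hform, hz, hz]; simp
    simp_rw [hform] at hall
    rw [integral_const_mul, integral_add (hint 1) ((hint I).const_mul I), integral_const_mul,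
      integral_fderiv_smul_eq_neg hBo hg hgc hgs hΦ, integral_fderiv_smul_eq_neg hBo hg hgc hgs hΦ]
      at hall
    have hΦv : ∀ v : ℂ, ContinuousOn (fun x => fderiv ℝ Φ x v) B := fun v =>
      (hΦ.continuousOn_fderiv_of_isOpen hBo (by simp)).clm_apply continuousOn_const
    have hint' : ∀ v : ℂ, Integrable fun x => g x • fderiv ℝ Φ x v := fun v =>
      integrable_smul_of_tsupport_subset hBo hg.continuous hgc hgs (hΦv v)
    have hlast : ∀ x, g x • dzbar Φ x =
        (2⁻¹ : ℂ) * (g x • fderiv ℝ Φ x 1 + I * (g x • fderiv ℝ Φ x I)) := by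
      intro x
      rw [dzbar, linZbar]
      simp only [real_smul]
      ring
    simp_rw [hlast]
    rw [integral_const_mul, integral_add (hint' 1) ((hint' I).const_mul I), integral_const_mul]
    linear_combination -hall
  -- `Φ_w̄` is continuous, so vanishing almost everywhere on the ball means vanishing throughout it.
  have hEq := Measure.eqOn_open_of_ae_eq (μ := volume) (f := dzbar Φ) (g := fun _ => 0)
    ((ae_restrict_iff' hBo.measurableSet).2 hae) hBo hΦ' continuousOn_const
  exact hEq (Metric.mem_ball_self hr)

end

/-! ### The equations for `h` and `μ` -/

lemma HasWirt.add {F G : ℂ → ℂ} {a b c d z : ℂ} (hF : HasWirt F a b z) (hG : HasWirt G c d z) :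
    HasWirt (fun w => F w + G w) (a + c) (b + d) z := by
  refine (HasFDerivAt.add hF hG).congr_fderiv ?_
  ext v
  simp
  ring

lemma HasWirt.congr_of_eventuallyEq {F G : ℂ → ℂ} {a b z : ℂ} (hF : HasWirt F a b z)
    (h : G =ᶠ[nhds z] F) : HasWirt G a b z := HasFDerivAt.congr_of_eventuallyEq hF h

lemma norm_dzbar_lt {F : ℂ → ℂ} {z : ℂ} (h : 0 < jac (fderiv ℝ F z)) : ‖dzbar F z‖ < ‖dz F z‖ :=
  lt_of_pow_lt_pow_left₀ 2 (norm_nonneg _) (sub_pos.1 h)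

lemma dz_ne_zero {F : ℂ → ℂ} {z : ℂ} (h : 0 < jac (fderiv ℝ F z)) : dz F z ≠ 0 :=
  norm_pos_iff.1 ((norm_nonneg _).trans_lt (norm_dzbar_lt h))

lemma norm_beltrami_lt_one {F : ℂ → ℂ} {z : ℂ} (h : 0 < jac (fderiv ℝ F z)) :
    ‖beltrami F z‖ < 1 := by
  rw [beltrami, norm_div, div_lt_one (norm_pos_iff.2 (dz_ne_zero h))]
  exact norm_dzbar_lt h

lemma contDiffOn_beltrami {F : ℂ → ℂ} {U : Set ℂ} (hU : IsOpen U) (hF : ContDiffOn ℝ ∞ F U)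
    (hJ : ∀ z ∈ U, 0 < jac (fderiv ℝ F z)) : ContDiffOn ℝ ∞ (beltrami F) U := by
  have h := (contDiffOn_dzbar hU hF).mul
    ((contDiffOn_dz hU hF).inv fun z hz => dz_ne_zero (hJ z hz))
  exact h.congr fun z _ => div_eq_mul_inv _ _

lemma distortion_eq_beltrami {F : ℂ → ℂ} {z : ℂ} (h : 0 < jac (fderiv ℝ F z)) :
    distortion (fderiv ℝ F z) = (1 + ‖beltrami F z‖ ^ 2) / (1 - ‖beltrami F z‖ ^ 2) := by
  have h0 : ‖dz F z‖ ≠ 0 := norm_ne_zero_iff.2 (dz_ne_zero h)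
  have h1 : jac (fderiv ℝ F z) = ‖dz F z‖ ^ 2 - ‖dzbar F z‖ ^ 2 := rfl
  rw [distortion_of_jac_ne_zero h.ne']
  rw [h1] at h ⊢
  rw [beltrami, norm_div]
  change (‖dz F z‖ ^ 2 + ‖dzbar F z‖ ^ 2) / _ = _
  have h2 : 1 - (‖dzbar F z‖ / ‖dz F z‖) ^ 2 ≠ 0 := by
    intro h3
    have : ‖dz F z‖ ^ 2 - ‖dzbar F z‖ ^ 2 = ‖dz F z‖ ^ 2 * (1 - (‖dzbar F z‖ / ‖dz F z‖) ^ 2) := by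
      field_simp
    rw [h3, mul_zero] at this
    exact h.ne' this
  rw [div_eq_div_iff h.ne' h2]
  field_simp

lemma lam_pos {p : ℝ} {F : ℂ → ℂ} {z : ℂ} (hz : z ∈ disk) : 0 < lam p F z :=
  mul_pos (Real.exp_pos _) (eta_pos hz)

lemma contDiffOn_lam {f : Disk ≃ₜ Disk} (hf : IsDiffeo f) (p : ℝ) :
    ContDiffOn ℝ ∞ (lam p (toPlane f)) disk :=
  (Real.contDiff_exp.comp_contDiffOn (contDiffOn_const.mul
    (contDiffOn_distortion_fderiv isOpen_disk hf.1 fun _ hz => hf.jac_ne_zero hz))).mul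
    contDiffOn_eta

/-- Taking moduli gives `|b| |T| = |a| |T|`. It is used with `a = h_w` and `b = conj(h_w̄)`, where
`|b| < |a|` is positivity of the Jacobian. -/
lemma eq_zero_of_conj_mul_add {a b T : ℂ} (hab : ‖b‖ < ‖a‖) (h : b * T + a * conj T = 0) :
    T = 0 := by
  by_contra hT
  have h1 : ‖b‖ * ‖T‖ = ‖a‖ * ‖T‖ := by
    have := congrArg norm (eq_neg_of_add_eq_zero_left h)
    simpa using this
  exact hab.ne (mul_right_cancel₀ (norm_ne_zero_iff.2 hT) h1)

lemma hasWirt_log_lam {f : Disk ≃ₜ Disk} (hf : IsDiffeo f) (p : ℝ) {z : ℂ} (hz : z ∈ disk) :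
    HasWirt (fun ζ => (Real.log (lam p (toPlane f) ζ) : ℂ))
      (dz (fun ζ => (Real.log (lam p (toPlane f) ζ) : ℂ)) z)
      (conj (dz (fun ζ => (Real.log (lam p (toPlane f) ζ) : ℂ)) z)) z := by
  have hd : DifferentiableAt ℝ (fun ζ => Real.log (lam p (toPlane f) ζ)) z :=
    (((contDiffOn_lam hf p).contDiffAt (isOpen_disk.mem_nhds hz)).differentiableAt (by simp)).log
      (lam_pos hz).ne'
  rw [← dzbar_ofReal hd]
  exact hasWirt_of_differentiableAt (ofRealCLM.differentiableAt.comp z hd)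

/-- Holomorphy of the Ahlfors–Hopf differential implies the tension equation. -/
theorem tensionEquation_of_dzbar_ahlforsHopf {f : Disk ≃ₜ Disk} (hf : IsDiffeo f) {p : ℝ} {w : ℂ}
    (hw : w ∈ disk) (hpos : 0 < jac (fderiv ℝ (toPlane f.symm) w))
    (hΦ : dzbar (ahlforsHopf p (toPlane f.symm)) w = 0) :
    TensionEquation (lam p (toPlane f)) (toPlane f.symm) w := by
  set h := toPlane f.symm with hh
  have hn := isOpen_disk.mem_nhds hw
  have d0 : HasWirt h (dz h w) (dzbar h w) w :=
    hasWirt_of_differentiableAt ((hf.2.contDiffAt hn).differentiableAt (by simp))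
  have d1 : HasWirt (dz h) (dz (dz h) w) (dzbar (dz h) w) w := hasWirt_of_differentiableAt
    (((contDiffOn_dz isOpen_disk hf.2).contDiffAt hn).differentiableAt (by simp))
  have d2 : HasWirt (dzbar h) (dzbar (dz h) w) (dzbar (dzbar h) w) w := by
    rw [← dzbar_dz_comm ((hf.2.contDiffAt hn).of_le ENat.LEInfty.out)]
    exact hasWirt_of_differentiableAt
      (((contDiffOn_dzbar isOpen_disk hf.2).contDiffAt hn).differentiableAt (by simp))
  have d3 := HasWirt.comp (G := h) (hasWirt_log_lam hf p (toPlane_mem f.symm hw)) d0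
  have d4 := d3.ofReal_comp (Real.hasDerivAt_exp _)
  have d5 := (d4.mul d1).mul d2.conj
  have heq : ahlforsHopf p h =ᶠ[nhds w] fun x =>
      ((Real.exp (Real.log (lam p (toPlane f) (h x))) : ℝ) : ℂ) * dz h x * conj (dzbar h x) := by
    filter_upwards [hn] with x hx
    rw [Real.exp_log (lam_pos (toPlane_mem f.symm hx)), ahlforsHopf, lam, hf.distortion_symm hx]
    push_cast
    ring
  -- By the product rule this is `Φ_w̄ = λ(h) (conj(h_w̄) T + h_w conj T)`, with `T` the tension
  -- expression.
  have d6 := (d5.congr_of_eventuallyEq heq).dzbar_eq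
  rw [hΦ, Real.exp_log (lam_pos (toPlane_mem f.symm hw))] at d6
  have hl : ((lam p (toPlane f) (h w) : ℝ) : ℂ) ≠ 0 :=
    ofReal_ne_zero.2 (lam_pos (toPlane_mem f.symm hw)).ne'
  rw [TensionEquation]
  set ℓ := dz (fun ζ => (Real.log (lam p (toPlane f) ζ) : ℂ)) (h w)
  refine eq_zero_of_conj_mul_add (a := dz h w) (b := conj (dzbar h w)) ?_ ?_
  · rw [norm_conj]; exact norm_dzbar_lt hpos
  · apply mul_left_cancel₀ hl
    simp only [map_add, map_mul]
    linear_combination -d6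

/-- The Beltrami equation of the inverse map; its `w`-derivative is what relates `μ` to `h_{w w̄}`.
-/
lemma dzbar_symm_eq_beltrami {f : Disk ≃ₜ Disk} (hf : IsDiffeo f)
    (hpos : ∀ z ∈ disk, 0 < jac (fderiv ℝ (toPlane f) z)) {w : ℂ} (hw : w ∈ disk) :
    dzbar (toPlane f.symm) w =
      -(beltrami (toPlane f) (toPlane f.symm w) * conj (dz (toPlane f.symm) w)) := by
  have h0 := dz_ne_zero (hpos _ (toPlane_mem f.symm hw))
  rw [hf.dzbar_symm hw, hf.dz_symm hw, beltrami, map_div₀, conj_conj, conj_ofReal]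
  field_simp

/-- The tension equation in terms of the Beltrami coefficient of the inverse map. -/
lemma beltrami_equation_of_tensionEquation {f : Disk ≃ₜ Disk} (hf : IsDiffeo f) {p : ℝ}
    (hpos : ∀ z ∈ disk, 0 < jac (fderiv ℝ (toPlane f) z))
    (hT : ∀ w ∈ disk, TensionEquation (lam p (toPlane f)) (toPlane f.symm) w) {z : ℂ}
    (hz : z ∈ disk) :
    dz (beltrami (toPlane f)) z - dzbar (beltrami (toPlane f)) z * conj (beltrami (toPlane f) z) +
      beltrami (toPlane f) z * dz (fun ζ => (Real.log (lam p (toPlane f) ζ) : ℂ)) z +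
      beltrami (toPlane f) z * conj (beltrami (toPlane f) z) *
        conj (dz (fun ζ => (Real.log (lam p (toPlane f) ζ) : ℂ)) z) = 0 := by
  set h := toPlane f.symm with hh
  set w := toPlane f z with hwdef
  have hw : w ∈ disk := toPlane_mem f hz
  have hzw : h w = z := toPlane_symm_toPlane f hz
  have hn := isOpen_disk.mem_nhds hw
  have hTw := hT w hw
  rw [TensionEquation, hzw] at hTw
  set μ := beltrami (toPlane f) with hμ
  set ℓ := dz (fun ζ => (Real.log (lam p (toPlane f) ζ) : ℂ)) z
  have hb := dzbar_symm_eq_beltrami hf hpos hw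
  rw [← hh, hzw] at hb
  have hw0 : dz h w ≠ 0 := by
    have : 0 < jac (fderiv ℝ h w) := by
      rw [hf.jac_symm hw]; exact inv_pos.2 (hpos _ (toPlane_mem f.symm hw))
    exact dz_ne_zero this
  have d0 : HasWirt h (dz h w) (dzbar h w) w :=
    hasWirt_of_differentiableAt ((hf.2.contDiffAt hn).differentiableAt (by simp))
  have d1 : HasWirt (dz h) (dz (dz h) w) (dzbar (dz h) w) w := hasWirt_of_differentiableAt
    (((contDiffOn_dz isOpen_disk hf.2).contDiffAt hn).differentiableAt (by simp))
  have d2 : HasWirt μ (dz μ z) (dzbar μ z) (h w) := by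
    rw [hzw]
    exact hasWirt_of_differentiableAt (((contDiffOn_beltrami isOpen_disk hf.1 hpos).contDiffAt
      (isOpen_disk.mem_nhds hz)).differentiableAt (by simp))
  have d3 := ((HasWirt.comp d2 d0).mul d1.conj).neg
  have heq : dzbar h =ᶠ[nhds w] fun x => -(μ (h x) * conj (dz h x)) := by
    filter_upwards [hn] with x hx
    exact dzbar_symm_eq_beltrami hf hpos hx
  have d4 := (d3.congr_of_eventuallyEq heq).dz_eq
  rw [dzbar_dz_comm ((hf.2.contDiffAt hn).of_le ENat.LEInfty.out), hb, hzw] at d4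
  rw [hb] at hTw
  have hTc := congrArg conj hTw
  simp only [map_add, map_mul, map_neg, map_zero, conj_conj] at hTc d4
  have hc : dz h w * conj (dz h w) ≠ 0 := mul_ne_zero hw0 (by simpa using hw0)
  apply mul_left_cancel₀ hc
  -- The tension equation and its conjugate remove `h_{w w̄}` and its conjugate from the
  -- differentiated identity; the common factor `|h_w|²` has been cancelled.
  linear_combination -hTw + d4 - μ z * hTc

/-- Here `log λ = p (1 + |μ|²)/(1 - |μ|²) + log η`, and `s ↦ (1 + s)/(1 - s)` has derivative `2/(1 -
s)²`. -/
lemma dz_log_lam {f : Disk ≃ₜ Disk} (hf : IsDiffeo f) (p : ℝ)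
    (hpos : ∀ z ∈ disk, 0 < jac (fderiv ℝ (toPlane f) z)) {z : ℂ} (hz : z ∈ disk) :
    dz (fun ζ => (Real.log (lam p (toPlane f) ζ) : ℂ)) z =
      ((p * (2 / (1 - ‖beltrami (toPlane f) z‖ ^ 2) ^ 2) : ℝ) : ℂ) *
        (dz (beltrami (toPlane f)) z * conj (beltrami (toPlane f) z) +
          beltrami (toPlane f) z * conj (dzbar (beltrami (toPlane f)) z)) +
      dz (fun ζ => (eta ζ : ℂ)) z / eta z := by
  have hn := isOpen_disk.mem_nhds hz
  set μ := beltrami (toPlane f) with hμ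
  have hlt : ∀ x ∈ disk, 1 - ‖μ x‖ ^ 2 ≠ 0 := fun x hx => by
    have := norm_beltrami_lt_one (hpos x hx)
    have h0 := norm_nonneg (beltrami (toPlane f) x)
    have : 0 < 1 - ‖μ x‖ ^ 2 := by rw [hμ]; nlinarith
    exact this.ne'
  have d1 : HasWirt μ (dz μ z) (dzbar μ z) z := hasWirt_of_differentiableAt
    (((contDiffOn_beltrami isOpen_disk hf.1 hpos).contDiffAt hn).differentiableAt (by simp))
  have hk : HasDerivAt (fun s : ℝ => p * ((1 + s) / (1 - s)))
      (p * (2 / (1 - ‖μ z‖ ^ 2) ^ 2)) (‖μ z‖ ^ 2) := by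
    have h1 := ((hasDerivAt_id (‖μ z‖ ^ 2)).const_add 1).div
      ((hasDerivAt_id (‖μ z‖ ^ 2)).const_sub 1) (hlt z hz)
    refine (h1.const_mul p).congr_deriv ?_
    simp only [id_eq]
    ring
  have d2 := d1.norm_sq.ofReal_comp hk
  have hη : DifferentiableAt ℝ eta z :=
    (contDiffOn_eta.contDiffAt hn).differentiableAt (by simp)
  have d3 : HasWirt (fun ζ => (eta ζ : ℂ)) (dz (fun ζ => (eta ζ : ℂ)) z)
      (dzbar (fun ζ => (eta ζ : ℂ)) z) z :=
    hasWirt_of_differentiableAt (ofRealCLM.differentiableAt.comp z hη)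
  have d4 := d3.ofReal_comp (Real.hasDerivAt_log (eta_pos hz).ne')
  have heq : (fun ζ => (Real.log (lam p (toPlane f) ζ) : ℂ)) =ᶠ[nhds z] fun ζ =>
      ((p * ((1 + ‖μ ζ‖ ^ 2) / (1 - ‖μ ζ‖ ^ 2)) : ℝ) : ℂ) + (Real.log (eta ζ) : ℂ) := by
    filter_upwards [hn] with x hx
    rw [lam, Real.log_mul (Real.exp_pos _).ne' (eta_pos hx).ne', Real.log_exp,
      distortion_eq_beltrami (hpos x hx)]
    push_cast
    ring
  rw [((d2.add d4).congr_of_eventuallyEq heq).dz_eq]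
  push_cast
  ring

/-- The nonlinear equation for the Beltrami coefficient. -/
theorem muEquation_of_tensionEquation {f : Disk ≃ₜ Disk} (hf : IsDiffeo f) {p : ℝ}
    (hpos : ∀ z ∈ disk, 0 < jac (fderiv ℝ (toPlane f) z))
    (hT : ∀ w ∈ disk, TensionEquation (lam p (toPlane f)) (toPlane f.symm) w) {z : ℂ}
    (hz : z ∈ disk) : MuEquation p (beltrami (toPlane f)) z := by
  have hE := beltrami_equation_of_tensionEquation hf hpos hT hz
  rw [dz_log_lam hf p hpos hz] at hE
  have hlt := norm_beltrami_lt_one (hpos z hz)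
  have hη : DifferentiableAt ℝ eta z :=
    (contDiffOn_eta.contDiffAt (isOpen_disk.mem_nhds hz)).differentiableAt (by simp)
  rw [MuEquation, phiTerm, dzbar_ofReal hη]
  set μ := beltrami (toPlane f) z
  set m := dz (beltrami (toPlane f)) z
  set n := dzbar (beltrami (toPlane f)) z
  have hs : (‖μ‖ : ℂ) ^ 2 = μ * conj μ := by
    rw [Complex.mul_conj, normSq_eq_norm_sq]; push_cast; ring
  have hs4 : (‖μ‖ : ℂ) ^ 4 = (μ * conj μ) ^ 2 := by rw [← hs]; ring
  have hs6 : (‖μ‖ : ℂ) ^ 6 = (μ * conj μ) ^ 3 := by rw [← hs]; ring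
  have hne : (1 - μ * conj μ : ℂ) ≠ 0 := by
    rw [← hs]
    have : (1 - ‖μ‖ ^ 2 : ℝ) ≠ 0 := by nlinarith [norm_nonneg μ]
    exact_mod_cast this
  have heta : (eta z : ℂ) ≠ 0 := ofReal_ne_zero.2 (eta_pos hz).ne'
  have hconj : conj (dz (fun ζ => (eta ζ : ℂ)) z) / (eta z : ℂ) =
      conj (dz (fun ζ => (eta ζ : ℂ)) z / (eta z : ℂ)) := by
    rw [map_div₀, conj_ofReal]
  rw [hconj]
  set e := dz (fun ζ => (eta ζ : ℂ)) z / (eta z : ℂ)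
  simp only [gammaCoeff, alphaCoeff, betaCoeff]
  push_cast at hE ⊢
  simp only [map_add, map_mul, map_div₀, map_pow, map_sub, map_one, conj_ofReal, conj_conj,
    map_ofNat] at hE
  rw [hs] at hE
  rw [hs, hs4, hs6]
  have hE1 : (1 - μ * conj μ) ^ 2 * (m - n * conj μ) +
      2 * p * (μ * (m * conj μ + μ * conj n) + μ * conj μ * (conj m * μ + conj μ * n)) +
      (1 - μ * conj μ) ^ 2 * (μ * e + μ * conj μ * conj e) = 0 := by
    have hq : (2 : ℂ) / (1 - μ * conj μ) ^ 2 * (1 - μ * conj μ) ^ 2 = 2 :=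
      div_mul_cancel₀ _ (pow_ne_zero 2 hne)
    set q : ℂ := 2 / (1 - μ * conj μ) ^ 2
    linear_combination (1 - μ * conj μ) ^ 2 * hE - p * (μ * (m * conj μ + μ * conj n) +
      μ * conj μ * (conj m * μ + conj μ * n)) * hq
  have hE2 := congrArg conj hE1
  simp only [map_add, map_mul, map_pow, map_sub, map_one, conj_ofReal, conj_conj, map_ofNat,
    map_zero] at hE2
  -- With `s = |μ|²` and `A = (1-s)² + 2ps`, the unknowns `μ_z` and `conj(μ_z)` enter `hE1` with
  -- coefficients `A` and `2psμ`. Combining with the conjugate equation to eliminate `conj(μ_z)`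
  -- leaves `A² - 4p²s³ = (1-s) γ` before `μ_z`, which explains the factor `1 - s` cancelled here.
  apply mul_left_cancel₀ hne
  linear_combination ((1 - μ * conj μ) ^ 2 + 2 * p * (μ * conj μ)) * hE1 -
    2 * p * (μ * conj μ) * μ * hE2

/-- The argument of the Beltrami coefficient is that of the conjugate Ahlfors–Hopf differential. -/
lemma beltrami_of_ahlforsHopf {p : ℝ} {H : ℂ → ℂ} {w : ℂ} (hH : H w ∈ disk)
    (hpos : 0 < jac (fderiv ℝ H w)) :
    (ahlforsHopf p H w = 0 → beltrami H w = 0) ∧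
      (ahlforsHopf p H w ≠ 0 → beltrami H w =
        ‖beltrami H w‖ * (conj (ahlforsHopf p H w) / ‖ahlforsHopf p H w‖)) := by
  have h0 := dz_ne_zero hpos
  set k : ℝ := Real.exp (p * distortion (fderiv ℝ H w)) * eta (H w) with hk
  have hk0 : 0 < k := mul_pos (Real.exp_pos _) (eta_pos hH)
  have hkc : (k : ℂ) ≠ 0 := ofReal_ne_zero.2 hk0.ne'
  have hΦ : ahlforsHopf p H w = k * (dz H w * conj (dzbar H w)) := by
    rw [ahlforsHopf, hk]; push_cast; ring
  rw [hΦ]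
  constructor
  · intro h
    have : dzbar H w = 0 := by simpa [hkc, h0] using h
    rw [beltrami, this, zero_div]
  · intro h
    have hb : dzbar H w ≠ 0 := by rintro hb; simp [hb] at h
    have n0 : (‖dz H w‖ : ℂ) ≠ 0 := ofReal_ne_zero.2 (norm_ne_zero_iff.2 h0)
    have nb : (‖dzbar H w‖ : ℂ) ≠ 0 := ofReal_ne_zero.2 (norm_ne_zero_iff.2 hb)
    have hs : (‖dz H w‖ : ℂ) ^ 2 = dz H w * conj (dz H w) := by
      rw [Complex.mul_conj, normSq_eq_norm_sq]; push_cast; ring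
    simp only [beltrami, norm_div, norm_mul, norm_conj, norm_real, Real.norm_eq_abs,
      abs_of_pos hk0, map_mul, conj_ofReal, conj_conj]
    push_cast
    field_simp
    rw [hs]

/-! ### The tension field in coordinates -/

lemma pd_const (i : Fin 2) (c : ℝ) (z : ℂ) : pd i (fun _ => c) z = 0 := by
  simp [pd]

lemma christoffel_conformalMetric_one (k i j : Fin 2) (z : ℂ) :
    christoffel (conformalMetric fun _ => 1) k i j z = 0 := by
  simp [christoffel, conformalMetric, pd_const]

lemma conformalMetric_inv {l : ℂ → ℝ} {z : ℂ} (h : l z ≠ 0) :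
    (conformalMetric l z)⁻¹ = (l z)⁻¹ • (1 : Matrix (Fin 2) (Fin 2) ℝ) := by
  refine Matrix.inv_eq_left_inv ?_
  rw [conformalMetric, Matrix.smul_mul, Matrix.one_mul, smul_smul, inv_mul_cancel₀ h, one_smul]

lemma pd_conformalMetric (l : ℂ → ℝ) (m i j : Fin 2) (z : ℂ) :
    pd m (fun ζ => conformalMetric l ζ i j) z = if i = j then pd m l z else 0 := by
  by_cases h : i = j
  · subst h
    simp [conformalMetric]
  · simp [conformalMetric, Matrix.one_apply_ne h, h, pd_const]

/-- Only the diagonal term of the inverse metric survives, so the symbols depend on the first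
derivatives of `log l` alone; this is how `(log l)_z` enters the tension field. -/
lemma christoffel_conformalMetric {l : ℂ → ℝ} {z : ℂ} (h : l z ≠ 0) (k i j : Fin 2) :
    christoffel (conformalMetric l) k i j z = 1 / 2 * ((l z)⁻¹ *
      ((if j = k then pd i l z else 0) + (if i = k then pd j l z else 0) -
        if i = j then pd k l z else 0)) := by
  rw [christoffel, conformalMetric_inv h]
  simp only [pd_conformalMetric]
  rw [Finset.sum_eq_single k]
  · simp
  · intro b _ hb
    simp [Matrix.one_apply_ne hb.symm]
  · simp

lemma isMetricOn_conformalMetric {U : Set ℂ} {l : ℂ → ℝ} (hl : ContDiffOn ℝ ∞ l U)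
    (hpos : ∀ z ∈ U, 0 < l z) : IsMetricOn U (conformalMetric l) := by
  refine ⟨fun i j => ?_, fun z hz => ?_⟩
  · exact hl.mul contDiffOn_const
  · exact Matrix.PosDef.one.smul (hpos z hz)

/-- The coordinate functions as continuous linear maps. -/
def coordCLM (k : Fin 2) : ℂ →L[ℝ] ℝ := ![reCLM, imCLM] k

lemma coord_eq (k : Fin 2) : coord k = coordCLM k := by
  funext z
  fin_cases k <;> rfl

lemma pd_coord {H : ℂ → ℂ} {w : ℂ} (h : DifferentiableAt ℝ H w) (a k : Fin 2) :
    pd a (fun ζ => coord k (H ζ)) w = coord k (fderiv ℝ H w (coordVec a)) := by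
  have := ((coordCLM k).hasFDerivAt.comp w h.hasFDerivAt).fderiv
  rw [pd, coord_eq]
  exact congrArg (fun A : ℂ →L[ℝ] ℝ => A (coordVec a)) this

lemma pd_pd_coord {H : ℂ → ℂ} {w : ℂ} (h : ContDiffAt ℝ 2 H w) (a b k : Fin 2) :
    pd a (pd b fun ζ => coord k (H ζ)) w =
      coord k (fderiv ℝ (fderiv ℝ H) w (coordVec a) (coordVec b)) := by
  have hd : DifferentiableAt ℝ (fderiv ℝ H) w :=
    (h.fderiv_right (m := 1) (by norm_num)).differentiableAt (by norm_num)
  have hv : HasFDerivAt (fun x => coordCLM k (fderiv ℝ H x (coordVec b)))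
      ((coordCLM k).comp ((ContinuousLinearMap.apply ℝ ℂ (coordVec b)).comp
        (fderiv ℝ (fderiv ℝ H) w))) w :=
    (coordCLM k).hasFDerivAt.comp w
      ((ContinuousLinearMap.apply ℝ ℂ (coordVec b)).hasFDerivAt.comp w hd.hasFDerivAt)
  have heq : (pd b fun ζ => coord k (H ζ)) =ᶠ[nhds w]
      fun x => coordCLM k (fderiv ℝ H x (coordVec b)) := by
    filter_upwards [h.eventually (by simp)] with x hx
    rw [pd_coord (hx.differentiableAt (by norm_num)), coord_eq]
  rw [pd, (hv.congr_of_eventuallyEq heq).fderiv, coord_eq]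
  rfl

/-- `4 F_{z z̄}` is the Laplacian. -/
lemma dzbar_dz_eq_laplacian {F : ℂ → ℂ} {z : ℂ} (h : ContDiffAt ℝ 2 F z) :
    dzbar (dz F) z =
      (fderiv ℝ (fderiv ℝ F) z 1 1 + fderiv ℝ (fderiv ℝ F) z I I) / 4 := by
  have hs := h.isSymmSndFDerivAt (by simp)
  have hd : DifferentiableAt ℝ (fderiv ℝ F) z :=
    (h.fderiv_right (m := 1) (by norm_num)).differentiableAt (by norm_num)
  have h1 := ((contDiff_linZ (n := 1)).differentiable (by simp) (fderiv ℝ F z)).hasFDerivAt.comp z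
    hd.hasFDerivAt
  have hlin : ∀ A B : ℂ →L[ℝ] ℂ, fderiv ℝ linZ A B = linZ B := by
    intro A B
    have hv : ∀ v, HasFDerivAt (fun A : ℂ →L[ℝ] ℂ => A v) (ContinuousLinearMap.apply ℝ ℂ v) A :=
      fun v => (ContinuousLinearMap.apply ℝ ℂ v).hasFDerivAt
    have h2 : HasFDerivAt linZ ((2⁻¹ : ℂ) • (ContinuousLinearMap.apply ℝ ℂ (1 : ℂ) -
        I • ContinuousLinearMap.apply ℝ ℂ I)) A := by
      refine (((hv 1).sub ((hv I).const_mul I)).const_mul (2⁻¹ : ℂ)).congr_of_eventuallyEq ?_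
      exact Filter.Eventually.of_forall fun B => by simp [linZ]; ring
    rw [h2.fderiv]
    simp [linZ]
    ring
  have e : fderiv ℝ (dz F) z = _ := h1.fderiv
  have hsym := hs.eq 1 I
  rw [dzbar, e, linZbar]
  simp only [ContinuousLinearMap.comp_apply, hlin, linZ, hsym]
  linear_combination (-(fderiv ℝ (fderiv ℝ F) z I I) / 4) * I_sq

lemma dz_ofReal {u : ℂ → ℝ} {z : ℂ} (h : DifferentiableAt ℝ u z) :
    dz (fun w => (u w : ℂ)) z = (pd 0 u z - I * pd 1 u z) / 2 := by
  have h2 : fderiv ℝ (fun w => (u w : ℂ)) z = ofRealCLM.comp (fderiv ℝ u z) :=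
    (ofRealCLM.hasFDerivAt.comp z h.hasFDerivAt).fderiv
  simp [dz, h2, linZ, pd, coordVec]

lemma pd_log {u : ℂ → ℝ} {z : ℂ} (h : DifferentiableAt ℝ u z) (h0 : u z ≠ 0) (i : Fin 2) :
    pd i (fun w => Real.log (u w)) z = (u z)⁻¹ * pd i u z := by
  rw [pd, (h.hasFDerivAt.log h0).fderiv, pd]
  simp

/-- For a conformal target metric, the tension equation says that the tension field vanishes. -/
theorem tension_eq_zero_of_tensionEquation {l : ℂ → ℝ} {H : ℂ → ℂ} {w : ℂ}
    (hH : ContDiffAt ℝ 2 H w) (hl : DifferentiableAt ℝ l (H w)) (h0 : l (H w) ≠ 0)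
    (hT : TensionEquation l H w) (k : Fin 2) :
    tension (conformalMetric fun _ => 1) (conformalMetric l) H k w = 0 := by
  have hd : DifferentiableAt ℝ H w := hH.differentiableAt (by norm_num)
  rw [TensionEquation, dzbar_dz_eq_laplacian hH, dz_ofReal (hl.log h0), pd_log hl h0,
    pd_log hl h0, dz, dzbar, linZ, linZbar] at hT
  simp only [tension, christoffel_conformalMetric_one, zero_mul, Finset.sum_const_zero, sub_zero,
    christoffel_conformalMetric h0, pd_pd_coord hH, pd_coord hd,
    conformalMetric_inv (l := fun _ => 1) (z := w) one_ne_zero, Fin.sum_univ_two]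
  simp only [coordVec, coord, Matrix.cons_val_zero, Matrix.cons_val_one, inv_one, one_smul,
    Matrix.one_apply_eq]
  have hre := congrArg re hT
  have him := congrArg im hT
  simp only [add_re, add_im, mul_re, mul_im, sub_re, sub_im, div_ofNat_re, div_ofNat_im, I_re, I_im,
    ofReal_re, ofReal_im, zero_re, zero_im] at hre him
  -- The two components of the tension field are four times the real and imaginary parts of the
  -- tension equation, as the Laplacian is `4 H_{w w̄}`.
  obtain rfl | rfl : k = 0 ∨ k = 1 := by fin_cases k <;> simp
  · simp
    linear_combination 4 * hre
  · simp
    linear_combination 4 * him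

end

end ExpDistortion

/-! ### Assembly of the four conclusions -/

theorem theorem2p4
    (p : ℝ) (hp : 0 < p)
    (Γ Γ' : Subgroup (Equiv.Perm Disk)) (hΓ : IsSurfaceGroup Γ) (hΓ' : IsSurfaceGroup Γ')
    (θ : Γ ≃* Γ')
    (P : Set Disk) (hP : IsFundamentalDomain Γ P hypArea)
    (f : Disk ≃ₜ Disk) (hf : IsDiffeo f) (hmin : IsMinimiser θ p P f) :
    -- `μ_f` is a smooth function with `|μ_f| < 1`, and it satisfies the nonlinear equation
    ((∀ z ∈ disk, dz (toPlane f) z ≠ 0 ∧ ‖beltrami (toPlane f) z‖ < 1) ∧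
      ContDiffOn ℝ ∞ (beltrami (toPlane f)) disk ∧
      ∀ z ∈ disk, MuEquation p (beltrami (toPlane f)) z) ∧
    -- `Φ` is holomorphic and `μ_h = |μ_h| conj Φ / |Φ|`
    (DifferentiableOn ℂ (ahlforsHopf p (toPlane f.symm)) disk ∧
      ∀ w ∈ disk, dz (toPlane f.symm) w ≠ 0 ∧
        (ahlforsHopf p (toPlane f.symm) w = 0 → beltrami (toPlane f.symm) w = 0) ∧
        (ahlforsHopf p (toPlane f.symm) w ≠ 0 →
          beltrami (toPlane f.symm) w =
            ‖beltrami (toPlane f.symm) w‖ *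
              (conj (ahlforsHopf p (toPlane f.symm) w) / ‖ahlforsHopf p (toPlane f.symm) w‖))) ∧
    -- the tension equation for `h`
    (∀ w ∈ disk, TensionEquation (lam p (toPlane f)) (toPlane f.symm) w) ∧
    -- `h` is a harmonic map from the disk to the disk with the metric `λ |dz|²`
    IsHarmonicMap disk (conformalMetric fun _ => 1) disk (conformalMetric (lam p (toPlane f)))
      (toPlane f.symm) := by
  have hpos : ∀ z ∈ disk, 0 < jac (fderiv ℝ (toPlane f) z) := fun z hz =>
    jac_pos_of_isMinimiser hp hΓ hΓ' hP hf hmin hz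
  have hpos' : ∀ w ∈ disk, 0 < jac (fderiv ℝ (toPlane f.symm) w) := fun w hw => by
    rw [hf.jac_symm hw]; exact inv_pos.2 (hpos _ (toPlane_mem _ hw))
  have hΦ : ∀ w ∈ disk, dzbar (ahlforsHopf p (toPlane f.symm)) w = 0 := fun w hw =>
    dzbar_ahlforsHopf_eq_zero hp hΓ hΓ' hP hf hmin hw
  have hT : ∀ w ∈ disk, TensionEquation (lam p (toPlane f)) (toPlane f.symm) w := fun w hw =>
    tensionEquation_of_dzbar_ahlforsHopf hf hw (hpos' w hw) (hΦ w hw)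
  refine ⟨⟨fun z hz => ⟨dz_ne_zero (hpos z hz), norm_beltrami_lt_one (hpos z hz)⟩,
    contDiffOn_beltrami isOpen_disk hf.1 hpos,
    fun z hz => muEquation_of_tensionEquation hf hpos hT hz⟩,
    ⟨fun w hw => ?_, fun w hw => ⟨dz_ne_zero (hpos' w hw),
      beltrami_of_ahlforsHopf (toPlane_mem _ hw) (hpos' w hw)⟩⟩, hT, ?_⟩
  · exact (differentiableAt_of_dzbar_eq_zero (((contDiffOn_ahlforsHopf hf p).contDiffAt
      (isOpen_disk.mem_nhds hw)).differentiableAt (by simp)) (hΦ w hw)).differentiableWithinAt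
  · exact
      { metric_source := isMetricOn_conformalMetric contDiffOn_const fun _ _ => one_pos
        metric_target := isMetricOn_conformalMetric (contDiffOn_lam hf p) fun _ hz => lam_pos hz
        mapsTo := fun w hw => toPlane_mem _ hw
        smooth := hf.2
        tension_eq_zero := fun w hw k => tension_eq_zero_of_tensionEquation
          ((hf.2.contDiffAt (isOpen_disk.mem_nhds hw)).of_le ENat.LEInfty.out)
          (((contDiffOn_lam hf p).contDiffAt
            (isOpen_disk.mem_nhds (toPlane_mem _ hw))).differentiableAt (by simp))
          (lam_pos (toPlane_mem _ hw)).ne' (hT w hw) k }
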